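/- **Setting.** Let $\pi:\Sigma\to C$ be a branched cover of oriented surfaces (Riemann surfaces) of degree $K\ge 3$ with simple branching over a closed discrete set $B\subset C$, and put $C'=C\setminus B$. Let $\widetilde\Sigma$ be the bundle of non-zero tangent vectors of $\Sigma$ (homotopy equivalent to the unit tangent bundle). *Charges.* To a singular 1-chain $c$ on $\widetilde\Sigma$, taken modulo boundaries, attach a formal variable $X_c$ with $X_cX_{c'}=X_{c+c'}$ and $X_H=-1$ for the class $H$ of each circle fibre. Solitons are counted by formal series in these variables, graded by the number of simpletons (formal variable $T$) of which a soliton is composed. *Streets.* A framed street $p$ of type $ij$ is a path in $C$, embedded in $C'$ except that its ends may lie in $B$, with lifts $p\{i\},p\{j\}$ to two sheets, together with the lifts to $\widetilde\Sigma$ of a framing (for $p\{i\}$) and of the opposite framing (for $p\{j\}$). Write $\mathbf p=[p\{j\}]-[p\{i\}]$ for the difference of the framed lifts, a 1-chain on $\widetilde\Sigma$, and $p_\Sigma=[p\{j\}]-[p\{i\}]\in C_1(\Sigma;\mathbb Z)$ for its push-forward to $\Sigma$. The series $\Upsilon_p,\Delta_p$ count the solitons of types $ij$ and $ji$ at the start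 of $p$; at its end they become $X_{\mathbf p}\Upsilon_p$ and $X_{-\mathbf p}\Delta_p$. Put $Q(p)=1+\Upsilon_p\Delta_p$. The street is two-way if $\Upsilon_p\neq0$ and $\Delta_p\neq 0$. *Networks.* At a joint up to six streets meet, on three sheets $1,2,3$: in the slot $ij$ either a street of type $ij$ starts or a street of type $ji$ ends. Let $\tau_{ij}$ be the outgoing series of type $ij$ (on the slot $ij$) and $\nu_{ij}$ the incoming one (on the slot $ji$), and let $\eta=X_h$ with $h$ the half rotation of the framing vector on sheet $2$. In a spectral network $$\tau_{12}=\nu_{12}+\eta\tau_{13}\nu_{32},\quad \tau_{23}=\nu_{23}+\eta\tau_{21}\nu_{13},\quad \tau_{31}=\nu_{31}+\eta\tau_{32}\nu_{21},$$ $$\tau_{21}=\nu_{21}+\eta^{-1}\nu_{23}\tau_{31},\quad \tau_{32}=\nu_{32}+\eta^{-1}\nu_{31}\tau_{12},\quad \tau_{13}=\nu_{13}+\eta^{-1}\nu_{12}\tau_{23}$$ at every joint. A street emanating from a branch point from which no other two-way street emanates carries exactly one outgoing soliton there, the simpleton (series $T$; the two lifts coincide at the branch point). No solitons come in at a free end.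 *Horses.* A horse consists of four joints $J_1,\dots,J_4$ and streets $a_1,a_2,a_3,\bar a_1,\bar a_2,\bar a_3$ of type $12$, $b_1,b_2,b_3,\bar b_1,\bar b_2,\bar b_3$ of type $23$ and $c$ of type $13$, such that: at $J_1$ the streets $a_1,b_1$ end and $a_2,b_2,c$ start; at $J_2$ the streets $a_2,\bar b_3$ end and $a_3,\bar b_2$ start; at $J_3$ the streets $\bar a_3,b_2$ end and $\bar a_2,b_3$ start; at $J_4$ the streets $\bar a_2,\bar b_2,c$ end and $\bar a_1,\bar b_1$ start. Streets of the horse may cross one-way background streets that do not affect their soliton series, and the remaining streets of types $13$ and $31$ at the four joints bring in no solitons. *Herds.* An $m$-herd is a spectral network with $m$ horses, $l=1,\dots,m$, in embedded open discs $U_l\subset C'$. These discs cover the two-way streets (away from branch points), and for $l\ne k$ they satisfy $U_l\cap U_k\ne\emptyset$ iff $|l-k|=1$. The disc $U_l$ contains the joints and the streets $a_2,b_2,\bar a_2,\bar b_2,c$ of the $l$-th horse, with the sheets $1,2,3$ constant over $U_l$. Moreover: - every two-way street is a horse street, and each $c^{(l)}$ is two-way; - $a_1^{(l+1)}=a_3^{(l)}$,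 $b_1^{(l+1)}=b_3^{(l)}$, $\bar a_1^{(l)}=\bar a_3^{(l+1)}$, $\bar b_1^{(l)}=\bar b_3^{(l+1)}$ for $1\le l<m$, and no further horse streets coincide; - $a_1^{(1)},b_1^{(1)}$ start and $\bar a_1^{(m)},\bar b_1^{(m)}$ end at four distinct branch points; - $\Upsilon_{\bar a_3^{(1)}}=\Upsilon_{\bar b_3^{(1)}}=0$ and $\Delta_{a_3^{(m)}}=\Delta_{b_3^{(m)}}=0$; - (no holes) for $1\le l<m$ the streets $\bar a_2^{(l)},\bar b_1^{(l)},a_2^{(l+1)},b_3^{(l)}$ lie in an open disc in $C'$, and so do $\bar b_2^{(l)},\bar a_1^{(l)},b_2^{(l+1)},a_3^{(l)}$. *The charge.* For $1\le l\le m$, let $h_1^{(l)},h_4^{(l)}$ be the half rotations at $J_1^{(l)},J_4^{(l)}$, and put $$\hat\gamma_c=\sum_{r<l}(\mathbf a_1+\mathbf a_2+\mathbf b_1+\mathbf b_2)^{(r)}+\mathbf a_1^{(l)}+\mathbf b_1^{(l)}-h_1^{(l)}+\mathbf c^{(l)}+h_4^{(l)}+\bar{\mathbf a}_1^{(l)}+\bar{\mathbf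 b}_1^{(l)}+\sum_{r>l}(\bar{\mathbf a}_1+\bar{\mathbf a}_2+\bar{\mathbf b}_1+\bar{\mathbf b}_2)^{(r)}.$$ This is a chain on $\widetilde\Sigma$ that joins four simpletons. Set $z=X_{\hat\gamma_c}T^4$. **Proposition.** Let an $m$-herd be given and let $1\le l\le m$. The push-forward of $\hat\gamma_c$ to $\Sigma$ is a cycle; let $\gamma_c\in H_1(\Sigma;\mathbb Z)$ be its class. There is a unique $P_m\in\mathbb Z[[z]]$ with $P_m=1+zP_m^{(m-1)^2}$, and there are unique integers $\alpha_n$, $n\ge1$, with $$P_m=\prod_{n\ge1}\bigl(1-(-1)^{mn}z^n\bigr)^{\alpha_n}.$$ There are integers $\alpha_n(p)$, for all streets $p$ and $n\ge 1$, with $$Q(p)=\prod_{n\ge1}\bigl(1-(-1)^{mn}z^n\bigr)^{\alpha_n(p)},$$ uniquely determined by the $Q(p)$ whenever $\mathbb Z$ embeds in the ring of charges (that is, whenever the relation $X_H=-1$ does not make a non-zero integer vanish), such that for every $n\ge1$ only finitely many $\alpha_n(p)$ are non-zero, and the 1-chain $L(n\gamma_c)=\sum_p\alpha_n(p)\,p_\Sigma$,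 in which each street is counted once, is a cycle with $$[L(n\gamma_c)]=m\,\alpha_n\,\gamma_c\in H_1(\Sigma;\mathbb Z).$$ Consequently, if $\gamma_c$ has infinite order and $\Omega$ is an integer-valued function on $H_1(\Sigma;\mathbb Z)$ with $[L(n\gamma_c)]=\Omega(n\gamma_c)\,n\gamma_c$ for all $n\ge1$, then $\Omega(n\gamma_c)=m\alpha_n/n$ for all $n\ge1$. -/

import Mathlib

open scoped Manifold ContDiff

noncomputable section

/-! ## Singular 1-chains and first homology

`Chain1 X` is the group of integral singular 1-chains of `X`, a singular 1-simplex being a path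
`unitInterval → X`.  The first homology is cycles modulo boundaries of singular 2-simplices. -/

namespace Sing

variable {X Y : Type*} [TopologicalSpace X] [TopologicalSpace Y]

/-- Singular 1-chains with integer coefficients. -/
abbrev Chain1 (X : Type*) [TopologicalSpace X] : Type _ := C(unitInterval, X) →₀ ℤ

/-- The 1-chain given by one path. -/
def ofPath (p : C(unitInterval, X)) : Chain1 X := Finsupp.single p 1

/-- The boundary operator on 1-chains: a path goes to its end point minus its starting point. -/
def bdry : Chain1 X →+ (X →₀ ℤ) :=
  Finsupp.liftAddHom fun p => Finsupp.singleAddHom (p 1) - Finsupp.singleAddHom (p 0)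

/-- The straight edge from vertex `i` to vertex `j` of the standard 2-simplex. -/
def edge (i j : Fin 3) : C(unitInterval, stdSimplex ℝ (Fin 3)) where
  toFun t := ⟨(1 - (t : ℝ)) • Pi.single i 1 + (t : ℝ) • Pi.single j 1,
    convex_stdSimplex ℝ (Fin 3) (single_mem_stdSimplex ℝ i) (single_mem_stdSimplex ℝ j)
      (sub_nonneg.2 t.2.2) t.2.1 (by ring)⟩
  continuous_toFun := by fun_prop

/-- The boundary of a singular 2-simplex. -/
def bdrySimplex (s : C(stdSimplex ℝ (Fin 3), X)) : Chain1 X :=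
  ofPath (s.comp (edge 0 1)) + ofPath (s.comp (edge 1 2)) - ofPath (s.comp (edge 0 2))

/-- The group of singular 1-boundaries. -/
def boundaries (X : Type*) [TopologicalSpace X] : AddSubgroup (Chain1 X) :=
  AddSubgroup.closure (Set.range bdrySimplex)

/-- The first singular homology group with integer coefficients. -/
abbrev H1 (X : Type*) [TopologicalSpace X] : Type _ :=
  (bdry (X := X)).ker ⧸ (boundaries X).addSubgroupOf (bdry (X := X)).ker

/-- The 1-chain `c` is a cycle and its homology class is `h`. -/
def HasClass (c : Chain1 X) (h : H1 X) : Prop :=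
  ∃ hc : c ∈ (bdry (X := X)).ker, (QuotientAddGroup.mk ⟨c, hc⟩ : H1 X) = h

/-- 1-chains modulo boundaries.  The elements with boundary `y - x` form the torsor of relative
homology classes of paths from `x` to `y`; those with boundary `0` form `H1 X`. -/
abbrev Rel (X : Type*) [TopologicalSpace X] : Type _ := Chain1 X ⧸ boundaries X

/-- The class of a 1-chain modulo boundaries. -/
def cls (c : Chain1 X) : Rel X := QuotientAddGroup.mk c

/-- Push-forward of 1-chains along a continuous map. -/
def push (f : C(X, Y)) : Chain1 X →+ Chain1 Y := Finsupp.mapDomain.addMonoidHom fun p => f.comp p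

end Sing

/-! ## Branched covers -/

section Covers

variable {S C : Type*}
  [TopologicalSpace S] [ChartedSpace ℂ S] [TopologicalSpace C] [ChartedSpace ℂ C]

/-- `π : S → C` is a branched cover of Riemann surfaces of degree `K`, with simple branching
exactly over the discrete closed set `B`. -/
structure IsSimpleBranchedCover (π : S → C) (B : Set C) (K : ℕ) : Prop where
  holomorphic : ContMDiff 𝓘(ℂ, ℂ) 𝓘(ℂ, ℂ) ω π
  proper : IsProperMap π
  isClosed : IsClosed B
  discrete : DiscreteTopology B
  covering : IsCoveringMapOn π Bᶜ
  etale : ∀ x, π x ∉ B → mfderiv 𝓘(ℂ, ℂ) 𝓘(ℂ, ℂ) π x ≠ 0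
  card_fibre : ∀ z, z ∉ B → (π ⁻¹' {z}).ncard = K
  card_branch : ∀ z, z ∈ B → (π ⁻¹' {z}).ncard + 1 = K

/-- An open disc embedded in the Riemann surface `C`: the domain of a holomorphic chart with
non-empty convex image. -/
def IsDisc (V : Set C) : Prop :=
  ∃ e ∈ IsManifold.maximalAtlas 𝓘(ℂ, ℂ) ω C,
    e.source = V ∧ e.target.Nonempty ∧ Convex ℝ e.target

/-! ## The circle bundle of tangent directions and twisted formal series -/

/-- Non-zero tangent vectors of `S`.  This space deformation retracts onto the unit tangent
bundle, for any Riemannian metric on `S`. -/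
abbrev Dir (S : Type*) [TopologicalSpace S] [ChartedSpace ℂ S] : Type _ :=
  {v : TangentBundle 𝓘(ℂ, ℂ) S // v.2 ≠ 0}

/-- The opposite tangent vector. -/
def tneg (v : TangentBundle 𝓘(ℂ, ℂ) S) : TangentBundle 𝓘(ℂ, ℂ) S := ⟨v.1, -v.2⟩

namespace Dir

/-- The foot point of a tangent direction. -/
def base (v : Dir S) : S := v.1.1

/-- The foot point as a continuous map. -/
def baseMap (S : Type*) [TopologicalSpace S] [ChartedSpace ℂ S] [IsManifold 𝓘(ℂ, ℂ) ω S] :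
    C(Dir S, S) where
  toFun v := v.base
  continuous_toFun :=
    (FiberBundle.continuous_proj ℂ (TangentSpace 𝓘(ℂ, ℂ) : S → Type)).comp
      continuous_subtype_val

/-- The opposite direction. -/
def neg (v : Dir S) : Dir S := ⟨tneg v.1, neg_ne_zero.2 v.2⟩

/-- Rotation of a tangent vector by the angle `θ`. -/
def rot (θ : ℝ) (v : Dir S) : Dir S :=
  ⟨⟨v.1.1, (Complex.exp (θ * Complex.I) • (v.1.2 : ℂ) : ℂ)⟩,
    smul_ne_zero (Complex.exp_ne_zero _) v.2⟩

/-- The path in the fibre that rotates `v` through the angles from `0` to `θ`. -/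
def rotPath [IsManifold 𝓘(ℂ, ℂ) ω S] (θ : ℝ) (v : Dir S) : C(unitInterval, Dir S) where
  toFun t := rot (θ * t) v
  continuous_toFun := by
    refine Continuous.subtype_mk ?_ _
    refine (FiberBundle.continuous_totalSpaceMk ℂ
      (TangentSpace 𝓘(ℂ, ℂ) : S → Type) v.1.1).comp ?_
    have h : Continuous fun t : unitInterval =>
        Complex.exp (((θ * (t : ℝ) : ℝ) : ℂ) * Complex.I) • (v.1.2 : ℂ) := by
      fun_prop
    exact h

end Dir

variable [IsManifold 𝓘(ℂ, ℂ) ω S]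

/-- The class of the loop that winds once around the circle fibre through `v`. -/
def fibreClass (v : Dir S) : Sing.Rel (Dir S) :=
  Sing.cls (Sing.ofPath (Dir.rotPath (2 * Real.pi) v))

/-- The charge ring: the group ring over `ℤ` of 1-chains modulo boundaries on `Dir S`, with the
relation `X_H = -1` for the class `H` of every circle fibre.  The concatenation product of the
formal variables of two composable paths is their product in this ring. -/
abbrev ChargeRing (S : Type*) [TopologicalSpace S] [ChartedSpace ℂ S]
    [IsManifold 𝓘(ℂ, ℂ) ω S] : Type _ :=
  AddMonoidAlgebra ℤ (Sing.Rel (Dir S)) ⧸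
    Ideal.span (Set.range fun v : Dir S =>
      (AddMonoidAlgebra.single (fibreClass v) 1 + 1 : AddMonoidAlgebra ℤ (Sing.Rel (Dir S))))

/-- Formal series in charges.  The power-series variable counts simpletons, so that infinite sums
of charges make sense. -/
abbrev Ser (S : Type*) [TopologicalSpace S] [ChartedSpace ℂ S]
    [IsManifold 𝓘(ℂ, ℂ) ω S] : Type _ :=
  PowerSeries (ChargeRing S)

/-- The formal variable `X_g` in the charge ring. -/
def chargeVar (g : Sing.Rel (Dir S)) : ChargeRing S :=
  Ideal.Quotient.mk _ (AddMonoidAlgebra.single g 1)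

/-- The formal variable of a 1-chain, as a formal series. -/
def expChain (c : Sing.Chain1 (Dir S)) : Ser S := PowerSeries.C (chargeVar (Sing.cls c))

/-- All charges in the series `f` are classes of 1-chains with boundary `y - x`, that is, relative
classes of paths from `x` to `y`. -/
def SupportedOn (f : Ser S) (x y : Dir S) : Prop :=
  ∀ k, PowerSeries.coeff k f ∈ AddSubgroup.closure
    {r | ∃ c : Sing.Chain1 (Dir S),
      Sing.bdry c = Finsupp.single y 1 - Finsupp.single x 1 ∧ r = chargeVar (Sing.cls c)}

/-! ## Framed streets -/

/-- A street `p` of type `ij`, with its lifts to the two sheets `i` and `j` and a framing.  `src`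
is the lift to sheet `i` together with the lift of the framing, `tgt` the lift to sheet `j`
together with the lift of the opposite framing: a soliton on the street runs from `src t` to
`tgt t`.  A street may begin or end at a branch point and is otherwise an embedded path off the
branch points. -/
structure FramedStreet (π : S → C) (B : Set C) where
  src : C(unitInterval, Dir S)
  tgt : C(unitInterval, Dir S)
  opposite : ∀ t, tangentMap 𝓘(ℂ, ℂ) 𝓘(ℂ, ℂ) π (tgt t).1 =
    tneg (tangentMap 𝓘(ℂ, ℂ) 𝓘(ℂ, ℂ) π (src t).1)
  notMem : ∀ t : unitInterval, 0 < t → t < 1 → π (src t).base ∉ B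
  sheets_ne : ∀ t, π (src t).base ∉ B → (src t).base ≠ (tgt t).base
  injOn : Set.InjOn (fun t => π (src t).base) (Set.Ioo 0 1)

namespace FramedStreet

variable {π : S → C} {B : Set C} (p : FramedStreet π B)

/-- The underlying path on `C`. -/
def path (t : unitInterval) : C := π (p.src t).base

/-- The lift `p{j} - p{i}` of the street to the space of directions. -/
def trans : Sing.Chain1 (Dir S) := Sing.ofPath p.tgt - Sing.ofPath p.src

/-- The lift `p_Σ` of the street to `S`: the oriented lift to sheet `j` minus the lift to
sheet `i`, for a street of type `ij`. -/
def lift : Sing.Chain1 S := Sing.push (Dir.baseMap S) p.trans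

end FramedStreet

/-! ## Spectral networks with their soliton generating series -/

/-- The framing vector `u` on sheet `i`, or its opposite, for solitons from sheet `i` to
sheet `j`. -/
def orient (i j : Fin 3) (u : Dir S) : Dir S := if i < j then u else u.neg

/-- The combinatorial and geometric data of a network: streets, and joints with up to six ends of
streets.  At a joint three sheets, labelled by `Fin 3`, are relevant; `frame v r` is the lift to
sheet `r` of one non-zero tangent vector at the joint.  The slot `i j` of a joint contains the
street that leaves the joint with type `ij`: either a street of type `ij` that starts there
(entry `(s, false)`), or a street of type `ji` that ends there (entry `(s, true)`). -/
structure Network (π : S → C) (B : Set C) (St Jt : Type*) where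
  street : St → FramedStreet π B
  frame : Jt → Fin 3 → Dir S
  frame_base : ∀ v, Function.Injective fun r => (frame v r).base
  frame_proj : ∀ v r r', tangentMap 𝓘(ℂ, ℂ) 𝓘(ℂ, ℂ) π (frame v r).1 =
    tangentMap 𝓘(ℂ, ℂ) 𝓘(ℂ, ℂ) π (frame v r').1
  frame_notMem : ∀ v r, π (frame v r).base ∉ B
  slot : Jt → Fin 3 → Fin 3 → Option (St × Bool)
  slot_diag : ∀ v i, slot v i i = none
  slot_inj : ∀ v v' i i' j j' e, slot v i j = some e → slot v' i' j' = some e →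
    v = v' ∧ i = i' ∧ j = j'
  attach_start : ∀ v i j s, slot v i j = some (s, false) →
    (street s).src 0 = orient i j (frame v i) ∧ (street s).tgt 0 = orient j i (frame v j)
  attach_end : ∀ v i j s, slot v i j = some (s, true) →
    (street s).src 1 = orient j i (frame v j) ∧ (street s).tgt 1 = orient i j (frame v i)

/-- A network with a pair of series for each street.  For a street `s` of type `ij` the series
`ups s` and `del s` count the solitons of type `ij`, respectively `ji`, at the starting point
of `s`; parallel transport along `s` gives the series at its end point. -/
structure SolitonNetwork (π : S → C) (B : Set C) (St Jt : Type*) extends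
    Network π B St Jt where
  ups : St → Ser S
  del : St → Ser S
  ups_supported : ∀ s, SupportedOn (ups s) ((street s).src 0) ((street s).tgt 0)
  del_supported : ∀ s, SupportedOn (del s) ((street s).tgt 0) ((street s).src 0)
  /-- the sense of the half rotation that enters the junction equations -/
  sense : ℤˣ

namespace SolitonNetwork

variable {π : S → C} {B : Set C} {St Jt : Type*} (N : SolitonNetwork π B St Jt)

/-- The series of solitons of type `ij` at the end of a street of type `ij`. -/
def upsEnd (s : St) : Ser S := expChain (N.street s).trans * N.ups s

/-- The series of solitons of type `ji` at the end of a street of type `ij`. -/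
def delEnd (s : St) : Ser S := expChain (-(N.street s).trans) * N.del s

/-- The outgoing series of type `ij` at a joint. -/
def tau (v : Jt) (i j : Fin 3) : Ser S :=
  match N.slot v i j with
  | none => 0
  | some (s, false) => N.ups s
  | some (s, true) => N.delEnd s

/-- The incoming series of type `ij` at a joint; it sits on the street that leaves the joint with
type `ji`. -/
def nu (v : Jt) (i j : Fin 3) : Ser S :=
  match N.slot v j i with
  | none => 0
  | some (s, false) => N.del s
  | some (s, true) => N.upsEnd s

/-- The half rotation, on the middle sheet, from the framing vector at a joint to its opposite. -/
def half (v : Jt) : Sing.Chain1 (Dir S) :=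
  Sing.ofPath (Dir.rotPath (((N.sense : ℤ) : ℝ) * Real.pi) (N.frame v 1))

/-- A two-way street carries solitons of both types. -/
def TwoWay (s : St) : Prop := N.ups s ≠ 0 ∧ N.del s ≠ 0

/-- The generating series `Q(s) = 1 + Υ Δ` of closed paths of a street. -/
def Q (s : St) : Ser S := 1 + N.ups s * N.del s

end SolitonNetwork

/-- A spectral network: its soliton series satisfy the six-way junction equations and the
branch-point rule. -/
structure SpectralNetwork (π : S → C) (B : Set C) (St Jt : Type*) extends
    N : SolitonNetwork π B St Jt where
  junction₁₂ : ∀ v, N.tau v 0 1 = N.nu v 0 1 + expChain (N.half v) * (N.tau v 0 2 * N.nu v 2 1)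
  junction₂₃ : ∀ v, N.tau v 1 2 = N.nu v 1 2 + expChain (N.half v) * (N.tau v 1 0 * N.nu v 0 2)
  junction₃₁ : ∀ v, N.tau v 2 0 = N.nu v 2 0 + expChain (N.half v) * (N.tau v 2 1 * N.nu v 1 0)
  junction₂₁ : ∀ v, N.tau v 1 0 = N.nu v 1 0 + expChain (-N.half v) * (N.nu v 1 2 * N.tau v 2 0)
  junction₃₂ : ∀ v, N.tau v 2 1 = N.nu v 2 1 + expChain (-N.half v) * (N.nu v 2 0 * N.tau v 0 1)
  junction₁₃ : ∀ v, N.tau v 0 2 = N.nu v 0 2 + expChain (-N.half v) * (N.nu v 0 1 * N.tau v 1 2)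
  /-- the two lifts of a street come together at a branch point -/
  branch_start : ∀ s, (N.street s).path 0 ∈ B → (N.street s).src 0 = (N.street s).tgt 0
  branch_end : ∀ s, (N.street s).path 1 ∈ B → (N.street s).src 1 = (N.street s).tgt 1
  /-- a street that starts at a branch point from which no other two-way street emanates carries
  exactly one soliton out of the branch point, the simpleton -/
  simpleton_start : ∀ s, (N.street s).path 0 ∈ B → (N.street s).path 1 ≠ (N.street s).path 0 →
    (∀ s', s' ≠ s → N.TwoWay s' → (N.street s').path 0 ≠ (N.street s).path 0 ∧
      (N.street s').path 1 ≠ (N.street s).path 0) →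
    N.ups s = PowerSeries.X
  simpleton_end : ∀ s, (N.street s).path 1 ∈ B → (N.street s).path 0 ≠ (N.street s).path 1 →
    (∀ s', s' ≠ s → N.TwoWay s' → (N.street s').path 0 ≠ (N.street s).path 1 ∧
      (N.street s').path 1 ≠ (N.street s).path 1) →
    N.delEnd s = PowerSeries.X
  /-- no soliton comes in at a free end, where a street runs off to a puncture -/
  free_start : ∀ s, (N.street s).path 0 ∉ B → (∀ v i j, N.slot v i j ≠ some (s, false)) →
    N.ups s = 0
  free_end : ∀ s, (N.street s).path 1 ∉ B → (∀ v i j, N.slot v i j ≠ some (s, true)) →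
    N.del s = 0

/-! ## Horses and herds -/

/-- The labels of the streets of a horse.  `a`, `abar` have type `12`, `b`, `bbar` have type `23`
and `c` has type `13`. -/
inductive HorseStreet
  | a1 | a2 | a3 | b1 | b2 | b3 | abar1 | abar2 | abar3 | bbar1 | bbar2 | bbar3 | c

namespace SolitonNetwork

variable {π : S → C} {B : Set C} {St Jt : Type*} (N : SolitonNetwork π B St Jt)

/-- The chain of streets `L` leaves the joint `v` in the slot `i j`. -/
def StartsAt (L : List St) (v : Jt) (i j : Fin 3) : Prop :=
  ∃ s, L.head? = some s ∧ N.slot v i j = some (s, false)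

/-- The chain of streets `L` runs into the joint `v` in the slot `i j`. -/
def EndsAt (L : List St) (v : Jt) (i j : Fin 3) : Prop :=
  ∃ s, L.getLast? = some s ∧ N.slot v i j = some (s, true)

/-- The street `s` runs straight through a joint and continues as `s'`, where the other streets
of the joint are one-way background: they carry solitons only of types `ik` and `jk`, or only of
types `ki` and `kj`, so that they do not change the soliton series of types `ij` and `ji`. -/
def Passes (s s' : St) : Prop :=
  ∃ v i j k, i ≠ j ∧ j ≠ k ∧ k ≠ i ∧
    N.slot v j i = some (s, true) ∧ N.slot v i j = some (s', false) ∧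
    ((N.tau v k i = 0 ∧ N.nu v k i = 0 ∧ N.tau v k j = 0 ∧ N.nu v k j = 0) ∨
      (N.tau v i k = 0 ∧ N.nu v i k = 0 ∧ N.tau v j k = 0 ∧ N.nu v j k = 0))

/-- The four joints and thirteen streets (each a chain of consecutive streets, which may cross
one-way background streets) form a horse.  The streets of type `13` and `31` at the joints that do
not belong to the horse carry no solitons into the joints. -/
structure IsHorse (joint : Fin 4 → Jt) (path : HorseStreet → List St) : Prop where
  chain : ∀ e, path e ≠ [] ∧ (path e).IsChain N.Passes
  a1_end : N.EndsAt (path .a1) (joint 0) 1 0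
  b1_end : N.EndsAt (path .b1) (joint 0) 2 1
  a2_start : N.StartsAt (path .a2) (joint 0) 0 1
  b2_start : N.StartsAt (path .b2) (joint 0) 1 2
  c_start : N.StartsAt (path .c) (joint 0) 0 2
  background₀ : N.nu (joint 0) 0 2 = 0
  a2_end : N.EndsAt (path .a2) (joint 1) 1 0
  bbar3_end : N.EndsAt (path .bbar3) (joint 1) 2 1
  a3_start : N.StartsAt (path .a3) (joint 1) 0 1
  bbar2_start : N.StartsAt (path .bbar2) (joint 1) 1 2
  background₁ : N.nu (joint 1) 0 2 = 0 ∧ N.nu (joint 1) 2 0 = 0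
  abar3_end : N.EndsAt (path .abar3) (joint 2) 1 0
  b2_end : N.EndsAt (path .b2) (joint 2) 2 1
  abar2_start : N.StartsAt (path .abar2) (joint 2) 0 1
  b3_start : N.StartsAt (path .b3) (joint 2) 1 2
  background₂ : N.nu (joint 2) 0 2 = 0 ∧ N.nu (joint 2) 2 0 = 0
  abar2_end : N.EndsAt (path .abar2) (joint 3) 1 0
  bbar2_end : N.EndsAt (path .bbar2) (joint 3) 2 1
  c_end : N.EndsAt (path .c) (joint 3) 2 0
  abar1_start : N.StartsAt (path .abar1) (joint 3) 0 1
  bbar1_start : N.StartsAt (path .bbar1) (joint 3) 1 2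
  background₃ : N.nu (joint 3) 2 0 = 0

/-- The part of `C` covered by the streets of a list. -/
def trace (L : List St) : Set C := {z | ∃ s ∈ L, ∃ t, z = (N.street s).path t}

/-- The sum of the lifts to `Dir S` of the streets of a list. -/
def trans (L : List St) : Sing.Chain1 (Dir S) := (L.map fun s => (N.street s).trans).sum

end SolitonNetwork

/-- How consecutive horses of a herd are glued: the pairs of horse streets that coincide. -/
def Glued {m : ℕ} (x y : Fin m × HorseStreet) : Prop :=
  x.1.val + 1 = y.1.val ∧
    ((x.2 = .a3 ∧ y.2 = .a1) ∨ (x.2 = .b3 ∧ y.2 = .b1) ∨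
      (x.2 = .abar1 ∧ y.2 = .abar3) ∨ (x.2 = .bbar1 ∧ y.2 = .bbar3))

/-- An `m`-herd: `m` horses on embedded open discs `U 0, …, U (m - 1)` off the branch points, each
glued to the next, the first one fed by two branch points from below and the last one by two
branch points from above. -/
structure Herd {π : S → C} {B : Set C} {St Jt : Type*} (N : SpectralNetwork π B St Jt)
    (m : ℕ) where
  U : Fin m → Set C
  isDisc : ∀ l, IsDisc (U l)
  off_branch : ∀ l, Disjoint (U l) B
  /-- the three relevant sheets over each disc -/
  sheet : Fin m → Fin 3 → C → S
  sheet_cont : ∀ l r, ContinuousOn (sheet l r) (U l)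
  sheet_section : ∀ l r, ∀ z ∈ U l, π (sheet l r z) = z
  sheet_inj : ∀ l, ∀ z ∈ U l, Function.Injective fun r => sheet l r z
  joint : Fin m → Fin 4 → Jt
  joint_inj : Function.Injective fun x : Fin m × Fin 4 => joint x.1 x.2
  joint_mem : ∀ l q r, π (N.frame (joint l q) r).base ∈ U l
  joint_sheet : ∀ l q r,
    sheet l r (π (N.frame (joint l q) r).base) = (N.frame (joint l q) r).base
  /-- each horse street, as a chain of streets of the network -/
  path : Fin m → HorseStreet → List St
  isHorse : ∀ l, N.IsHorse (joint l) (path l)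
  path_nodup : ∀ l e, (path l e).Nodup
  path_disjoint : ∀ x y : Fin m × HorseStreet, ∀ s, s ∈ path x.1 x.2 → s ∈ path y.1 y.2 →
    x = y ∨ Glued x y ∨ Glued y x
  inner_mem : ∀ l, N.trace (path l .a2 ++ path l .b2 ++ path l .c ++ path l .abar2 ++
    path l .bbar2) ⊆ U l
  c_twoWay : ∀ l, ∀ s ∈ path l .c, N.TwoWay s
  /-- every two-way street is a street of one of the horses -/
  twoWay_mem : ∀ s, N.TwoWay s → ∃ l e, s ∈ path l e
  /-- the discs cover the two-way streets, except for their end points at branch points -/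
  cover : ∀ s, N.TwoWay s → ∀ t, (N.street s).path t ∉ B → ∃ l, (N.street s).path t ∈ U l
  overlap : ∀ l l', l ≠ l' →
    ((U l ∩ U l').Nonempty ↔ l.val + 1 = l'.val ∨ l'.val + 1 = l.val)
  glue : ∀ x y : Fin m × HorseStreet, Glued x y → path x.1 x.2 = path y.1 y.2
  /-- the branch points from which `a1`, `b1` of the first horse and (downwards) `abar1`, `bbar1`
  of the last horse emanate -/
  branchPoint : Fin 4 → C
  branchPoint_mem : ∀ q, branchPoint q ∈ B
  branchPoint_inj : Function.Injective branchPoint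
  lower_source : ∀ l : Fin m, l.val = 0 →
    (∃ s, (path l .a1).head? = some s ∧ (N.street s).path 0 = branchPoint 0) ∧
    (∃ s, (path l .b1).head? = some s ∧ (N.street s).path 0 = branchPoint 1) ∧
    (∀ s ∈ path l .abar3, N.ups s = 0) ∧ (∀ s ∈ path l .bbar3, N.ups s = 0)
  upper_source : ∀ l : Fin m, l.val + 1 = m →
    (∃ s, (path l .abar1).getLast? = some s ∧ (N.street s).path 1 = branchPoint 2) ∧
    (∃ s, (path l .bbar1).getLast? = some s ∧ (N.street s).path 1 = branchPoint 3) ∧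
    (∀ s ∈ path l .a3, N.del s = 0) ∧ (∀ s ∈ path l .b3, N.del s = 0)
  /-- no holes: the two loops between consecutive horses bound discs off the branch points -/
  no_holes : ∀ l l' : Fin m, l.val + 1 = l'.val →
    (∃ V, IsDisc V ∧ Disjoint V B ∧
      N.trace (path l .abar2 ++ path l .bbar1 ++ path l' .a2 ++ path l .b3) ⊆ V) ∧
    (∃ V, IsDisc V ∧ Disjoint V B ∧
      N.trace (path l .bbar2 ++ path l .abar1 ++ path l' .b2 ++ path l .a3) ⊆ V)

namespace Herd

variable {π : S → C} {B : Set C} {St Jt : Type*} {N : SpectralNetwork π B St Jt} {m : ℕ}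
  (H : Herd N m)

/-- The 1-cycle on `Dir S` obtained by joining, at the street `c` of the horse `l`, the simpletons
of the four branch points of the herd, transported along the streets `a`, `b` of the horses below
and `abar`, `bbar` of the horses above. -/
def chargeChain (l : Fin m) : Sing.Chain1 (Dir S) :=
  (∑ r with r < l, (N.trans (H.path r .a1) + N.trans (H.path r .a2)
    + N.trans (H.path r .b1) + N.trans (H.path r .b2)))
  + N.trans (H.path l .a1) + N.trans (H.path l .b1) - N.half (H.joint l 0)
  + N.trans (H.path l .c)
  + N.half (H.joint l 3) + N.trans (H.path l .abar1) + N.trans (H.path l .bbar1)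
  + ∑ r with l < r, (N.trans (H.path r .abar1) + N.trans (H.path r .abar2)
    + N.trans (H.path r .bbar1) + N.trans (H.path r .bbar2))

/-- The formal variable `z` of the herd: the charge of the cycle, which is composed of four
simpletons. -/
def z (l : Fin m) : Ser S := expChain (H.chargeChain l) * PowerSeries.X ^ 4

/-- The push-forward of the cycle to `S`, which represents the charge of the herd. -/
def gammaChain (l : Fin m) : Sing.Chain1 S := Sing.push (Dir.baseMap S) (H.chargeChain l)

end Herd

/-! ## Exponents of product decompositions -/

/-- Integer powers of a formal power series with constant coefficient `1`. -/
def serPow {R : Type*} [CommRing R] (f : PowerSeries R) : ℤ → PowerSeries R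
  | .ofNat k => f ^ k
  | .negSucc k => (PowerSeries.invOfUnit f 1) ^ (k + 1)

/-- `Q = ∏_{n ≥ 1} (1 - (-1)^(m n) z^n)^(β n)`: every coefficient of `Q` is the coefficient of all
sufficiently long partial products. -/
def HasExponents {R : Type*} [CommRing R] (m : ℕ) (z Q : PowerSeries R) (β : ℕ → ℤ) : Prop :=
  ∀ k, ∀ᶠ M in Filter.atTop, PowerSeries.coeff k Q = PowerSeries.coeff k
    (∏ n ∈ Finset.Icc 1 M, serPow (1 - (-1) ^ (m * n) * z ^ n) (β n))

/-- The 1-chain `L(n γ_c) = ∑_p α_n(p) p_Σ` for exponents `β p n = α_n(p)` of the streets. -/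
def streetSum {π : S → C} {B : Set C} {St Jt : Type*} (N : SpectralNetwork π B St Jt)
    (β : St → ℕ → ℤ) (n : ℕ) : Sing.Chain1 S :=
  ∑ᶠ s, β s n • (N.street s).lift

end Covers

end

set_option linter.unusedSectionVars false

section Exponents

open PowerSeries

variable {R : Type*} [CommRing R]

/-- The partial products of `∏ (1 - (-1)^(m n) z^n)^(β n)`. -/
noncomputable def partialProd (m : ℕ) (z : PowerSeries R) (β : ℕ → ℤ) (M : ℕ) : PowerSeries R :=
  ∏ n ∈ Finset.Icc 1 M, serPow (1 - (-1) ^ (m * n) * z ^ n) (β n)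

lemma partialProd_zero (m : ℕ) (z : PowerSeries R) (β : ℕ → ℤ) : partialProd m z β 0 = 1 := by
  simp [partialProd]

lemma partialProd_succ (m : ℕ) (z : PowerSeries R) (β : ℕ → ℤ) (M : ℕ) :
    partialProd m z β (M + 1) = partialProd m z β M *
      serPow (1 - (-1) ^ (m * (M + 1)) * z ^ (M + 1)) (β (M + 1)) := by
  unfold partialProd
  rw [Finset.prod_Icc_succ_top (by omega)]

lemma exists_unit_serPow (f : PowerSeries R) (hf : constantCoeff f = 1) :
    ∃ u : (PowerSeries R)ˣ, (u : PowerSeries R) = f ∧ ∀ k, serPow f k = ((u ^ k : (PowerSeries R)ˣ) : PowerSeries R) := by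
  have h : f * invOfUnit f 1 = 1 := mul_invOfUnit f 1 (by simpa using hf)
  refine ⟨⟨f, invOfUnit f 1, h, by rw [mul_comm, h]⟩, rfl, ?_⟩
  rintro (k | k)
  · simp [serPow]
  · rw [zpow_negSucc, ← inv_pow]
    simp [serPow]

lemma constantCoeff_of_X_dvd {z : PowerSeries R} (hz : X ∣ z) : constantCoeff z = 0 :=
  X_dvd_iff.1 hz

lemma constantCoeff_factor {z : PowerSeries R} (hz : X ∣ z) (m : ℕ) {n : ℕ} (hn : 1 ≤ n) :
    constantCoeff (1 - (-1) ^ (m * n) * z ^ n) = 1 := by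
  simp [constantCoeff_of_X_dvd hz, show n ≠ 0 by omega]

lemma sq_dvd_zpow_sub {A : Type*} [CommRing A] (u : Aˣ) (w : A) (hu : (u : A) = 1 - w) (b : ℤ) :
    w ^ 2 ∣ ((u ^ b : Aˣ) : A) - (1 - b * w) := by
  induction b using Int.induction_on with
  | zero => simp
  | succ k ih =>
    obtain ⟨g, hg⟩ := ih
    refine ⟨g * (1 - w) + k, ?_⟩
    rw [zpow_add_one, Units.val_mul, eq_add_of_sub_eq hg, hu]
    push_cast
    ring
  | pred k ih =>
    obtain ⟨g, hg⟩ := ih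
    have h1 : ((u ^ (-(k : ℤ) - 1) : Aˣ) : A) * u = ((u ^ (-(k : ℤ)) : Aˣ) : A) := by
      rw [← Units.val_mul, ← zpow_add_one]; simp
    have h2 : (((u ^ (-(k : ℤ) - 1) : Aˣ) : A) - (1 - ((-(k : ℤ) - 1 : ℤ) : A) * w)) * u
        = w ^ 2 * (g + (k + 1)) := by
      rw [sub_mul, h1, eq_add_of_sub_eq hg, hu]
      push_cast
      ring
    have h3 : w ^ 2 ∣ (((u ^ (-(k : ℤ) - 1) : Aˣ) : A) - (1 - ((-(k : ℤ) - 1 : ℤ) : A) * w)) * u :=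
      ⟨_, h2⟩
    exact (Units.dvd_mul_right).1 h3

lemma pow_dvd_serPow_sub {z : PowerSeries R} (hz : X ∣ z) (m : ℕ) {n : ℕ} (hn : 1 ≤ n) (b : ℤ) :
    z ^ (n + 1) ∣ serPow (1 - (-1) ^ (m * n) * z ^ n) b -
      (1 - (b : PowerSeries R) * ((-1) ^ (m * n) * z ^ n)) := by
  obtain ⟨u, hu, hk⟩ := exists_unit_serPow _ (constantCoeff_factor hz m hn)
  rw [hk]
  refine dvd_trans ?_ (sq_dvd_zpow_sub u _ hu b)
  rw [mul_pow, ← pow_mul z]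
  exact Dvd.dvd.mul_left (pow_dvd_pow _ (by omega)) _

lemma pow_dvd_serPow_sub_one {z : PowerSeries R} (hz : X ∣ z) (m : ℕ) {n : ℕ} (hn : 1 ≤ n)
    (b : ℤ) : z ^ n ∣ serPow (1 - (-1) ^ (m * n) * z ^ n) b - 1 := by
  have h1 := (pow_dvd_pow z (Nat.le_succ n)).trans (pow_dvd_serPow_sub hz m hn b)
  have h2 : z ^ n ∣ (b : PowerSeries R) * ((-1) ^ (m * n) * z ^ n) :=
    Dvd.dvd.mul_left (Dvd.dvd.mul_left dvd_rfl _) _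
  have := dvd_sub h1 h2
  convert this using 1
  ring

lemma pow_dvd_partialProd_sub {z : PowerSeries R} (hz : X ∣ z) (m : ℕ) (β : ℕ → ℤ) {k M : ℕ}
    (h : k ≤ M) : z ^ (k + 1) ∣ partialProd m z β M - partialProd m z β k := by
  induction M, h using Nat.le_induction with
  | base => simp
  | succ M hM ih =>
    have h1 := (pow_dvd_pow z (show k + 1 ≤ M + 1 by omega)).trans
      (pow_dvd_serPow_sub_one hz m (show 1 ≤ M + 1 by omega) (β (M + 1)))
    have := dvd_add ih (Dvd.dvd.mul_left h1 (partialProd m z β M))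
    rw [partialProd_succ]
    convert this using 1
    ring

lemma constantCoeff_partialProd {z : PowerSeries R} (hz : X ∣ z) (m : ℕ) (β : ℕ → ℤ) (M : ℕ) :
    constantCoeff (partialProd m z β M) = 1 := by
  have h := (hz.trans (by simpa using pow_dvd_partialProd_sub hz m β (Nat.zero_le M)))
  rw [partialProd_zero, X_dvd_iff, map_sub, map_one, sub_eq_zero] at h
  exact h

lemma X_pow_dvd_pow {z : PowerSeries R} (hz : X ∣ z) (k : ℕ) : X ^ k ∣ z ^ k := pow_dvd_pow_of_dvd hz k

lemma hasExponents_iff {z : PowerSeries R} (hz : X ∣ z) (m : ℕ) (Q : PowerSeries R) (β : ℕ → ℤ) :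
    HasExponents m z Q β ↔ ∀ k, X ^ (k + 1) ∣ Q - partialProd m z β k := by
  have key : ∀ k M, k ≤ M → X ^ (k + 1) ∣ partialProd m z β M - partialProd m z β k :=
    fun k M h => (X_pow_dvd_pow hz _).trans (pow_dvd_partialProd_sub hz m β h)
  constructor
  · intro h k
    rw [X_pow_dvd_iff]
    intro j hj
    obtain ⟨M, hM, hkM⟩ := ((h j).and (Filter.eventually_ge_atTop k)).exists
    have := X_pow_dvd_iff.1 (key k M hkM) j hj
    rw [map_sub] at this ⊢
    rw [hM]
    exact this
  · intro h k
    filter_upwards [Filter.eventually_ge_atTop k] with M hM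
    have h1 := X_pow_dvd_iff.1 (h M) k (by omega)
    rwa [map_sub, sub_eq_zero] at h1

lemma HasExponents.unique (hinj : Function.Injective (Int.castRingHom R)) {a : R} (ha : IsUnit a)
    {d : ℕ} (hd : 1 ≤ d) {m : ℕ} {Q : PowerSeries R} {b b' : ℕ → ℤ}
    (h : HasExponents m (C a * X ^ d) Q b) (h' : HasExponents m (C a * X ^ d) Q b') {n : ℕ}
    (hn : 1 ≤ n) : b n = b' n := by
  have hz : (X : PowerSeries R) ∣ C a * X ^ d :=
    Dvd.dvd.mul_left (dvd_pow_self X (by omega)) _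
  rw [hasExponents_iff hz] at h h'
  induction n using Nat.strong_induction_on with
  | _ n ih =>
    obtain ⟨k, rfl⟩ : ∃ k, n = k + 1 := ⟨n - 1, by omega⟩
    set z : PowerSeries R := C a * X ^ d with hzdef
    have hF : partialProd m z b k = partialProd m z b' k := by
      unfold partialProd
      refine Finset.prod_congr rfl fun j hj => ?_
      rw [Finset.mem_Icc] at hj
      rw [ih j (by omega) hj.1]
    have hle : k + 1 ≤ d * (k + 1) := Nat.le_mul_of_pos_left _ hd
    have hzpow : (X : PowerSeries R) ^ (d * (k + 1) + 1) ∣ z ^ (k + 1 + 1) := by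
      rw [hzdef, mul_pow, ← pow_mul]
      refine Dvd.dvd.mul_left (pow_dvd_pow _ ?_) _
      nlinarith
    have key : ∀ c : ℕ → ℤ, (∀ k, X ^ (k + 1) ∣ Q - partialProd m z c k) →
        X ^ (d * (k + 1) + 1) ∣ Q - partialProd m z c k *
          (1 - (c (k + 1) : PowerSeries R) * ((-1) ^ (m * (k + 1)) * z ^ (k + 1))) := by
      intro c hc
      have h1 := hc (d * (k + 1))
      have h2 := hzpow.trans (pow_dvd_partialProd_sub hz m c hle)
      have h3 := hzpow.trans (pow_dvd_serPow_sub hz m (show 1 ≤ k + 1 by omega) (c (k + 1)))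
      have := dvd_add (dvd_add h1 h2) (Dvd.dvd.mul_left h3 (partialProd m z c k))
      rw [partialProd_succ] at this
      convert this using 1
      ring
    have h1 := dvd_sub (key b' h') (key b h)
    rw [hF] at h1
    have h2 : (X : PowerSeries R) ^ (d * (k + 1) + 1) ∣ X ^ (d * (k + 1)) *
        (C (a ^ (k + 1)) * partialProd m z b' k * ((b' (k + 1) - b (k + 1) : ℤ) : PowerSeries R)
          * (-1) ^ (m * (k + 1))) := by
      convert h1 using 1
      rw [hzdef, mul_pow (C a), ← pow_mul X, map_pow]
      push_cast
      ring
    have h3 := X_pow_dvd_iff.1 h2 (d * (k + 1)) (by omega)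
    rw [coeff_X_pow_mul', if_pos le_rfl, Nat.sub_self, coeff_zero_eq_constantCoeff_apply] at h3
    simp only [map_mul, constantCoeff_C, constantCoeff_partialProd hz, map_intCast, map_pow,
      map_neg, map_one, mul_one] at h3
    rw [((isUnit_one.neg).pow _).mul_left_eq_zero, (ha.pow _).mul_right_eq_zero] at h3
    have := hinj (a₁ := b' (k + 1) - b (k + 1)) (a₂ := 0) (by simpa using h3)
    omega

lemma exists_hasExponents (m : ℕ) (P : PowerSeries ℤ) (hP : constantCoeff P = 1) :
    ∃ α : ℕ → ℤ, HasExponents m X P α := by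
  let c : PowerSeries ℤ → ℕ → ℤ := fun F n => -((-1) ^ (m * n) * coeff n (P - F))
  let F : ℕ → PowerSeries ℤ := fun n => Nat.rec (motive := fun _ => PowerSeries ℤ) 1
    (fun n Fn => Fn * serPow (1 - (-1) ^ (m * (n + 1)) * X ^ (n + 1)) (c Fn (n + 1))) n
  let α : ℕ → ℤ := fun n => c (F (n - 1)) n
  have hF : ∀ n, F n = partialProd m X α n := by
    intro n
    induction n with
    | zero => rw [partialProd_zero]; rfl
    | succ n ih => rw [partialProd_succ, ← ih]; rfl
  refine ⟨α, (hasExponents_iff dvd_rfl m P α).2 fun k => ?_⟩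
  induction k with
  | zero => rw [partialProd_zero, zero_add, pow_one, X_dvd_iff]; simp [hP]
  | succ k ih =>
    obtain ⟨g, hg⟩ := ih
    have h3 := pow_dvd_serPow_sub (R := ℤ) dvd_rfl m (show 1 ≤ k + 1 by omega) (α (k + 1))
    have hα : α (k + 1) = -((-1) ^ (m * (k + 1)) * constantCoeff g) := by
      change -((-1) ^ (m * (k + 1)) * coeff (k + 1) (P - F k)) = _
      rw [hF, hg, coeff_X_pow_mul', if_pos le_rfl, Nat.sub_self, coeff_zero_eq_constantCoeff_apply]
    have h4 : (X : PowerSeries ℤ) ^ (k + 1 + 1) ∣ X ^ (k + 1) * (g + partialProd m X α k *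
        ((α (k + 1) : PowerSeries ℤ) * (-1) ^ (m * (k + 1)))) := by
      rw [pow_succ]
      refine mul_dvd_mul_left _ ?_
      rw [X_dvd_iff]
      simp only [map_add, map_mul, constantCoeff_partialProd (R := ℤ) dvd_rfl, map_intCast, map_pow,
        map_neg, map_one, one_mul, hα]
      have : ((-1 : ℤ) ^ (m * (k + 1))) * (-1) ^ (m * (k + 1)) = 1 := by
        rw [← mul_pow]; simp
      simp only [Int.cast_id]
      linear_combination (-constantCoeff g) * this
    have := dvd_sub h4 (Dvd.dvd.mul_left h3 (partialProd m X α k))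
    rw [partialProd_succ]
    convert this using 1
    linear_combination hg

lemma HasExponents.pow {z : PowerSeries R} (hz : X ∣ z) {m : ℕ} {Q : PowerSeries R} {β : ℕ → ℤ}
    (h : HasExponents m z Q β) (j : ℕ) : HasExponents m z (Q ^ j) fun n => j * β n := by
  rw [hasExponents_iff hz] at h ⊢
  intro k
  have : partialProd m z (fun n => j * β n) k = partialProd m z β k ^ j := by
    unfold partialProd
    rw [← Finset.prod_pow]
    refine Finset.prod_congr rfl fun n hn => ?_
    obtain ⟨u, -, hu⟩ := exists_unit_serPow _ (constantCoeff_factor hz m (Finset.mem_Icc.1 hn).1)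
    rw [hu, hu, ← Units.val_pow_eq_pow_val]
    simp only
    rw [mul_comm, zpow_mul, zpow_natCast]
  rw [this]
  exact (h k).trans (sub_dvd_pow_sub_pow _ _ j)

lemma map_serPow {R' : Type*} [CommRing R'] (φ : PowerSeries R →+* PowerSeries R')
    {f : PowerSeries R} (hf : constantCoeff f = 1) (hf' : constantCoeff (φ f) = 1) (k : ℤ) :
    φ (serPow f k) = serPow (φ f) k := by
  obtain ⟨u, rfl, hk⟩ := exists_unit_serPow f hf
  obtain ⟨v, hv, hk'⟩ := exists_unit_serPow _ hf'
  rw [hk, hk']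
  have : Units.map (φ : PowerSeries R →* PowerSeries R') u = v := Units.ext hv.symm
  rw [← this, ← map_zpow]
  rfl

lemma HasExponents.map {R' : Type*} [CommRing R'] (φ : PowerSeries R →+* PowerSeries R')
    (hφ : X ∣ φ X) {m : ℕ} {P : PowerSeries R} {β : ℕ → ℤ} (h : HasExponents m X P β) :
    HasExponents m (φ X) (φ P) β := by
  rw [hasExponents_iff hφ]
  rw [hasExponents_iff dvd_rfl] at h
  intro k
  have : φ (partialProd m X β k) = partialProd m (φ X) β k := by
    unfold partialProd
    rw [map_prod]
    refine Finset.prod_congr rfl fun n hn => ?_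
    have e : φ (1 - (-1) ^ (m * n) * X ^ n) = 1 - (-1) ^ (m * n) * φ X ^ n := by simp
    rw [map_serPow φ (constantCoeff_factor dvd_rfl m (Finset.mem_Icc.1 hn).1), e]
    rw [e]
    exact constantCoeff_factor hφ m (Finset.mem_Icc.1 hn).1
  rw [← this, ← map_sub]
  refine (X_pow_dvd_pow hφ _).trans ?_
  rw [← map_pow]
  exact map_dvd φ (h k)

/-- A congruence version of uniqueness of fixed points. -/
lemma eq_of_forall_X_pow_dvd {f g : PowerSeries R} (h : ∀ k, X ^ k ∣ f - g) : f = g := by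
  ext k
  have := X_pow_dvd_iff.1 (h (k + 1)) k (by omega)
  rwa [map_sub, sub_eq_zero] at this

lemma existsUnique_fixedPoint (N : ℕ) : ∃! P : PowerSeries R, P = 1 + X * P ^ N := by
  let F : ℕ → PowerSeries R := fun n => (fun P => 1 + X * P ^ N)^[n] 1
  have hs : ∀ n, F (n + 1) = 1 + X * F n ^ N := fun n => Function.iterate_succ_apply' _ _ _
  have hstep : ∀ n, X ^ (n + 1) ∣ F (n + 1) - F n := by
    intro n
    induction n with
    | zero => rw [hs]; exact ⟨F 0 ^ N, by simp [F]⟩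
    | succ n ih =>
      rw [hs, hs, pow_succ']
      have := mul_dvd_mul_left X (ih.trans (sub_dvd_pow_sub_pow (F (n + 1)) (F n) N))
      rw [hs] at this
      convert this using 1
      ring
  have hle : ∀ k n, k ≤ n → X ^ (k + 1) ∣ F n - F k := by
    intro k n h
    induction n, h using Nat.le_induction with
    | base => simp
    | succ n hn ih =>
      have := dvd_add ((pow_dvd_pow X (show k + 1 ≤ n + 1 by omega)).trans (hstep n)) ih
      convert this using 1
      ring
  let P : PowerSeries R := PowerSeries.mk fun n => coeff n (F n)
  have hP : ∀ k, X ^ (k + 1) ∣ P - F k := by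
    intro k
    rw [X_pow_dvd_iff]
    intro j hj
    have := X_pow_dvd_iff.1 (hle j k (by omega)) j (by omega)
    rw [map_sub, sub_eq_zero] at this
    simp [P, this]
  refine ⟨P, eq_of_forall_X_pow_dvd fun k => ?_, fun P' hP' => eq_of_forall_X_pow_dvd fun k => ?_⟩
  · have h1 := (pow_dvd_pow X (show k ≤ k + 1 + 1 by omega)).trans (hP (k + 1))
    have h2 := (pow_dvd_pow X (show k ≤ k + 1 by omega)).trans
      ((hP k).trans (sub_dvd_pow_sub_pow P (F k) N))
    have := dvd_sub h1 (Dvd.dvd.mul_left h2 X)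
    convert this using 1
    rw [hs]
    ring
  · have key : ∀ k, X ^ k ∣ P' - F k := by
      intro k
      induction k with
      | zero => simp
      | succ k ih =>
        have := mul_dvd_mul_left X (ih.trans (sub_dvd_pow_sub_pow P' (F k) N))
        rw [← pow_succ'] at this
        convert this using 1
        rw [hs]
        nth_rw 1 [hP']
        ring
    have := dvd_sub (key k) ((pow_dvd_pow X (Nat.le_succ k)).trans (hP k))
    convert this using 1
    ring

/-- The equations of the street factors of a herd determine them. -/
lemma eq_of_herd_system {m : ℕ} {z : PowerSeries R} (hz : X ∣ z) {q : Fin m → PowerSeries R}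
    {P : PowerSeries R}
    (hq : ∀ l, q l = 1 + z * ∏ r ∈ Finset.univ.erase l, ∏ s ∈ Finset.univ.erase r, q s)
    (hP : P = 1 + z * P ^ ((m - 1) ^ 2)) (l : Fin m) : q l = P := by
  refine eq_of_forall_X_pow_dvd fun k => ?_
  induction k generalizing l with
  | zero => simp
  | succ k ih =>
    have hP' : P = 1 + z * ∏ r ∈ Finset.univ.erase l, ∏ s ∈ Finset.univ.erase r, P := by
      simp only [Finset.prod_const, Finset.card_erase_of_mem (Finset.mem_univ _), Finset.card_univ,
        Fintype.card_fin]
      rw [← pow_mul, ← sq]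
      exact hP
    have hprod : ∀ (s : Finset (Fin m)) (f g : Fin m → PowerSeries R),
        (∀ i, X ^ k ∣ f i - g i) → X ^ k ∣ ∏ i ∈ s, f i - ∏ i ∈ s, g i := by
      intro s f g h
      rw [← Ideal.mem_span_singleton, ← Ideal.Quotient.eq, map_prod, map_prod]
      refine Finset.prod_congr rfl fun i _ => ?_
      rw [Ideal.Quotient.eq, Ideal.mem_span_singleton]
      exact h i
    have h1 := mul_dvd_mul hz (hprod (Finset.univ.erase l)
      (fun r => ∏ s ∈ Finset.univ.erase r, q s) (fun r => ∏ s ∈ Finset.univ.erase r, P)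
      fun i => hprod _ _ _ ih)
    rw [← pow_succ'] at h1
    rw [hq l]
    nth_rw 1 [hP']
    convert h1 using 1
    ring

end Exponents

namespace Sing

variable {X Y : Type*} [TopologicalSpace X] [TopologicalSpace Y]

lemma cls_add (a b : Chain1 X) : cls (a + b) = cls a + cls b := rfl
lemma cls_sub (a b : Chain1 X) : cls (a - b) = cls a - cls b := rfl
lemma cls_zero : cls (0 : Chain1 X) = 0 := rfl

/-- The class of a chain modulo boundaries, as a homomorphism. -/
noncomputable def clsHom (X : Type*) [TopologicalSpace X] : Chain1 X →+ Rel X := QuotientAddGroup.mk' _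

lemma clsHom_apply (c : Chain1 X) : clsHom X c = cls c := rfl

lemma cls_bdrySimplex (s : C(stdSimplex ℝ (Fin 3), X)) : cls (bdrySimplex s) = 0 :=
  (QuotientAddGroup.eq_zero_iff _).2 (AddSubgroup.subset_closure ⟨s, rfl⟩)

lemma cls_triangle (s : C(stdSimplex ℝ (Fin 3), X)) :
    cls (ofPath (s.comp (edge 0 1))) + cls (ofPath (s.comp (edge 1 2)))
      = cls (ofPath (s.comp (edge 0 2))) := by
  have := cls_bdrySimplex s
  rw [bdrySimplex, cls_sub, cls_add, sub_eq_zero] at this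
  exact this

lemma cls_const (x : X) : cls (ofPath (ContinuousMap.const unitInterval x)) = 0 := by
  have := cls_triangle (ContinuousMap.const _ x)
  simpa using this

/-- The two routes along the boundary of a square are homologous. -/
lemma cls_square (H : C(unitInterval × unitInterval, X)) :
    cls (ofPath (H.comp ((ContinuousMap.id _).prodMk (.const _ 0))))
      + cls (ofPath (H.comp ((ContinuousMap.const _ 1).prodMk (.id _))))
      = cls (ofPath (H.comp ((ContinuousMap.const _ 0).prodMk (.id _))))
      + cls (ofPath (H.comp ((ContinuousMap.id _).prodMk (.const _ 1)))) := by
  have hedge : ∀ (i j k : Fin 3) (t : unitInterval), (edge i j t : stdSimplex ℝ (Fin 3)) k =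
      (1 - (t : ℝ)) * (Pi.single i 1 : Fin 3 → ℝ) k + (t : ℝ) * (Pi.single j 1 : Fin 3 → ℝ) k :=
    fun _ _ _ _ => rfl
  have hc : ∀ i, Continuous fun a : stdSimplex ℝ (Fin 3) => (a : Fin 3 → ℝ) i := fun i =>
    (continuous_apply i).comp continuous_subtype_val
  let c : Fin 3 → C(stdSimplex ℝ (Fin 3), unitInterval) := fun i =>
    ⟨fun a => ⟨(a : Fin 3 → ℝ) i, (stdSimplex.zero_le a i), stdSimplex.le_one a i⟩,
      (hc i).subtype_mk _⟩
  let d : Fin 3 → C(stdSimplex ℝ (Fin 3), unitInterval) := fun i =>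
    ⟨fun a => unitInterval.symm (c i a), by fun_prop⟩
  have h1 := cls_triangle (H.comp ((d 0).prodMk (c 2)))
  have h2 := cls_triangle (H.comp ((c 2).prodMk (d 0)))
  have e01 : ∀ t, ((d 0) (edge 0 1 t) : unitInterval) = t ∧ c 2 (edge 0 1 t) = 0 := fun t =>
    ⟨Subtype.ext (by simp [d, c, hedge]), Subtype.ext (by simp [c, hedge])⟩
  have e12 : ∀ t, ((d 0) (edge 1 2 t) : unitInterval) = 1 ∧ c 2 (edge 1 2 t) = t := fun t =>
    ⟨Subtype.ext (by simp [d, c, hedge]), Subtype.ext (by simp [c, hedge])⟩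
  have e02 : ∀ t, ((d 0) (edge 0 2 t) : unitInterval) = t ∧ c 2 (edge 0 2 t) = t := fun t =>
    ⟨Subtype.ext (by simp [d, c, hedge]), Subtype.ext (by simp [c, hedge])⟩
  have f1 : (H.comp ((d 0).prodMk (c 2))).comp (edge 0 1) =
      H.comp ((ContinuousMap.id _).prodMk (.const _ 0)) := by
    ext t; simp [e01]
  have f2 : (H.comp ((d 0).prodMk (c 2))).comp (edge 1 2) =
      H.comp ((ContinuousMap.const _ 1).prodMk (.id _)) := by
    ext t; simp [e12]
  have f3 : (H.comp ((c 2).prodMk (d 0))).comp (edge 0 1) =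
      H.comp ((ContinuousMap.const _ 0).prodMk (.id _)) := by
    ext t; simp [e01]
  have f4 : (H.comp ((c 2).prodMk (d 0))).comp (edge 1 2) =
      H.comp ((ContinuousMap.id _).prodMk (.const _ 1)) := by
    ext t; simp [e12]
  have f5 : (H.comp ((c 2).prodMk (d 0))).comp (edge 0 2) =
      (H.comp ((d 0).prodMk (c 2))).comp (edge 0 2) := by
    ext t; simp [e02]
  rw [f1, f2] at h1
  rw [f3, f4, f5] at h2
  rw [h1, h2]

/-- The class of a path in the image of a convex set depends only on the ends of a lift. -/
lemma exists_potential {E : Type*} [AddCommGroup E] [Module ℝ E] [TopologicalSpace E]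
    [IsTopologicalAddGroup E] [ContinuousSMul ℝ E] {W : Set E} (hW : Convex ℝ W) (hne : W.Nonempty)
    (f : W → X) (hf : Continuous f) :
    ∃ G : E → Rel X, ∀ (q : C(unitInterval, W)) (p : C(unitInterval, X)), (∀ t, p t = f (q t)) →
      cls (ofPath p) = G (q 1) - G (q 0) := by
  classical
  obtain ⟨x0, hx0⟩ := hne
  have hmem : ∀ y : W, ∀ s : unitInterval, (1 - (s : ℝ)) • x0 + (s : ℝ) • (y : E) ∈ W := fun y s =>
    hW hx0 y.2 (sub_nonneg.2 s.2.2) s.2.1 (by ring)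
  let seg : W → C(unitInterval, X) := fun y =>
    ⟨fun s => f ⟨_, hmem y s⟩, hf.comp (Continuous.subtype_mk (by fun_prop) _)⟩
  refine ⟨fun y => if h : y ∈ W then cls (ofPath (seg ⟨y, h⟩)) else 0, fun q p hp => ?_⟩
  let H : C(unitInterval × unitInterval, X) :=
    ⟨fun x => f ⟨_, hmem (q x.2) x.1⟩, hf.comp (Continuous.subtype_mk (by fun_prop) _)⟩
  have h := cls_square H
  have f1 : H.comp ((ContinuousMap.id _).prodMk (.const _ 0)) = seg (q 0) := rfl
  have f2 : H.comp ((ContinuousMap.const _ 1).prodMk (.id _)) = p := by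
    ext t; simp [H, hp]
  have f3 : H.comp ((ContinuousMap.const _ 0).prodMk (.id _)) = .const _ (f ⟨x0, hx0⟩) := by
    ext t; simp [H]
  have f4 : H.comp ((ContinuousMap.id _).prodMk (.const _ 1)) = seg (q 1) := rfl
  rw [f1, f2, f3, f4, cls_const, zero_add] at h
  simp only [Subtype.coe_prop, dite_true, Subtype.coe_eta]
  rw [← h]
  abel

end Sing

/-- Every path in the non-zero complex numbers has a continuous logarithm. -/
lemma exists_continuous_log (f : C(unitInterval, ℂ)) (hf : ∀ t, f t ≠ 0) :
    ∃ g : C(unitInterval, ℂ), ∀ t, Complex.exp (g t) = f t := by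
  let γ : C(unitInterval, {z : ℂ // z ≠ 0}) := ⟨fun t => ⟨f t, hf t⟩, f.continuous.subtype_mk _⟩
  obtain ⟨Γ, h, -⟩ := Complex.isCoveringMap_exp.exists_path_lifts γ (Complex.log (f 0))
    (Subtype.ext (Complex.exp_log (hf 0)).symm)
  exact ⟨Γ, fun t => congrArg Subtype.val (congrFun h t)⟩

section Sections

variable {S C : Type*}
  [TopologicalSpace S] [ChartedSpace ℂ S] [IsManifold 𝓘(ℂ, ℂ) ω S]
  [TopologicalSpace C] [ChartedSpace ℂ C]

open Topology in
/-- A continuous section of an étale holomorphic map is differentiable. -/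
lemma contMDiffAt_section {π : S → C} (hπ : ContMDiff 𝓘(ℂ, ℂ) 𝓘(ℂ, ℂ) ω π) {σ : C → S} {z : C}
    (hσ : ContinuousAt σ z) (hsec : ∀ᶠ y in 𝓝 z, π (σ y) = y)
    (hd : mfderiv 𝓘(ℂ, ℂ) 𝓘(ℂ, ℂ) π (σ z) ≠ 0) :
    ContMDiffAt 𝓘(ℂ, ℂ) 𝓘(ℂ, ℂ) 1 σ z := by
  have hz : π (σ z) = z := hsec.self_of_nhds
  set x := σ z with hx
  have hπ1 : ContMDiffAt 𝓘(ℂ, ℂ) 𝓘(ℂ, ℂ) 1 π x := (hπ x).of_le le_top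
  set eS := extChartAt 𝓘(ℂ, ℂ) x with heS
  set eC := extChartAt 𝓘(ℂ, ℂ) (π x) with heC
  set g : ℂ → ℂ := eC ∘ π ∘ eS.symm with hg
  have hgc : ContDiffAt ℂ 1 g (eS x) := by
    have := (contMDiffAt_iff.1 hπ1).2
    rwa [ModelWithCorners.range_eq_univ, contDiffWithinAt_univ] at this
  have hd' : deriv g (eS x) ≠ 0 := by
    intro h0
    apply hd
    rw [(hπ1.mdifferentiableAt one_ne_zero).mfderiv, ModelWithCorners.range_eq_univ,
      fderivWithin_univ]
    have : fderiv ℂ g (eS x) = 0 := by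
      ext
      simpa using h0
    exact this
  let f' : ℂ ≃L[ℂ] ℂ := ContinuousLinearEquiv.unitsEquivAut ℂ (Units.mk0 _ hd')
  have hf' : HasFDerivAt g (f' : ℂ →L[ℂ] ℂ) (eS x) := by
    have h1 := (hgc.differentiableAt one_ne_zero).hasDerivAt.hasFDerivAt
    have e : (f' : ℂ →L[ℂ] ℂ) = ContinuousLinearMap.toSpanSingleton ℂ (deriv g (eS x)) := by
      ext
      simp [f']
    rw [e]
    exact h1
  have hinv := hgc.to_localInverse hf' one_ne_zero
  set inv := hgc.localInverse hf' one_ne_zero with hinvdef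
  have hgx : g (eS x) = eC z := by
    simp only [hg, Function.comp_apply, heS, extChartAt_to_inv]
    rw [hz]
  have hsource : eS.source ∈ 𝓝 (σ z) := extChartAt_source_mem_nhds x
  have hev : ∀ᶠ y in 𝓝 z, eS.symm (inv (eC y)) = σ y := by
    have h1 : ∀ᶠ w in 𝓝 (eS x), inv (g w) = w :=
      (hgc.hasStrictFDerivAt' hf' one_ne_zero).eventually_left_inverse
    have h2 : ContinuousAt (fun y => eS (σ y)) z :=
      (continuousAt_extChartAt (I := 𝓘(ℂ, ℂ)) x).comp_of_eq hσ rfl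
    filter_upwards [h2.eventually h1, hσ.eventually hsource, hsec] with y hy1 hy2 hy3
    have : g (eS (σ y)) = eC y := by
      simp only [hg, Function.comp_apply]
      rw [eS.left_inv hy2, hy3]
    rw [this] at hy1
    rw [hy1, eS.left_inv hy2]
  refine ContMDiffAt.congr_of_eventuallyEq (f := eS.symm ∘ inv ∘ eC) ?_
    (hev.mono fun y hy => hy.symm)
  have hC : ContMDiffAt 𝓘(ℂ, ℂ) 𝓘(ℂ, ℂ) 1 eC z := by
    rw [heC, hz]; exact contMDiffAt_extChartAt
  have hI : ContMDiffAt 𝓘(ℂ, ℂ) 𝓘(ℂ, ℂ) 1 inv (eC z) := by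
    rw [← hgx]; exact hinv.contMDiffAt
  have hix : inv (eC z) = eS x := by
    rw [← hgx]; exact hgc.localInverse_apply_image hf' one_ne_zero
  have hS : ContMDiffAt 𝓘(ℂ, ℂ) 𝓘(ℂ, ℂ) 1 eS.symm (inv (eC z)) := by
    rw [hix]
    exact (contMDiffOn_extChartAt_symm x).contMDiffAt (extChartAt_target_mem_nhds x)
  exact hS.comp z (hI.comp z hC)

end Sections

section TangentMaps

variable {M M' : Type*} [TopologicalSpace M] [ChartedSpace ℂ M]
  [TopologicalSpace M'] [ChartedSpace ℂ M']

/-- A scalar multiple of a tangent vector. -/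
noncomputable def tsmul (c : ℂ) (u : TangentBundle 𝓘(ℂ, ℂ) M) : TangentBundle 𝓘(ℂ, ℂ) M :=
  ⟨u.1, (c • (u.2 : ℂ) : ℂ)⟩

lemma tangentMap_tsmul (f : M → M') (c : ℂ) (u : TangentBundle 𝓘(ℂ, ℂ) M) :
    tangentMap 𝓘(ℂ, ℂ) 𝓘(ℂ, ℂ) f (tsmul c u) = tsmul c (tangentMap 𝓘(ℂ, ℂ) 𝓘(ℂ, ℂ) f u) :=
  congrArg (fun w => (⟨f u.1, w⟩ : TangentBundle 𝓘(ℂ, ℂ) M'))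
    ((mfderiv 𝓘(ℂ, ℂ) 𝓘(ℂ, ℂ) f u.1).map_smul c u.2)

lemma tneg_eq_tsmul (u : TangentBundle 𝓘(ℂ, ℂ) M) : tneg u = tsmul (-1) u :=
  congrArg (fun w => (⟨u.1, w⟩ : TangentBundle 𝓘(ℂ, ℂ) M)) (neg_one_smul ℂ (u.2 : ℂ)).symm

lemma Dir.rot_val (θ : ℝ) (v : Dir M) : (Dir.rot θ v).1 = tsmul (Complex.exp (θ * Complex.I)) v.1 :=
  rfl

lemma injective_of_ne_zero (f : ℂ →L[ℂ] ℂ) (hf : f ≠ 0) : Function.Injective f := by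
  have h1 : f 1 ≠ 0 := fun h => hf (by ext; simpa using h)
  intro v w h
  have e : ∀ v, f v = v * f 1 := fun v => by rw [← smul_eq_mul, ← map_smul, smul_eq_mul, mul_one]
  rw [e v, e w] at h
  exact mul_right_cancel₀ h1 h

lemma tangentMap_injective_of_ne_zero {f : M → M'} {u v : TangentBundle 𝓘(ℂ, ℂ) M}
    (h : mfderiv 𝓘(ℂ, ℂ) 𝓘(ℂ, ℂ) f u.1 ≠ 0) (h1 : u.1 = v.1)
    (h2 : tangentMap 𝓘(ℂ, ℂ) 𝓘(ℂ, ℂ) f u = tangentMap 𝓘(ℂ, ℂ) 𝓘(ℂ, ℂ) f v) : u = v := by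
  obtain ⟨x, a⟩ := u
  obtain ⟨y, b⟩ := v
  obtain rfl : x = y := h1
  have h3 : mfderiv 𝓘(ℂ, ℂ) 𝓘(ℂ, ℂ) f x a = mfderiv 𝓘(ℂ, ℂ) 𝓘(ℂ, ℂ) f x b := by
    simpa [tangentMap] using h2
  have : a = b := injective_of_ne_zero (mfderiv 𝓘(ℂ, ℂ) 𝓘(ℂ, ℂ) f x) h h3
  rw [this]

lemma snd_ne_zero_of_tangentMap {f : M → M'} {u : TangentBundle 𝓘(ℂ, ℂ) M}
    (h : (tangentMap 𝓘(ℂ, ℂ) 𝓘(ℂ, ℂ) f u).2 ≠ 0) : u.2 ≠ 0 := fun h0 =>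
  h (by rw [tangentMap_snd]; exact (congrArg _ h0).trans (map_zero _))

lemma tangentMap_snd_ne_zero {f : M → M'} {u : TangentBundle 𝓘(ℂ, ℂ) M}
    (h : mfderiv 𝓘(ℂ, ℂ) 𝓘(ℂ, ℂ) f u.1 ≠ 0) (hu : u.2 ≠ 0) :
    (tangentMap 𝓘(ℂ, ℂ) 𝓘(ℂ, ℂ) f u).2 ≠ 0 := fun h0 =>
  hu (injective_of_ne_zero (mfderiv 𝓘(ℂ, ℂ) 𝓘(ℂ, ℂ) f u.1) h (h0.trans (map_zero _).symm))

lemma continuousOn_tangentMap [IsManifold 𝓘(ℂ, ℂ) 1 M] [IsManifold 𝓘(ℂ, ℂ) 1 M'] {f : M → M'}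
    {V : Set M} (hV : IsOpen V) (hf : ContMDiffOn 𝓘(ℂ, ℂ) 𝓘(ℂ, ℂ) 1 f V) :
    ContinuousOn (tangentMap 𝓘(ℂ, ℂ) 𝓘(ℂ, ℂ) f)
      {u : TangentBundle 𝓘(ℂ, ℂ) M | u.1 ∈ V} := by
  have h := hf.continuousOn_tangentMapWithin le_rfl hV.uniqueMDiffOn
  refine h.congr fun u hu => ?_
  exact (tangentMapWithin_eq_tangentMap (hV.uniqueMDiffWithinAt hu)
    (((hf u.1 hu).contMDiffAt (hV.mem_nhds hu)).mdifferentiableAt one_ne_zero)).symm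

open Topology in
lemma tangentMap_tangentMap_of_eventually_id {f : M → M'} {g : M' → M}
    {u : TangentBundle 𝓘(ℂ, ℂ) M} (hf : MDifferentiableAt 𝓘(ℂ, ℂ) 𝓘(ℂ, ℂ) f u.1)
    (hg : MDifferentiableAt 𝓘(ℂ, ℂ) 𝓘(ℂ, ℂ) g (f u.1)) (h : ∀ᶠ y in 𝓝 u.1, g (f y) = y) :
    tangentMap 𝓘(ℂ, ℂ) 𝓘(ℂ, ℂ) g (tangentMap 𝓘(ℂ, ℂ) 𝓘(ℂ, ℂ) f u) = u := by
  rw [← tangentMap_comp_at u hg hf]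
  have h1 : mfderiv 𝓘(ℂ, ℂ) 𝓘(ℂ, ℂ) (g ∘ f) u.1 = mfderiv 𝓘(ℂ, ℂ) 𝓘(ℂ, ℂ) id u.1 :=
    Filter.EventuallyEq.mfderiv_eq h
  have h2 : g (f u.1) = u.1 := h.self_of_nhds
  have h3 : tangentMap 𝓘(ℂ, ℂ) 𝓘(ℂ, ℂ) (g ∘ f) u = tangentMap 𝓘(ℂ, ℂ) 𝓘(ℂ, ℂ) id u := by
    unfold tangentMap
    rw [h1]
    simp [h2]
    rfl
  rw [h3, tangentMap_id]
  rfl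

end TangentMaps

section Transport

variable {S C : Type*}
  [TopologicalSpace S] [ChartedSpace ℂ S] [IsManifold 𝓘(ℂ, ℂ) ω S]
  [TopologicalSpace C] [ChartedSpace ℂ C] [IsManifold 𝓘(ℂ, ℂ) ω C]

/-- `σ` is a continuous section of `π` over the open set `V`, over which `π` is étale. -/
structure IsEtaleSection (π : S → C) (V : Set C) (σ : C → S) : Prop where
  isOpen : IsOpen V
  smooth : ContMDiff 𝓘(ℂ, ℂ) 𝓘(ℂ, ℂ) ω π
  etale : ∀ x, π x ∈ V → mfderiv 𝓘(ℂ, ℂ) 𝓘(ℂ, ℂ) π x ≠ 0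
  cont : ContinuousOn σ V
  sec : ∀ z ∈ V, π (σ z) = z

namespace IsEtaleSection

variable {π : S → C} {V : Set C} {σ : C → S} (h : IsEtaleSection π V σ)

include h

lemma contMDiffOn : ContMDiffOn 𝓘(ℂ, ℂ) 𝓘(ℂ, ℂ) 1 σ V := fun z hz =>
  (contMDiffAt_section h.smooth (h.cont.continuousAt (h.isOpen.mem_nhds hz))
    (Filter.eventually_of_mem (h.isOpen.mem_nhds hz) h.sec)
    (h.etale _ (by rwa [h.sec z hz]))).contMDiffWithinAt

lemma tangentMap_section {u : TangentBundle 𝓘(ℂ, ℂ) C} (hu : u.1 ∈ V) :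
    tangentMap 𝓘(ℂ, ℂ) 𝓘(ℂ, ℂ) π (tangentMap 𝓘(ℂ, ℂ) 𝓘(ℂ, ℂ) σ u) = u :=
  tangentMap_tangentMap_of_eventually_id
    ((h.contMDiffOn.contMDiffAt (h.isOpen.mem_nhds hu)).mdifferentiableAt one_ne_zero)
    ((h.smooth _).mdifferentiableAt (by simp))
    (Filter.eventually_of_mem (h.isOpen.mem_nhds hu) h.sec)

lemma section_tangentMap {p : TangentBundle 𝓘(ℂ, ℂ) S} (hp : π p.1 ∈ V) (hσ : p.1 = σ (π p.1)) :
    tangentMap 𝓘(ℂ, ℂ) 𝓘(ℂ, ℂ) σ (tangentMap 𝓘(ℂ, ℂ) 𝓘(ℂ, ℂ) π p) = p := by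
  refine (tangentMap_injective_of_ne_zero (f := π) (h.etale _ hp) hσ ?_).symm
  rw [h.tangentMap_section hp]

lemma continuousOn_tangentMap : ContinuousOn (tangentMap 𝓘(ℂ, ℂ) 𝓘(ℂ, ℂ) σ)
    {u : TangentBundle 𝓘(ℂ, ℂ) C | u.1 ∈ V} :=
  _root_.continuousOn_tangentMap h.isOpen h.contMDiffOn

lemma snd_ne_zero {u : TangentBundle 𝓘(ℂ, ℂ) C} (hu : u.1 ∈ V) (h0 : u.2 ≠ 0) :
    (tangentMap 𝓘(ℂ, ℂ) 𝓘(ℂ, ℂ) σ u).2 ≠ 0 := by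
  refine snd_ne_zero_of_tangentMap (f := π) ?_
  rw [h.tangentMap_section hu]
  exact h0

/-- Lift of a path of non-zero tangent vectors. -/
lemma exists_lift (u : C(unitInterval, TangentBundle 𝓘(ℂ, ℂ) C)) (hV : ∀ t, (u t).1 ∈ V)
    (h0 : ∀ t, (u t).2 ≠ 0) :
    ∃ p : C(unitInterval, Dir S), ∀ t, (p t).1 = tangentMap 𝓘(ℂ, ℂ) 𝓘(ℂ, ℂ) σ (u t) :=
  ⟨⟨fun t => ⟨_, h.snd_ne_zero (hV t) (h0 t)⟩,
    (h.continuousOn_tangentMap.comp_continuous u.continuous hV).subtype_mk _⟩, fun _ => rfl⟩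

end IsEtaleSection

/-- The tangent vector at a point of the disc `e` with given logarithm of its coordinate. -/
noncomputable def discVec (e : OpenPartialHomeomorph C ℂ) (x : ℂ × ℂ) : TangentBundle 𝓘(ℂ, ℂ) C :=
  tangentMap 𝓘(ℂ, ℂ) 𝓘(ℂ, ℂ) e.symm ⟨x.1, Complex.exp x.2⟩

/-- The coordinate of the foot point and a logarithm of the coordinate of a tangent vector. -/
noncomputable def discLog (e : OpenPartialHomeomorph C ℂ) (u : TangentBundle 𝓘(ℂ, ℂ) C) : ℂ × ℂ :=
  (e u.1, Complex.log (tangentMap 𝓘(ℂ, ℂ) 𝓘(ℂ, ℂ) e u).2)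

omit [IsManifold 𝓘(ℂ, ℂ) ω C] in
lemma discVec_add (e : OpenPartialHomeomorph C ℂ) (x : ℂ × ℂ) (y : ℂ) :
    discVec e (x + (0, y)) = tsmul (Complex.exp y) (discVec e x) := by
  rw [discVec, discVec, ← tangentMap_tsmul]
  obtain ⟨a, b⟩ := x
  change tangentMap 𝓘(ℂ, ℂ) 𝓘(ℂ, ℂ) e.symm ⟨a + 0, Complex.exp (b + y)⟩ =
    tangentMap 𝓘(ℂ, ℂ) 𝓘(ℂ, ℂ) e.symm ⟨a, Complex.exp y * Complex.exp b⟩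
  rw [add_zero, Complex.exp_add, mul_comm]

section Disc

variable {e : OpenPartialHomeomorph C ℂ} (he : e ∈ IsManifold.maximalAtlas 𝓘(ℂ, ℂ) ω C)

include he

lemma discChart_contMDiffOn : ContMDiffOn 𝓘(ℂ, ℂ) 𝓘(ℂ, ℂ) 1 e e.source :=
  (contMDiffOn_of_mem_maximalAtlas he).of_le le_top

lemma discChart_symm_contMDiffOn : ContMDiffOn 𝓘(ℂ, ℂ) 𝓘(ℂ, ℂ) 1 e.symm e.target :=
  (contMDiffOn_symm_of_mem_maximalAtlas he).of_le le_top

lemma discVec_tangentMap {u : TangentBundle 𝓘(ℂ, ℂ) C} (hu : u.1 ∈ e.source) :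
    tangentMap 𝓘(ℂ, ℂ) 𝓘(ℂ, ℂ) e.symm (tangentMap 𝓘(ℂ, ℂ) 𝓘(ℂ, ℂ) e u) = u :=
  tangentMap_tangentMap_of_eventually_id
    (((discChart_contMDiffOn he).contMDiffAt (e.open_source.mem_nhds hu)).mdifferentiableAt
      one_ne_zero)
    (((discChart_symm_contMDiffOn he).contMDiffAt
      (e.open_target.mem_nhds (e.map_source hu))).mdifferentiableAt one_ne_zero)
    (Filter.eventually_of_mem (e.open_source.mem_nhds hu) fun _ hy => e.left_inv hy)

lemma tangentMap_discVec {x : ℂ × ℂ} (hx : x.1 ∈ e.target) :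
    tangentMap 𝓘(ℂ, ℂ) 𝓘(ℂ, ℂ) e (discVec e x) = ⟨x.1, Complex.exp x.2⟩ :=
  tangentMap_tangentMap_of_eventually_id
    (((discChart_symm_contMDiffOn he).contMDiffAt (e.open_target.mem_nhds hx)).mdifferentiableAt
      one_ne_zero)
    (((discChart_contMDiffOn he).contMDiffAt
      (e.open_source.mem_nhds (e.map_target hx))).mdifferentiableAt one_ne_zero)
    (Filter.eventually_of_mem (e.open_target.mem_nhds hx) fun _ hy => e.right_inv hy)

lemma discVec_snd_ne_zero {x : ℂ × ℂ} (hx : x.1 ∈ e.target) : (discVec e x).2 ≠ 0 := by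
  refine snd_ne_zero_of_tangentMap (f := e) ?_
  rw [tangentMap_discVec he hx]
  exact Complex.exp_ne_zero _

lemma tangentMap_chart_snd_ne_zero {u : TangentBundle 𝓘(ℂ, ℂ) C} (hu : u.1 ∈ e.source)
    (h0 : u.2 ≠ 0) : (tangentMap 𝓘(ℂ, ℂ) 𝓘(ℂ, ℂ) e u).2 ≠ 0 := by
  refine snd_ne_zero_of_tangentMap (f := e.symm) ?_
  rw [discVec_tangentMap he hu]
  exact h0

lemma discVec_of_exp {u : TangentBundle 𝓘(ℂ, ℂ) C} (hu : u.1 ∈ e.source) {ζ : ℂ}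
    (hζ : Complex.exp ζ = (tangentMap 𝓘(ℂ, ℂ) 𝓘(ℂ, ℂ) e u).2) : discVec e (e u.1, ζ) = u := by
  conv_rhs => rw [← discVec_tangentMap he hu]
  rw [discVec]
  congr 1
  exact congrArg (fun w => (⟨e u.1, w⟩ : TangentBundle 𝓘(ℂ, ℂ) ℂ)) hζ

lemma discVec_discLog {u : TangentBundle 𝓘(ℂ, ℂ) C} (hu : u.1 ∈ e.source) (h0 : u.2 ≠ 0) :
    discVec e (discLog e u) = u :=
  discVec_of_exp he hu (Complex.exp_log (tangentMap_chart_snd_ne_zero he hu h0))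

lemma continuousOn_discVec : ContinuousOn (discVec e) {x | x.1 ∈ e.target} := by
  have h := continuousOn_tangentMap e.open_target (discChart_symm_contMDiffOn he)
  refine h.comp (f := fun x : ℂ × ℂ => (⟨x.1, Complex.exp x.2⟩ : TangentBundle 𝓘(ℂ, ℂ) ℂ))
    (Continuous.continuousOn ?_) fun x hx => hx
  have h1 : Continuous fun x : ℂ × ℂ => ((x.1, Complex.exp x.2) : ModelProd ℂ ℂ) :=
    continuous_fst.prodMk (Complex.continuous_exp.comp continuous_snd)
  exact (tangentBundleModelSpaceHomeomorph 𝓘(ℂ, ℂ)).symm.continuous.comp h1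

lemma exists_discVec_lift (u : C(unitInterval, TangentBundle 𝓘(ℂ, ℂ) C))
    (hV : ∀ t, (u t).1 ∈ e.source) (h0 : ∀ t, (u t).2 ≠ 0) :
    ∃ q : C(unitInterval, ℂ × ℂ), ∀ t, (q t).1 ∈ e.target ∧ discVec e (q t) = u t := by
  have h1 : Continuous fun t => tangentMap 𝓘(ℂ, ℂ) 𝓘(ℂ, ℂ) e (u t) :=
    (continuousOn_tangentMap e.open_source (discChart_contMDiffOn he)).comp_continuous
      u.continuous hV
  have h2 : Continuous fun t => (tangentBundleModelSpaceHomeomorph 𝓘(ℂ, ℂ))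
      (tangentMap 𝓘(ℂ, ℂ) 𝓘(ℂ, ℂ) e (u t)) :=
    (tangentBundleModelSpaceHomeomorph 𝓘(ℂ, ℂ)).continuous.comp h1
  have h3 : Continuous fun t => e (u t).1 := continuous_fst.comp h2
  have h4 : Continuous fun t => ((tangentMap 𝓘(ℂ, ℂ) 𝓘(ℂ, ℂ) e (u t)).2 : ℂ) :=
    continuous_snd.comp h2
  obtain ⟨g, hg⟩ := exists_continuous_log ⟨_, h4⟩
    fun t => tangentMap_chart_snd_ne_zero he (hV t) (h0 t)
  exact ⟨⟨fun t => (e (u t).1, g t), h3.prodMk g.continuous⟩, fun t =>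
    ⟨e.map_source (hV t), discVec_of_exp he (hV t) (hg t)⟩⟩

lemma eq_of_discVec_eq {x y : ℂ × ℂ} (hx : x.1 ∈ e.target) (hy : y.1 ∈ e.target)
    (h : discVec e x = discVec e y) :
    ∃ n : ℤ, x = y + (0, n * (2 * Real.pi * Complex.I)) := by
  have h1 := tangentMap_discVec he hx
  rw [h, tangentMap_discVec he hy] at h1
  have h2 : y.1 = x.1 := congrArg (fun u : TangentBundle 𝓘(ℂ, ℂ) ℂ => u.1) h1
  have h3 : Complex.exp y.2 = Complex.exp x.2 :=
    congrArg (fun u : TangentBundle 𝓘(ℂ, ℂ) ℂ => (u.2 : ℂ)) h1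
  obtain ⟨n, hn⟩ := Complex.exp_eq_exp_iff_exists_int.1 h3.symm
  exact ⟨n, Prod.ext (by simp [h2]) (by simpa using hn)⟩

end Disc

end Transport

section Potential

variable {S C : Type*}
  [TopologicalSpace S] [ChartedSpace ℂ S] [IsManifold 𝓘(ℂ, ℂ) ω S]
  [TopologicalSpace C] [ChartedSpace ℂ C] [IsManifold 𝓘(ℂ, ℂ) ω C]

open Sing

/-- Paths of directions over one sheet of a disc are determined, up to homology, by the ends of a
continuous logarithm. -/
lemma IsEtaleSection.exists_potential {π : S → C} {V : Set C} {σ : C → S}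
    (h : IsEtaleSection π V σ) {e : OpenPartialHomeomorph C ℂ}
    (he : e ∈ IsManifold.maximalAtlas 𝓘(ℂ, ℂ) ω C) (hV : e.source = V) (hne : e.target.Nonempty)
    (hconv : Convex ℝ e.target) :
    ∃ G : ℂ × ℂ → Rel (Dir S),
      (∀ (q : C(unitInterval, ℂ × ℂ)) (p : C(unitInterval, Dir S)), (∀ t, (q t).1 ∈ e.target) →
        (∀ t, (p t).1 = tangentMap 𝓘(ℂ, ℂ) 𝓘(ℂ, ℂ) σ (discVec e (q t))) →
        cls (ofPath p) = G (q 1) - G (q 0)) ∧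
      ∀ (x : ℂ × ℂ) (v : Dir S) (θ : ℝ), x.1 ∈ e.target →
        v.1 = tangentMap 𝓘(ℂ, ℂ) 𝓘(ℂ, ℂ) σ (discVec e x) →
        cls (ofPath (Dir.rotPath θ v)) = G (x + (0, θ * Complex.I)) - G x := by
  have hmem : ∀ x : ℂ × ℂ, x.1 ∈ e.target → (discVec e x).1 ∈ V := fun x hx => by
    rw [← hV]; exact e.map_target hx
  let W : Set (ℂ × ℂ) := e.target ×ˢ Set.univ
  let f : W → Dir S := fun x => ⟨tangentMap 𝓘(ℂ, ℂ) 𝓘(ℂ, ℂ) σ (discVec e x),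
    h.snd_ne_zero (hmem _ x.2.1) (discVec_snd_ne_zero he x.2.1)⟩
  have hf : Continuous f := by
    refine Continuous.subtype_mk ?_ _
    refine h.continuousOn_tangentMap.comp_continuous ?_ fun x => hmem _ x.2.1
    exact (continuousOn_discVec he).comp_continuous continuous_subtype_val fun x => x.2.1
  obtain ⟨G, hG⟩ := Sing.exists_potential (hconv.prod convex_univ) (hne.prod Set.univ_nonempty) f hf
  have key : ∀ (q : C(unitInterval, ℂ × ℂ)) (p : C(unitInterval, Dir S)),
      (∀ t, (q t).1 ∈ e.target) →
      (∀ t, (p t).1 = tangentMap 𝓘(ℂ, ℂ) 𝓘(ℂ, ℂ) σ (discVec e (q t))) →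
      cls (ofPath p) = G (q 1) - G (q 0) := fun q p hq hp =>
    hG ⟨fun t => ⟨q t, hq t, trivial⟩, q.continuous.subtype_mk _⟩ p fun t => Subtype.ext (hp t)
  refine ⟨G, key, fun x v θ hx hv => ?_⟩
  have := key ⟨fun t => x + (0, ((θ * (t : ℝ) : ℝ) : ℂ) * Complex.I), by fun_prop⟩
    (Dir.rotPath θ v) (fun t => by simpa using hx) fun t => by
      change (Dir.rot (θ * t) v).1 = tangentMap 𝓘(ℂ, ℂ) 𝓘(ℂ, ℂ) σ (discVec e (x + (0, _)))
      rw [discVec_add, tangentMap_tsmul, Dir.rot_val, hv]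
  rw [this]
  have e1 : x + ((0 : ℂ), ((θ * ((1 : unitInterval) : ℝ) : ℝ) : ℂ) * Complex.I) =
      x + (0, θ * Complex.I) := by simp
  have e0 : x + ((0 : ℂ), ((θ * ((0 : unitInterval) : ℝ) : ℝ) : ℂ) * Complex.I) = x := by
    simp
  simp only [ContinuousMap.coe_mk]
  rw [e1, e0]

/-- Over a disc, the charge of a pair of opposite framed lifts of a path is a difference of
potentials of the end vectors. -/
structure IsFramedPotential (π : S → C) (V : Set C) {ι : Type*} (σ : ι → C → S) {A : Type*}
    [AddCommGroup A] (Φ : Rel (Dir S) →+ A) (h : A) (a a' : ι → TangentBundle 𝓘(ℂ, ℂ) C → A) :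
    Prop where
  transport : ∀ i j (src tgt : C(unitInterval, Dir S)), (∀ t, π (src t).base ∈ V) →
    (∀ t, (src t).base = σ i (π (src t).base)) → (∀ t, (tgt t).base = σ j (π (tgt t).base)) →
    (∀ t, tangentMap 𝓘(ℂ, ℂ) 𝓘(ℂ, ℂ) π (tgt t).1 = tneg (tangentMap 𝓘(ℂ, ℂ) 𝓘(ℂ, ℂ) π (src t).1)) →
    Φ (cls (ofPath tgt - ofPath src)) =
      (a' j (tangentMap 𝓘(ℂ, ℂ) 𝓘(ℂ, ℂ) π (src 1).1) - a i (tangentMap 𝓘(ℂ, ℂ) 𝓘(ℂ, ℂ) π (src 1).1)) -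
      (a' j (tangentMap 𝓘(ℂ, ℂ) 𝓘(ℂ, ℂ) π (src 0).1) - a i (tangentMap 𝓘(ℂ, ℂ) 𝓘(ℂ, ℂ) π (src 0).1))
  half : ∀ i (v : Dir S) (s : ℤˣ), π v.base ∈ V → v.base = σ i (π v.base) →
    Φ (cls (ofPath (Dir.rotPath (((s : ℤ) : ℝ) * Real.pi) v))) =
      a' i (tangentMap 𝓘(ℂ, ℂ) 𝓘(ℂ, ℂ) π v.1) - a i (tangentMap 𝓘(ℂ, ℂ) 𝓘(ℂ, ℂ) π v.1)
        - (if s = 1 then 0 else h)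

theorem exists_isFramedPotential {π : S → C} {V : Set C} (hV : IsDisc V) {ι : Type*}
    {σ : ι → C → S} (hσ : ∀ i, IsEtaleSection π V (σ i)) {A : Type*} [AddCommGroup A]
    (Φ : Rel (Dir S) →+ A) {h : A} (hΦ : ∀ v, Φ (fibreClass v) = h) :
    ∃ a a' : ι → TangentBundle 𝓘(ℂ, ℂ) C → A, IsFramedPotential π V σ Φ h a a' := by
  obtain ⟨e, he, hsrc, hne, hconv⟩ := hV
  choose G hG hrot using fun i => (hσ i).exists_potential he hsrc hne hconv
  have hmem : ∀ x : ℂ × ℂ, x.1 ∈ e.target → (discVec e x).1 ∈ V := fun x hx => by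
    rw [← hsrc]; exact e.map_target hx
  have hshift1 : ∀ i (x : ℂ × ℂ), x.1 ∈ e.target →
      Φ (G i (x + (0, 2 * Real.pi * Complex.I))) = Φ (G i x) + h := by
    intro i x hx
    have h1 := hrot i x ⟨_, (hσ i).snd_ne_zero (hmem _ hx) (discVec_snd_ne_zero he hx)⟩
      (2 * Real.pi) hx rfl
    have h2 := hΦ ⟨_, (hσ i).snd_ne_zero (hmem _ hx) (discVec_snd_ne_zero he hx)⟩
    rw [fibreClass, h1, map_sub, sub_eq_iff_eq_add'] at h2
    rw [← h2]
    push_cast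
    rfl
  have hshift : ∀ i (x : ℂ × ℂ), x.1 ∈ e.target → ∀ n : ℤ,
      Φ (G i (x + (0, n * (2 * Real.pi * Complex.I)))) = Φ (G i x) + n • h := by
    intro i x hx n
    induction n using Int.induction_on with
    | zero =>
      have hx0 : x + ((0 : ℂ), (0 : ℂ)) = x := add_zero x
      simp [hx0]
    | succ k ih =>
      have h1 := hshift1 i (x + (0, (k : ℤ) * (2 * Real.pi * Complex.I))) (by simpa using hx)
      rw [ih, add_assoc x] at h1
      rw [add_smul, one_smul, ← add_assoc, ← h1]
      congr 3
      ext <;> simp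
      ring
    | pred k ih =>
      have h1 := hshift1 i (x + (0, (-(k : ℤ) - 1 : ℤ) * (2 * Real.pi * Complex.I)))
        (by simpa using hx)
      rw [add_assoc x] at h1
      have h2 : (((0 : ℂ), ((-(k : ℤ) - 1 : ℤ) : ℂ) * (2 * Real.pi * Complex.I)) +
          (0, 2 * Real.pi * Complex.I) : ℂ × ℂ) =
          (0, ((-(k : ℤ) : ℤ) : ℂ) * (2 * Real.pi * Complex.I)) := by
        ext <;> simp
        ring
      rw [h2, ih] at h1
      rw [sub_smul, one_smul, ← add_sub_assoc, h1, add_sub_cancel_right]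
  have hlog : ∀ (x : ℂ × ℂ), x.1 ∈ e.target → ∃ n : ℤ,
      x = discLog e (discVec e x) + (0, n * (2 * Real.pi * Complex.I)) := by
    intro x hx
    refine eq_of_discVec_eq he hx ?_ ?_
    · exact e.map_source (e.map_target hx)
    · exact (discVec_discLog he (e.map_target hx) (discVec_snd_ne_zero he hx)).symm
  have hlogmem : ∀ (x : ℂ × ℂ), x.1 ∈ e.target → (discLog e (discVec e x)).1 ∈ e.target :=
    fun x hx => e.map_source (e.map_target hx)
  refine ⟨fun i u => Φ (G i (discLog e u)),
    fun i u => Φ (G i (discLog e u + (0, Real.pi * Complex.I))), ?_, ?_⟩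
  · intro i j src tgt hb hs ht ho
    have hT : Continuous (tangentMap 𝓘(ℂ, ℂ) 𝓘(ℂ, ℂ) π) :=
      (hσ i).smooth.continuous_tangentMap le_top
    obtain ⟨q, hq⟩ := exists_discVec_lift he
      ⟨fun t => tangentMap 𝓘(ℂ, ℂ) 𝓘(ℂ, ℂ) π (src t).1,
        hT.comp (continuous_subtype_val.comp src.continuous)⟩
      (fun t => by rw [hsrc]; exact hb t)
      (fun t => tangentMap_snd_ne_zero ((hσ i).etale _ (hb t)) (src t).2)
    simp only [ContinuousMap.coe_mk] at hq
    have hbt : ∀ t, π (tgt t).base ∈ V := fun t => by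
      have : π (tgt t).base = π (src t).base := congrArg (fun u => u.1) (ho t)
      rw [this]; exact hb t
    have h1 := hG i q src (fun t => (hq t).1) fun t => by
      rw [(hq t).2, (hσ i).section_tangentMap (hb t) (hs t)]
    have h2 := hG j ⟨fun t => q t + (0, Real.pi * Complex.I), by fun_prop⟩ tgt
      (fun t => by simpa using (hq t).1) fun t => by
        simp only [ContinuousMap.coe_mk]
        rw [discVec_add, (hq t).2, Complex.exp_pi_mul_I, ← tneg_eq_tsmul, ← ho,
          (hσ j).section_tangentMap (hbt t) (ht t)]
    have hend : ∀ t, ∀ i j, Φ (G j (q t + (0, Real.pi * Complex.I))) - Φ (G i (q t)) =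
        Φ (G j (discLog e (tangentMap 𝓘(ℂ, ℂ) 𝓘(ℂ, ℂ) π (src t).1) + (0, Real.pi * Complex.I)))
        - Φ (G i (discLog e (tangentMap 𝓘(ℂ, ℂ) 𝓘(ℂ, ℂ) π (src t).1))) := by
      intro t i j
      obtain ⟨n, hn⟩ := hlog (q t) (hq t).1
      have hm := hlogmem _ (hq t).1
      rw [(hq t).2] at hn hm
      rw [hn, hshift i _ hm, add_right_comm, hshift j _ (by simpa using hm)]
      abel
    rw [cls_sub, h1, h2]
    simp only [ContinuousMap.coe_mk, map_sub]
    rw [← hend, ← hend]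
    abel
  · intro i v s hb hs
    have h0 := tangentMap_snd_ne_zero ((hσ i).etale _ hb) v.2
    have hx : (discLog e (tangentMap 𝓘(ℂ, ℂ) 𝓘(ℂ, ℂ) π v.1)).1 ∈ e.target :=
      e.map_source (by rw [hsrc]; exact hb)
    have hv : v.1 = tangentMap 𝓘(ℂ, ℂ) 𝓘(ℂ, ℂ) (σ i)
        (discVec e (discLog e (tangentMap 𝓘(ℂ, ℂ) 𝓘(ℂ, ℂ) π v.1))) := by
      rw [discVec_discLog he (by rw [hsrc]; exact hb) h0, (hσ i).section_tangentMap hb hs]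
    rw [hrot i _ v _ hx hv, map_sub]
    rcases Int.units_eq_one_or s with rfl | rfl
    · simp
    · have h1 := hshift i (discLog e (tangentMap 𝓘(ℂ, ℂ) 𝓘(ℂ, ℂ) π v.1) +
        (0, Real.pi * Complex.I)) (by simpa using hx) (-1)
      rw [add_assoc] at h1
      have h2 : (((0 : ℂ), (Real.pi : ℂ) * Complex.I) +
          (0, ((-1 : ℤ) : ℂ) * (2 * Real.pi * Complex.I)) : ℂ × ℂ) =
          (0, (((((-1 : ℤˣ) : ℤ) : ℝ) * Real.pi : ℝ) : ℂ) * Complex.I) := by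
        ext <;> simp
        ring
      rw [h2] at h1
      rw [h1, if_neg (by decide)]
      simp only [neg_smul, one_smul]
      abel

end Potential

section DiscSections

variable {S C : Type*}
  [TopologicalSpace S] [ChartedSpace ℂ S]
  [TopologicalSpace C] [ChartedSpace ℂ C]

lemma IsDisc.isOpen {V : Set C} (hV : IsDisc V) : IsOpen V := by
  obtain ⟨e, -, rfl, -⟩ := hV
  exact e.open_source

variable {π : S → C} {B : Set C} {K : ℕ} (hπ : IsSimpleBranchedCover π B K)

include hπ

lemma IsSimpleBranchedCover.isEtaleSection {V : Set C} (hV : IsOpen V) (hB : Disjoint V B)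
    {σ : C → S} (hc : ContinuousOn σ V) (hs : ∀ z ∈ V, π (σ z) = z) : IsEtaleSection π V σ :=
  ⟨hV, hπ.holomorphic, fun x hx => hπ.etale x (hB.notMem_of_mem_left hx), hc, hs⟩

/-- Over a disc off the branch points there is a section through every point. -/
lemma IsSimpleBranchedCover.exists_section {V : Set C} (hV : IsDisc V) (hB : Disjoint V B) {x : S}
    (hx : π x ∈ V) : ∃ σ : C → S, IsEtaleSection π V σ ∧ σ (π x) = x := by
  classical
  have hV' := hV
  obtain ⟨e, he, rfl, hne, hconv⟩ := hV'
  have : ContractibleSpace e.target := hconv.contractibleSpace hne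
  have : LocallyPathConnectedSpace e.target := e.open_target.locallyPathConnectedSpace
  let f : C(e.target, C) := ⟨fun w => e.symm w, e.symm.continuousOn.domRestrict⟩
  have hf : ∀ w, f w ∈ Bᶜ := fun w => hB.notMem_of_mem_left (e.map_target w.2)
  obtain ⟨F, ⟨hF0, hF⟩, -⟩ := hπ.covering.existsUnique_continuousMap_lifts f
    (a₀ := ⟨e (π x), e.map_source hx⟩) (e₀ := x) (e.left_inv hx).symm hf
  let g : ℂ → S := fun w => if h : w ∈ e.target then F ⟨w, h⟩ else x
  have hg : ContinuousOn g e.target := by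
    rw [continuousOn_iff_continuous_domRestrict]
    convert F.continuous using 1
    ext w
    simp [g]
  refine ⟨fun z => g (e z), hπ.isEtaleSection e.open_source hB ?_ ?_, ?_⟩
  · exact hg.comp e.continuousOn e.mapsTo
  · intro z hz
    have h1 := congrFun hF ⟨e z, e.map_source hz⟩
    simp only [g, e.map_source hz, dite_true]
    exact h1.trans (e.left_inv hz)
  · simp only [g, e.map_source hx, dite_true]
    exact hF0

/-- A path over `V` that starts on a sheet stays on it. -/
lemma IsSimpleBranchedCover.eq_section {V : Set C} (hB : Disjoint V B) {σ : C → S}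
    (hσ : ContinuousOn σ V) (hs : ∀ z ∈ V, π (σ z) = z) (p : C(unitInterval, S))
    (hp : ∀ t, π (p t) ∈ V) (h0 : p 0 = σ (π (p 0))) (t : unitInterval) : p t = σ (π (p t)) := by
  have hcov : IsCoveringMap (V.restrictPreimage π) :=
    (hπ.covering.mono (fun z hz => hB.notMem_of_mem_left hz)).isCoveringMap_restrictPreimage
  let g₁ : unitInterval → π ⁻¹' V := fun t => ⟨p t, hp t⟩
  let g₂ : unitInterval → π ⁻¹' V := fun t => ⟨σ (π (p t)), by
    rw [Set.mem_preimage, hs _ (hp t)]; exact hp t⟩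
  have c1 : Continuous g₁ := p.continuous.subtype_mk _
  have c2 : Continuous g₂ := (hσ.comp_continuous
    (hπ.holomorphic.continuous.comp p.continuous) hp).subtype_mk _
  have := hcov.eq_of_comp_eq c1 c2 (by
    ext t
    exact (hs _ (hp t)).symm) 0 (Subtype.ext h0)
  exact congrArg Subtype.val (congrFun this t)

end DiscSections

section Runs

open Sing

variable {S C : Type*}
  [TopologicalSpace S] [ChartedSpace ℂ S] [IsManifold 𝓘(ℂ, ℂ) ω S]
  [TopologicalSpace C] [ChartedSpace ℂ C]
  {π : S → C} {B : Set C} {St Jt : Type*}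

namespace Network

variable (N : Network π B St Jt)

/-- The street chain `L` runs from the pair of directions `x, y` to the pair `x', y'`. -/
inductive Run : List St → Dir S → Dir S → Dir S → Dir S → Prop
  | single (s : St) : Run [s] ((N.street s).src 0) ((N.street s).tgt 0) ((N.street s).src 1)
      ((N.street s).tgt 1)
  | cons (s : St) {L : List St} {x' y' : Dir S} :
      Run L ((N.street s).src 1) ((N.street s).tgt 1) x' y' →
      Run (s :: L) ((N.street s).src 0) ((N.street s).tgt 0) x' y'

/-- The street chain `L` of type `k l` runs from the joint `v` to the joint `w`. -/
def JointRun (L : List St) (v w : Jt) (k l : Fin 3) : Prop :=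
  N.Run L (N.frame v k) (N.frame v l).neg (N.frame w k) (N.frame w l).neg

/-- The tangent vector at a joint whose lifts are the frames. -/
noncomputable def jointVec (v : Jt) : TangentBundle 𝓘(ℂ, ℂ) C := tangentMap 𝓘(ℂ, ℂ) 𝓘(ℂ, ℂ) π (N.frame v 0).1

variable {N}

lemma tangentMap_frame (v : Jt) (r : Fin 3) :
    tangentMap 𝓘(ℂ, ℂ) 𝓘(ℂ, ℂ) π (N.frame v r).1 = N.jointVec v := N.frame_proj v r 0

lemma proj_frame (v : Jt) (r : Fin 3) : π (N.frame v r).base = (N.jointVec v).1 :=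
  congrArg (fun u : TangentBundle 𝓘(ℂ, ℂ) C => u.1) (tangentMap_frame v r)

lemma run_of_forall {R : St → St → Prop} (hR : ∀ s s', R s s' →
      (N.street s).src 1 = (N.street s').src 0 ∧ (N.street s).tgt 1 = (N.street s').tgt 0)
    {L : List St} (hne : L ≠ []) (hch : L.IsChain R) {s s' : St} (hs : L.head? = some s)
    (hs' : L.getLast? = some s') :
    N.Run L ((N.street s).src 0) ((N.street s).tgt 0) ((N.street s').src 1)
      ((N.street s').tgt 1) := by
  induction L generalizing s with
  | nil => exact absurd rfl hne
  | cons a L ih =>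
    obtain rfl : a = s := by simpa using hs
    cases L with
    | nil =>
      obtain rfl : a = s' := by simpa using hs'
      exact .single a
    | cons b L =>
      rw [List.isChain_cons_cons] at hch
      have h1 := ih (by simp) hch.2 (s := b) rfl (by simpa [List.getLast?_cons_cons] using hs')
      rw [← (hR _ _ hch.1).1, ← (hR _ _ hch.1).2] at h1
      exact .cons a h1

end Network

lemma SolitonNetwork.trans_cons (N : SolitonNetwork π B St Jt) (s : St) (L : List St) :
    N.trans (s :: L) = (N.street s).trans + N.trans L := by
  simp [SolitonNetwork.trans]

lemma SolitonNetwork.trans_singleton (N : SolitonNetwork π B St Jt) (s : St) :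
    N.trans [s] = (N.street s).trans := by
  simp [SolitonNetwork.trans]

lemma Sing.bdry_ofPath {X : Type*} [TopologicalSpace X] (p : C(unitInterval, X)) :
    bdry (ofPath p) = Finsupp.single (p 1) 1 - Finsupp.single (p 0) 1 := by
  simp [bdry, ofPath]

lemma FramedStreet.bdry_trans (p : FramedStreet π B) :
    bdry p.trans = (Finsupp.single (p.tgt 1) 1 - Finsupp.single (p.src 1) 1) -
      (Finsupp.single (p.tgt 0) 1 - Finsupp.single (p.src 0) 1) := by
  rw [FramedStreet.trans, map_sub, bdry_ofPath, bdry_ofPath]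
  abel

lemma Network.Run.bdry_trans {N : SolitonNetwork π B St Jt} {L : List St} {x y x' y' : Dir S}
    (h : N.Run L x y x' y') :
    bdry (N.trans L) = (Finsupp.single y' 1 - Finsupp.single x' 1) -
      (Finsupp.single y 1 - Finsupp.single x 1) := by
  induction h with
  | single s => rw [N.trans_singleton, FramedStreet.bdry_trans]
  | cons s h ih =>
    rw [N.trans_cons, map_add, FramedStreet.bdry_trans, ih]
    abel

lemma SolitonNetwork.trace_cons_subset {N : SolitonNetwork π B St Jt} {s : St} {L : List St}
    {V : Set C} (h : N.trace (s :: L) ⊆ V) :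
    (∀ t, π ((N.street s).src t).base ∈ V) ∧ N.trace L ⊆ V :=
  ⟨fun t => h ⟨s, by simp, t, rfl⟩, fun z ⟨s', hs', t, ht⟩ => h ⟨s', by simp [hs'], t, ht⟩⟩

lemma FramedStreet.proj_tgt (p : FramedStreet π B) (t : unitInterval) :
    π (p.tgt t).base = π (p.src t).base :=
  congrArg (fun u => u.1) (p.opposite t)

variable [IsManifold 𝓘(ℂ, ℂ) ω C]

variable {K : ℕ} {V : Set C} {ι : Type*} {σ : ι → C → S} {A : Type*} [AddCommGroup A]
  {Φ : Rel (Dir S) →+ A} {h : A} {a a' : ι → TangentBundle 𝓘(ℂ, ℂ) C → A}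

/-- Charge of a chain of streets over a disc. -/
lemma Network.Run.transport (hπ : IsSimpleBranchedCover π B K) {N : SolitonNetwork π B St Jt}
    (hB : Disjoint V B) (hσ : ∀ i, IsEtaleSection π V (σ i))
    (hpot : IsFramedPotential π V σ Φ h a a') {L : List St} {x y x' y' : Dir S}
    (hr : N.Run L x y x' y') (hL : N.trace L ⊆ V) {i j : ι} (hx : x.base = σ i (π x.base))
    (hy : y.base = σ j (π y.base)) :
    x'.base = σ i (π x'.base) ∧ y'.base = σ j (π y'.base) ∧
    Φ (cls (N.trans L)) =
      (a' j (tangentMap 𝓘(ℂ, ℂ) 𝓘(ℂ, ℂ) π x'.1) - a i (tangentMap 𝓘(ℂ, ℂ) 𝓘(ℂ, ℂ) π x'.1)) -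
      (a' j (tangentMap 𝓘(ℂ, ℂ) 𝓘(ℂ, ℂ) π x.1) - a i (tangentMap 𝓘(ℂ, ℂ) 𝓘(ℂ, ℂ) π x.1)) := by
  have key : ∀ s, (∀ t, π ((N.street s).src t).base ∈ V) →
      ((N.street s).src 0).base = σ i (π ((N.street s).src 0).base) →
      ((N.street s).tgt 0).base = σ j (π ((N.street s).tgt 0).base) →
      ((N.street s).src 1).base = σ i (π ((N.street s).src 1).base) ∧
      ((N.street s).tgt 1).base = σ j (π ((N.street s).tgt 1).base) ∧
      Φ (cls (N.street s).trans) =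
      (a' j (tangentMap 𝓘(ℂ, ℂ) 𝓘(ℂ, ℂ) π ((N.street s).src 1).1) -
        a i (tangentMap 𝓘(ℂ, ℂ) 𝓘(ℂ, ℂ) π ((N.street s).src 1).1)) -
      (a' j (tangentMap 𝓘(ℂ, ℂ) 𝓘(ℂ, ℂ) π ((N.street s).src 0).1) -
        a i (tangentMap 𝓘(ℂ, ℂ) 𝓘(ℂ, ℂ) π ((N.street s).src 0).1)) := by
    intro s hs h0 h1
    have hsrc := hπ.eq_section hB (hσ i).cont (hσ i).sec
      ((Dir.baseMap S).comp (N.street s).src) hs h0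
    have htgt := hπ.eq_section hB (hσ j).cont (hσ j).sec
      ((Dir.baseMap S).comp (N.street s).tgt)
      (fun t => by
        change π ((N.street s).tgt t).base ∈ V
        rw [(N.street s).proj_tgt]; exact hs t) h1
    exact ⟨hsrc 1, htgt 1, hpot.transport i j _ _ hs hsrc htgt (N.street s).opposite⟩
  induction hr with
  | single s =>
    rw [N.trans_singleton]
    exact key s (SolitonNetwork.trace_cons_subset hL).1 hx hy
  | cons s hr ih =>
    obtain ⟨hs, hL'⟩ := SolitonNetwork.trace_cons_subset hL
    obtain ⟨k1, k2, k3⟩ := key s hs hx hy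
    obtain ⟨e1, e2, e3⟩ := ih hL' k1 k2
    refine ⟨e1, e2, ?_⟩
    rw [N.trans_cons, cls_add, map_add, k3, e3]
    abel

/-- Two potentials that belong to the same sheets at the start of a chain of streets have the same
differences along it. -/
lemma Network.Run.compare (hπ : IsSimpleBranchedCover π B K) {N : SolitonNetwork π B St Jt}
    (hB : Disjoint V B) (hσ : ∀ i, IsEtaleSection π V (σ i))
    (hpot : IsFramedPotential π V σ Φ h a a')
    {V₂ : Set C} {κ : Type*} {σ₂ : κ → C → S} {b b' : κ → TangentBundle 𝓘(ℂ, ℂ) C → A}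
    (hσ₂ : ∀ i, IsEtaleSection π V₂ (σ₂ i)) (hpot₂ : IsFramedPotential π V₂ σ₂ Φ h b b')
    {L : List St} {x y x' y' : Dir S}
    (hr : N.Run L x y x' y') (hL : N.trace L ⊆ V) (hL₂ : N.trace L ⊆ V₂) {i j : ι} {k l : κ}
    (hi : σ i (π x.base) = σ₂ k (π x.base)) (hj : σ j (π x.base) = σ₂ l (π x.base)) :
    σ i (π x'.base) = σ₂ k (π x'.base) ∧ σ j (π x'.base) = σ₂ l (π x'.base) ∧
      (a' j (tangentMap 𝓘(ℂ, ℂ) 𝓘(ℂ, ℂ) π x'.1) - a i (tangentMap 𝓘(ℂ, ℂ) 𝓘(ℂ, ℂ) π x'.1)) -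
      (a' j (tangentMap 𝓘(ℂ, ℂ) 𝓘(ℂ, ℂ) π x.1) - a i (tangentMap 𝓘(ℂ, ℂ) 𝓘(ℂ, ℂ) π x.1)) =
      (b' l (tangentMap 𝓘(ℂ, ℂ) 𝓘(ℂ, ℂ) π x'.1) - b k (tangentMap 𝓘(ℂ, ℂ) 𝓘(ℂ, ℂ) π x'.1)) -
      (b' l (tangentMap 𝓘(ℂ, ℂ) 𝓘(ℂ, ℂ) π x.1) - b k (tangentMap 𝓘(ℂ, ℂ) 𝓘(ℂ, ℂ) π x.1)) := by
  have key : ∀ s, (∀ t, π ((N.street s).src t).base ∈ V) →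
      (∀ t, π ((N.street s).src t).base ∈ V₂) →
      σ i (π ((N.street s).src 0).base) = σ₂ k (π ((N.street s).src 0).base) →
      σ j (π ((N.street s).src 0).base) = σ₂ l (π ((N.street s).src 0).base) →
      σ i (π ((N.street s).src 1).base) = σ₂ k (π ((N.street s).src 1).base) ∧
      σ j (π ((N.street s).src 1).base) = σ₂ l (π ((N.street s).src 1).base) ∧
      (a' j (tangentMap 𝓘(ℂ, ℂ) 𝓘(ℂ, ℂ) π ((N.street s).src 1).1) -
        a i (tangentMap 𝓘(ℂ, ℂ) 𝓘(ℂ, ℂ) π ((N.street s).src 1).1)) -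
      (a' j (tangentMap 𝓘(ℂ, ℂ) 𝓘(ℂ, ℂ) π ((N.street s).src 0).1) -
        a i (tangentMap 𝓘(ℂ, ℂ) 𝓘(ℂ, ℂ) π ((N.street s).src 0).1)) =
      (b' l (tangentMap 𝓘(ℂ, ℂ) 𝓘(ℂ, ℂ) π ((N.street s).src 1).1) -
        b k (tangentMap 𝓘(ℂ, ℂ) 𝓘(ℂ, ℂ) π ((N.street s).src 1).1)) -
      (b' l (tangentMap 𝓘(ℂ, ℂ) 𝓘(ℂ, ℂ) π ((N.street s).src 0).1) -
        b k (tangentMap 𝓘(ℂ, ℂ) 𝓘(ℂ, ℂ) π ((N.street s).src 0).1)) := by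
    intro s hs hs₂ h0 h1
    have hT : Continuous (tangentMap 𝓘(ℂ, ℂ) 𝓘(ℂ, ℂ) π) :=
      hπ.holomorphic.continuous_tangentMap le_top
    let u : C(unitInterval, TangentBundle 𝓘(ℂ, ℂ) C) :=
      ⟨fun t => tangentMap 𝓘(ℂ, ℂ) 𝓘(ℂ, ℂ) π ((N.street s).src t).1,
        hT.comp (continuous_subtype_val.comp (N.street s).src.continuous)⟩
    have hTn : Continuous fun t => tneg (u t) := by
      have h1 : Continuous fun t => tangentMap 𝓘(ℂ, ℂ) 𝓘(ℂ, ℂ) π ((N.street s).tgt t).1 :=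
        hT.comp (continuous_subtype_val.comp (N.street s).tgt.continuous)
      exact h1.congr (N.street s).opposite
    let u' : C(unitInterval, TangentBundle 𝓘(ℂ, ℂ) C) := ⟨fun t => tneg (u t), hTn⟩
    have hu0 : ∀ t, (u t).2 ≠ 0 := fun t =>
      tangentMap_snd_ne_zero ((hσ i).etale _ (hs t)) ((N.street s).src t).2
    obtain ⟨p, hp⟩ := (hσ i).exists_lift u hs hu0
    obtain ⟨p', hp'⟩ := (hσ j).exists_lift u' hs fun t => neg_ne_zero.2 (hu0 t)
    have hpu : ∀ t, tangentMap 𝓘(ℂ, ℂ) 𝓘(ℂ, ℂ) π (p t).1 = u t := fun t => by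
      rw [hp, (hσ i).tangentMap_section (hs t)]
    have hpu' : ∀ t, tangentMap 𝓘(ℂ, ℂ) 𝓘(ℂ, ℂ) π (p' t).1 = tneg (u t) := fun t => by
      rw [hp', (hσ j).tangentMap_section (hs t)]; rfl
    have hpb : ∀ t, π (p t).base = (u t).1 := fun t => congrArg (fun u => u.1) (hpu t)
    have hpb' : ∀ t, π (p' t).base = (u t).1 := fun t => congrArg (fun u => u.1) (hpu' t)
    have g1 : ∀ t, (p t).base = σ i (π (p t).base) := fun t => by
      rw [hpb]; exact congrArg (fun u => u.1) (hp t)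
    have g2 : ∀ t, (p' t).base = σ j (π (p' t).base) := fun t => by
      rw [hpb']; exact congrArg (fun u => u.1) (hp' t)
    have hV : ∀ t, π (p t).base ∈ V := fun t => by rw [hpb]; exact hs t
    have hV₂ : ∀ t, π (p t).base ∈ V₂ := fun t => by rw [hpb]; exact hs₂ t
    have hV₂' : ∀ t, π (p' t).base ∈ V₂ := fun t => by rw [hpb']; exact hs₂ t
    have hB₂ : ∀ t, π ((N.street s).src t).base ∉ B := fun t => hB.notMem_of_mem_left (hs t)
    have k1 : ∀ t, (p t).base = σ₂ k (π (p t).base) := by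
      have hd : Disjoint (V ∩ V₂) B := hB.mono_left Set.inter_subset_left
      refine hπ.eq_section hd ((hσ₂ k).cont.mono Set.inter_subset_right)
        (fun z hz => (hσ₂ k).sec z hz.2) ((Dir.baseMap S).comp p) (fun t => ⟨hV t, hV₂ t⟩) ?_
      change (p 0).base = σ₂ k (π (p 0).base)
      rw [g1, hpb]
      rw [show (u 0).1 = π ((N.street s).src 0).base from rfl, h0, (hσ₂ k).sec _ (hs₂ 0)]
    have k2 : ∀ t, (p' t).base = σ₂ l (π (p' t).base) := by
      have hd : Disjoint (V ∩ V₂) B := hB.mono_left Set.inter_subset_left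
      refine hπ.eq_section hd ((hσ₂ l).cont.mono Set.inter_subset_right)
        (fun z hz => (hσ₂ l).sec z hz.2) ((Dir.baseMap S).comp p')
        (fun t => ⟨by change π (p' t).base ∈ V; rw [hpb']; exact hs t, hV₂' t⟩) ?_
      change (p' 0).base = σ₂ l (π (p' 0).base)
      rw [g2, hpb']
      rw [show (u 0).1 = π ((N.street s).src 0).base from rfl, h1, (hσ₂ l).sec _ (hs₂ 0)]
    have hop : ∀ t, tangentMap 𝓘(ℂ, ℂ) 𝓘(ℂ, ℂ) π (p' t).1 =
        tneg (tangentMap 𝓘(ℂ, ℂ) 𝓘(ℂ, ℂ) π (p t).1) := fun t => by rw [hpu', hpu]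
    have e1 := hpot.transport i j p p' hV g1 g2 hop
    have e2 := hpot₂.transport k l p p' hV₂ k1 k2 hop
    rw [hpu, hpu] at e1 e2
    refine ⟨?_, ?_, e1.symm.trans e2⟩
    · have := (g1 1).symm.trans (k1 1)
      rwa [hpb] at this
    · have := (g2 1).symm.trans (k2 1)
      rwa [hpb'] at this
  induction hr with
  | single s =>
    exact key s (SolitonNetwork.trace_cons_subset hL).1 (SolitonNetwork.trace_cons_subset hL₂).1
      hi hj
  | cons s hr ih =>
    obtain ⟨hs, hL'⟩ := SolitonNetwork.trace_cons_subset hL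
    obtain ⟨hs₂, hL₂'⟩ := SolitonNetwork.trace_cons_subset hL₂
    obtain ⟨k1, k2, k3⟩ := key s hs hs₂ hi hj
    obtain ⟨e1, e2, e3⟩ := ih hL' hL₂' k1 k2
    refine ⟨e1, e2, ?_⟩
    have := congrArg₂ (· + ·) e3 k3
    simpa only [sub_add_sub_cancel] using this

end Runs

section FinProd

variable {M : Type*} [CommMonoid M] {m : ℕ}

@[to_additive]
lemma prod_filter_lt_succ (f : Fin m → M) {l l' : Fin m} (h : l.val + 1 = l'.val) :
    ∏ r with r < l', f r = (∏ r with r < l, f r) * f l := by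
  have : Finset.univ.filter (fun r : Fin m => r < l') =
      insert l (Finset.univ.filter fun r : Fin m => r < l) := by
    ext r
    simp only [Finset.mem_filter, Finset.mem_univ, true_and, Finset.mem_insert, Fin.lt_def,
      Fin.ext_iff]
    omega
  rw [this, Finset.prod_insert (by simp), mul_comm]

@[to_additive]
lemma prod_filter_gt_succ (f : Fin m → M) {l l' : Fin m} (h : l.val + 1 = l'.val) :
    ∏ r with l < r, f r = (∏ r with l' < r, f r) * f l' := by
  have : Finset.univ.filter (fun r : Fin m => l < r) =
      insert l' (Finset.univ.filter fun r : Fin m => l' < r) := by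
    ext r
    simp only [Finset.mem_filter, Finset.mem_univ, true_and, Finset.mem_insert, Fin.lt_def,
      Fin.ext_iff]
    omega
  rw [this, Finset.prod_insert (by simp), mul_comm]

@[to_additive]
lemma prod_filter_lt_first (f : Fin m → M) {l : Fin m} (h : l.val = 0) :
    ∏ r with r < l, f r = 1 := by
  rw [Finset.filter_false_of_mem, Finset.prod_empty]
  intro r _
  rw [Fin.lt_def]
  omega

@[to_additive]
lemma prod_filter_gt_last (f : Fin m → M) {l : Fin m} (h : l.val + 1 = m) :
    ∏ r with l < r, f r = 1 := by
  rw [Finset.filter_false_of_mem, Finset.prod_empty]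
  intro r _
  rw [Fin.lt_def]
  omega

/-- Induction along the horses of a herd, upwards. -/
lemma Fin.induction_up {P : Fin m → Prop} (h0 : ∀ l, l.val = 0 → P l)
    (hs : ∀ l l' : Fin m, l.val + 1 = l'.val → P l → P l') (l : Fin m) : P l := by
  obtain ⟨k, hk⟩ := l
  induction k with
  | zero => exact h0 _ rfl
  | succ k ih => exact hs ⟨k, by omega⟩ _ rfl (ih _)

/-- Induction along the horses of a herd, downwards. -/
lemma Fin.induction_down {P : Fin m → Prop} (h0 : ∀ l, l.val + 1 = m → P l)
    (hs : ∀ l l' : Fin m, l.val + 1 = l'.val → P l' → P l) (l : Fin m) : P l := by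
  obtain ⟨k, hk⟩ := l
  obtain ⟨d, hd⟩ : ∃ d, k + 1 + d = m := ⟨m - (k + 1), by omega⟩
  induction d generalizing k with
  | zero => exact h0 _ hd
  | succ d ih => exact hs _ ⟨k + 1, by omega⟩ rfl (ih (k + 1) (by omega) (by omega))

end FinProd

section Joints

open Sing

variable {S C : Type*}
  [TopologicalSpace S] [ChartedSpace ℂ S] [IsManifold 𝓘(ℂ, ℂ) ω S]
  [TopologicalSpace C] [ChartedSpace ℂ C]
  {π : S → C} {B : Set C} {St Jt : Type*}

namespace SolitonNetwork

variable {N : SolitonNetwork π B St Jt}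

lemma Passes.ends {s s' : St} (h : N.Passes s s') :
    (N.street s).src 1 = (N.street s').src 0 ∧ (N.street s).tgt 1 = (N.street s').tgt 0 := by
  obtain ⟨v, i, j, k, -, -, -, h1, h2, -⟩ := h
  have e1 := N.attach_end v j i s h1
  have e2 := N.attach_start v i j s' h2
  exact ⟨e1.1.trans e2.1.symm, e1.2.trans e2.2.symm⟩

lemma jointRun {L : List St} {v w : Jt} {i j : Fin 3} (hij : i < j)
    (hL : L ≠ [] ∧ L.IsChain N.Passes) (hs : N.StartsAt L v i j) (he : N.EndsAt L w j i) :
    N.JointRun L v w i j := by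
  obtain ⟨s, hs, hs'⟩ := hs
  obtain ⟨s₁, he, he'⟩ := he
  have e1 := N.attach_start v i j s hs'
  have e2 := N.attach_end w j i s₁ he'
  have hr := Network.run_of_forall (N := N.toNetwork) (fun s s' h => Passes.ends h) hL.1 hL.2 hs he
  rw [e1.1, e1.2, e2.1, e2.2] at hr
  simp only [orient, hij, hij.not_gt, if_true, if_false] at hr
  exact hr

end SolitonNetwork

lemma Network.Run.proj_mem {N : SolitonNetwork π B St Jt} {L : List St} {x y x' y' : Dir S}
    (h : N.Run L x y x' y') {V : Set C} (hL : N.trace L ⊆ V) : π x.base ∈ V := by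
  cases h with
  | single s => exact (SolitonNetwork.trace_cons_subset hL).1 0
  | cons s _ => exact (SolitonNetwork.trace_cons_subset hL).1 0

variable [IsManifold 𝓘(ℂ, ℂ) ω C] {K : ℕ} {A : Type*} [AddCommGroup A]

/-- Charges of the opposite sides of a quadrangle of streets that lies in a disc: two opposite
corners' sides lie in further discs, with potentials. -/
lemma SolitonNetwork.transport_sub_of_quadrangle (hπ : IsSimpleBranchedCover π B K)
    (N : SolitonNetwork π B St Jt) (Φ : Rel (Dir S) →+ A) {h : A}
    (hΦ : ∀ v, Φ (fibreClass v) = h) {U U' V : Set C} (hV : IsDisc V) (hVB : Disjoint V B)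
    {τ τ' : Fin 3 → C → S} (hτ : ∀ i, IsEtaleSection π U (τ i))
    (hτ' : ∀ i, IsEtaleSection π U' (τ' i)) {a a' b b' : Fin 3 → TangentBundle 𝓘(ℂ, ℂ) C → A}
    (pU : IsFramedPotential π U τ Φ h a a') (pU' : IsFramedPotential π U' τ' Φ h b b')
    {i j k l k' l' : Fin 3} {P P₂ R R₂ : Jt}
    (fP : ∀ r, τ r (N.jointVec P).1 = (N.frame P r).base)
    (fP₂ : ∀ r, τ r (N.jointVec P₂).1 = (N.frame P₂ r).base)
    (fR : ∀ r, τ' r (N.jointVec R).1 = (N.frame R r).base) {LX LY Lp Lp' : List St}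
    (hX : N.JointRun LX P P₂ k l) (hXU : N.trace LX ⊆ U) (hXV : N.trace LX ⊆ V)
    (hY : N.JointRun LY R R₂ k' l') (hYU : N.trace LY ⊆ U') (hYV : N.trace LY ⊆ V)
    (hp : N.JointRun Lp P R i j) (hpV : N.trace Lp ⊆ V)
    (hp' : N.JointRun Lp' P₂ R₂ i j) (hpV' : N.trace Lp' ⊆ V) :
    Φ (cls (N.trans Lp)) - Φ (cls (N.trans Lp')) =
      ((b' j (N.jointVec R) - b i (N.jointVec R)) - (b' j (N.jointVec R₂) - b i (N.jointVec R₂))) -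
      ((a' j (N.jointVec P) - a i (N.jointVec P)) -
        (a' j (N.jointVec P₂) - a i (N.jointVec P₂))) := by
  have pf : ∀ v r, π (N.frame v r).base = (N.jointVec v).1 := fun v r => Network.proj_frame v r
  have tf : ∀ v r, tangentMap 𝓘(ℂ, ℂ) 𝓘(ℂ, ℂ) π (N.frame v r).1 = N.jointVec v := fun v r =>
    Network.tangentMap_frame v r
  have hPV : (N.jointVec P).1 ∈ V := pf P i ▸ hp.proj_mem hpV
  obtain ⟨σ₀, hσ₀, hx₀⟩ := hπ.exists_section hV hVB (x := (N.frame P i).base)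
    (by rw [pf]; exact hPV)
  obtain ⟨σ₁, hσ₁, hx₁⟩ := hπ.exists_section hV hVB (x := (N.frame P j).base)
    (by rw [pf]; exact hPV)
  rw [pf] at hx₀ hx₁
  let σ : Fin 2 → C → S := ![σ₀, σ₁]
  have hσ : ∀ r, IsEtaleSection π V (σ r) := by
    intro r
    fin_cases r
    · exact hσ₀
    · exact hσ₁
  obtain ⟨c, c', pV⟩ := exists_isFramedPotential hV hσ Φ hΦ
  obtain ⟨x1, x2, x3⟩ := hX.compare hπ hVB hσ pV hτ pU hXV hXU (i := 0) (j := 1) (k := i) (l := j)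
    (by rw [pf, fP]; exact hx₀) (by rw [pf, fP]; exact hx₁)
  rw [pf, fP₂] at x1 x2
  obtain ⟨y1, y2, y3⟩ := hp.transport hπ hVB hσ pV hpV (i := 0) (j := 1)
    (by rw [pf]; exact hx₀.symm)
    (by
      change (N.frame P j).base = σ 1 (π (N.frame P j).base)
      rw [pf]; exact hx₁.symm)
  change (N.frame R j).base = σ 1 (π (N.frame R j).base) at y2
  rw [pf] at y1 y2
  obtain ⟨-, -, z3⟩ := hY.compare hπ hVB hσ pV hτ' pU' hYV hYU (i := 0) (j := 1) (k := i) (l := j)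
    (by rw [pf, fR, ← y1]) (by rw [pf, fR, ← y2])
  obtain ⟨-, -, w3⟩ := hp'.transport hπ hVB hσ pV hpV' (i := 0) (j := 1)
    (by rw [pf]; exact x1.symm)
    (by
      change (N.frame P₂ j).base = σ 1 (π (N.frame P₂ j).base)
      rw [pf]; exact x2.symm)
  rw [tf, tf] at x3 y3 z3 w3
  rw [y3, w3, ← neg_sub (b' j (N.jointVec R₂) - _), ← z3,
    ← neg_sub (a' j (N.jointVec P₂) - _) (a' j (N.jointVec P) - _), ← x3]
  abel

end Joints

section HerdCharges

open Sing

variable {S C : Type*}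
  [TopologicalSpace S] [ChartedSpace ℂ S] [IsManifold 𝓘(ℂ, ℂ) ω S]
  [TopologicalSpace C] [ChartedSpace ℂ C]
  {π : S → C} {B : Set C} {St Jt : Type*}

lemma SolitonNetwork.trace_mono {N : SolitonNetwork π B St Jt} {L L' : List St}
    (h : ∀ s ∈ L, s ∈ L') : N.trace L ⊆ N.trace L' := fun _ ⟨s, hs, t, ht⟩ => ⟨s, h s hs, t, ht⟩

namespace Herd

variable {N : SpectralNetwork π B St Jt} {m : ℕ} (H : Herd N m)

lemma run_a2 (l : Fin m) : N.JointRun (H.path l .a2) (H.joint l 0) (H.joint l 1) 0 1 :=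
  SolitonNetwork.jointRun (by decide) ((H.isHorse l).chain _) (H.isHorse l).a2_start
    (H.isHorse l).a2_end

lemma run_b2 (l : Fin m) : N.JointRun (H.path l .b2) (H.joint l 0) (H.joint l 2) 1 2 :=
  SolitonNetwork.jointRun (by decide) ((H.isHorse l).chain _) (H.isHorse l).b2_start
    (H.isHorse l).b2_end

lemma run_c (l : Fin m) : N.JointRun (H.path l .c) (H.joint l 0) (H.joint l 3) 0 2 :=
  SolitonNetwork.jointRun (by decide) ((H.isHorse l).chain _) (H.isHorse l).c_start
    (H.isHorse l).c_end

lemma run_abar2 (l : Fin m) : N.JointRun (H.path l .abar2) (H.joint l 2) (H.joint l 3) 0 1 :=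
  SolitonNetwork.jointRun (by decide) ((H.isHorse l).chain _) (H.isHorse l).abar2_start
    (H.isHorse l).abar2_end

lemma run_bbar2 (l : Fin m) : N.JointRun (H.path l .bbar2) (H.joint l 1) (H.joint l 3) 1 2 :=
  SolitonNetwork.jointRun (by decide) ((H.isHorse l).chain _) (H.isHorse l).bbar2_start
    (H.isHorse l).bbar2_end

section Succ

variable {l l' : Fin m} (hl : l.val + 1 = l'.val)
include hl

lemma a1_eq : H.path l' .a1 = H.path l .a3 :=
  (H.glue (l, .a3) (l', .a1) ⟨hl, .inl ⟨rfl, rfl⟩⟩).symm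

lemma b1_eq : H.path l' .b1 = H.path l .b3 :=
  (H.glue (l, .b3) (l', .b1) ⟨hl, .inr (.inl ⟨rfl, rfl⟩)⟩).symm

lemma abar1_eq : H.path l .abar1 = H.path l' .abar3 :=
  H.glue (l, .abar1) (l', .abar3) ⟨hl, .inr (.inr (.inl ⟨rfl, rfl⟩))⟩

lemma bbar1_eq : H.path l .bbar1 = H.path l' .bbar3 :=
  H.glue (l, .bbar1) (l', .bbar3) ⟨hl, .inr (.inr (.inr ⟨rfl, rfl⟩))⟩

lemma run_a3 : N.JointRun (H.path l .a3) (H.joint l 1) (H.joint l' 0) 0 1 :=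
  SolitonNetwork.jointRun (by decide) ((H.isHorse l).chain _) (H.isHorse l).a3_start
    (H.a1_eq hl ▸ (H.isHorse l').a1_end)

lemma run_b3 : N.JointRun (H.path l .b3) (H.joint l 2) (H.joint l' 0) 1 2 :=
  SolitonNetwork.jointRun (by decide) ((H.isHorse l).chain _) (H.isHorse l).b3_start
    (H.b1_eq hl ▸ (H.isHorse l').b1_end)

lemma run_abar1 : N.JointRun (H.path l .abar1) (H.joint l 3) (H.joint l' 2) 0 1 :=
  SolitonNetwork.jointRun (by decide) ((H.isHorse l).chain _) (H.isHorse l).abar1_start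
    (H.abar1_eq hl ▸ (H.isHorse l').abar3_end)

lemma run_bbar1 : N.JointRun (H.path l .bbar1) (H.joint l 3) (H.joint l' 1) 1 2 :=
  SolitonNetwork.jointRun (by decide) ((H.isHorse l).chain _) (H.isHorse l).bbar1_start
    (H.bbar1_eq hl ▸ (H.isHorse l').bbar3_end)

end Succ

lemma inner_subset (l : Fin m) {e : HorseStreet}
    (he : e = .a2 ∨ e = .b2 ∨ e = .c ∨ e = .abar2 ∨ e = .bbar2) :
    N.trace (H.path l e) ⊆ H.U l := by
  refine (SolitonNetwork.trace_mono fun s hs => ?_).trans (H.inner_mem l)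
  rcases he with rfl | rfl | rfl | rfl | rfl <;> simp [hs]

/-- The image of the cycle of a herd under a homomorphism, term by term. -/
lemma chargeChain_eq_add {A : Type*} [AddCommGroup A] (Ψ : Chain1 (Dir S) →+ A) (l : Fin m) :
    Ψ (H.chargeChain l) =
      (∑ r with r < l, (Ψ (N.trans (H.path r .a1)) + Ψ (N.trans (H.path r .a2))
        + Ψ (N.trans (H.path r .b1)) + Ψ (N.trans (H.path r .b2))))
      + Ψ (N.trans (H.path l .a1)) + Ψ (N.trans (H.path l .b1)) - Ψ (N.half (H.joint l 0))
      + Ψ (N.trans (H.path l .c))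
      + Ψ (N.half (H.joint l 3)) + Ψ (N.trans (H.path l .abar1)) + Ψ (N.trans (H.path l .bbar1))
      + ∑ r with l < r, (Ψ (N.trans (H.path r .abar1)) + Ψ (N.trans (H.path r .abar2))
        + Ψ (N.trans (H.path r .bbar1)) + Ψ (N.trans (H.path r .bbar2))) := by
  simp only [chargeChain, map_add, map_sub, map_sum]

variable [IsManifold 𝓘(ℂ, ℂ) ω C] {K : ℕ} {A : Type*} [AddCommGroup A]

include H in
/-- Adjacent horses have the same charge. -/
lemma map_chargeChain_succ (hπ : IsSimpleBranchedCover π B K) (Φ : Rel (Dir S) →+ A) {h : A}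
    (hΦ : ∀ v, Φ (fibreClass v) = h) {l l' : Fin m} (hl : l.val + 1 = l'.val) :
    Φ (cls (H.chargeChain l)) = Φ (cls (H.chargeChain l')) := by
  have pf : ∀ v r, π (N.frame v r).base = (N.jointVec v).1 := fun v r => Network.proj_frame v r
  have tf : ∀ v r, tangentMap 𝓘(ℂ, ℂ) 𝓘(ℂ, ℂ) π (N.frame v r).1 = N.jointVec v := fun v r =>
    Network.tangentMap_frame v r
  have hsec : ∀ l i, IsEtaleSection π (H.U l) (H.sheet l i) := fun l i =>
    hπ.isEtaleSection (H.isDisc l).isOpen (H.off_branch l) (H.sheet_cont l i)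
      (H.sheet_section l i)
  choose a a' pot using fun l => exists_isFramedPotential (H.isDisc l) (hsec l) Φ hΦ
  have hf : ∀ l q r, H.sheet l r (N.jointVec (H.joint l q)).1 = (N.frame (H.joint l q) r).base :=
    fun l q r => by rw [← pf _ r]; exact H.joint_sheet l q r
  have hrun : ∀ l {e : HorseStreet} {q q' : Fin 4} {i j : Fin 3},
      (e = .a2 ∨ e = .b2 ∨ e = .c ∨ e = .abar2 ∨ e = .bbar2) →
      N.JointRun (H.path l e) (H.joint l q) (H.joint l q') i j →
      Φ (cls (N.trans (H.path l e))) =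
        (a' l j (N.jointVec (H.joint l q')) - a l i (N.jointVec (H.joint l q'))) -
        (a' l j (N.jointVec (H.joint l q)) - a l i (N.jointVec (H.joint l q))) := by
    intro l e q q' i j he hr
    have := (hr.transport hπ (H.off_branch l) (hsec l) (pot l) (H.inner_subset l he)
      (i := i) (j := j) (by rw [pf, hf])
      (by
        change (N.frame (H.joint l q) j).base = H.sheet l j (π (N.frame (H.joint l q) j).base)
        rw [pf, hf])).2.2
    rw [tf, tf] at this
    exact this
  have hhalf : ∀ l q, Φ (cls (N.half (H.joint l q))) =
      a' l 1 (N.jointVec (H.joint l q)) - a l 1 (N.jointVec (H.joint l q))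
        - (if N.sense = 1 then 0 else h) := by
    intro l q
    have := (pot l).half 1 (N.frame (H.joint l q) 1) N.sense (H.joint_mem l q 1)
      (H.joint_sheet l q 1).symm
    rw [tf] at this
    exact this
  obtain ⟨⟨V, hV, hVB, hVt⟩, ⟨V', hV', hVB', hVt'⟩⟩ := H.no_holes l l' hl
  have sub1 : ∀ L, (∀ s ∈ L, s ∈ H.path l .abar2 ++ H.path l .bbar1 ++ H.path l' .a2 ++
      H.path l .b3) → N.trace L ⊆ V := fun L hL => (SolitonNetwork.trace_mono hL).trans hVt
  have sub2 : ∀ L, (∀ s ∈ L, s ∈ H.path l .bbar2 ++ H.path l .abar1 ++ H.path l' .b2 ++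
      H.path l .a3) → N.trace L ⊆ V' := fun L hL => (SolitonNetwork.trace_mono hL).trans hVt'
  have qa := SolitonNetwork.transport_sub_of_quadrangle hπ N.N Φ hΦ hV' hVB' (hsec l) (hsec l')
    (pot l) (pot l') (hf l 1) (hf l 3) (hf l' 0)
    (H.run_bbar2 l) (H.inner_subset l (by simp)) (sub2 _ (by simp +contextual))
    (H.run_b2 l') (H.inner_subset l' (by simp)) (sub2 _ (by simp +contextual))
    (H.run_a3 hl) (sub2 _ (by simp +contextual)) (H.run_abar1 hl) (sub2 _ (by simp +contextual))
  have qb := SolitonNetwork.transport_sub_of_quadrangle hπ N.N Φ hΦ hV hVB (hsec l) (hsec l')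
    (pot l) (pot l') (hf l 2) (hf l 3) (hf l' 0)
    (H.run_abar2 l) (H.inner_subset l (by simp)) (sub1 _ (by simp +contextual))
    (H.run_a2 l') (H.inner_subset l' (by simp)) (sub1 _ (by simp +contextual))
    (H.run_b3 hl) (sub1 _ (by simp +contextual)) (H.run_bbar1 hl) (sub1 _ (by simp +contextual))
  have E := H.chargeChain_eq_add (Φ.comp (clsHom _))
  simp only [AddMonoidHom.coe_comp, Function.comp_apply, clsHom_apply] at E
  rw [E, E, sum_filter_lt_succ _ hl, sum_filter_gt_succ _ hl, H.a1_eq hl, H.b1_eq hl]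
  rw [hhalf, hhalf, hhalf, hhalf, hrun l (by simp) (H.run_c l), hrun l' (by simp) (H.run_c l'),
    hrun l (by simp) (H.run_a2 l), hrun l (by simp) (H.run_b2 l),
    hrun l' (by simp) (H.run_abar2 l'), hrun l' (by simp) (H.run_bbar2 l'),
    eq_add_of_sub_eq qa, eq_add_of_sub_eq qb]
  abel

/-- All horses have the same charge. -/
lemma map_chargeChain_eq (hπ : IsSimpleBranchedCover π B K) (Φ : Rel (Dir S) →+ A) {h : A}
    (hΦ : ∀ v, Φ (fibreClass v) = h) (l l' : Fin m) :
    Φ (cls (H.chargeChain l)) = Φ (cls (H.chargeChain l')) := by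
  have key : ∀ l l₀ : Fin m, l₀.val = 0 → Φ (cls (H.chargeChain l)) = Φ (cls (H.chargeChain l₀)) := by
    intro l
    induction l using Fin.induction_up with
    | h0 l hl =>
      intro l₀ h₀
      rw [Fin.ext (hl.trans h₀.symm)]
    | hs l l' hl ih =>
      intro l₀ h₀
      rw [← H.map_chargeChain_succ hπ Φ hΦ hl, ih l₀ h₀]
  have hm : 0 < m := l.pos
  rw [key l ⟨0, hm⟩ rfl, key l' ⟨0, hm⟩ rfl]

end Herd

end HerdCharges

section JunctionRing

lemma eq_of_eq_add_mul_left_zero {R : Type*} [CommRing R] {x y η z w : R}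
    (h : x = y + η * (z * w)) (hz : z = 0) : x = y := by
  rw [h, hz]; ring

lemma eq_of_eq_add_mul_right_zero {R : Type*} [CommRing R] {x y η z w : R}
    (h : x = y + η * (z * w)) (hw : w = 0) : x = y := by
  rw [h, hw]; ring

variable {R : Type*} [CommRing R] {η η' A A' B B' a b c d f g t u : R}

lemma junction_lower (hη : η * η' = 1) (h1 : a = A + η * (c * f)) (h2 : b = B)
    (h3 : t = g + η * (B' * d)) (h4 : A' = d + η' * (B * t)) (h5 : B' = f + η' * (g * a))
    (h6 : c = η' * (A * b)) :
    a = A * (1 + b * f) ∧ 1 + A * A' = (1 + c * g) * (1 + a * d) ∧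
      1 + B * B' = (1 + c * g) * (1 + b * f) := by
  have e1 : a = A * (1 + b * f) := by
    rw [h1, h6]; linear_combination (A * b * f) * hη
  have e3 : 1 + B * B' = (1 + c * g) * (1 + b * f) := by
    rw [h5, h6, e1, h2]; ring
  refine ⟨e1, ?_, e3⟩
  have e4 : A' = d * (1 + B * B') + η' * B * g := by
    rw [h4, h3]; linear_combination (B * B' * d) * hη
  rw [e4, e3, e1, h6, h2]
  ring

lemma junction_upper (hη : η * η' = 1) (h1 : a = A + η * (t * f)) (h2 : b = B + η * (A' * c))
    (h3 : g = η * (B' * d)) (h4 : A' = d + η' * (B * g)) (h5 : B' = f)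
    (h6 : t = c + η' * (A * b)) :
    A' = d * (1 + B * B') ∧ 1 + a * d = (1 + c * g) * (1 + A * A') ∧
      1 + b * f = (1 + c * g) * (1 + B * B') := by
  have e1 : A' = d * (1 + B * B') := by
    rw [h4, h3]; linear_combination (B * B' * d) * hη
  refine ⟨e1, ?_, ?_⟩
  · rw [h1, h6, h2, h3, e1, h5]
    linear_combination (A * B * f * d + A * d ^ 2 * c * f * η * (1 + B * f)) * hη
  · rw [h2, e1, h3, h5]; ring

lemma junction_middle (hη : η * η' = 1) (h1 : a = A + η * (t * f)) (h2 : b = B)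
    (h3 : u = η * (B' * d)) (h4 : A' = d + η' * (B * u)) (h5 : B' = f) (h6 : t = η' * (A * b)) :
    a = A * (1 + b * f) ∧ A' = d * (1 + b * f) := by
  constructor
  · rw [h1, h6]; linear_combination (A * b * f) * hη
  · rw [h4, h3, h5, h2]; linear_combination (B * f * d) * hη

end JunctionRing

section Characters

open Sing

variable {S : Type*} [TopologicalSpace S] [ChartedSpace ℂ S] [IsManifold 𝓘(ℂ, ℂ) ω S]

lemma chargeVar_zero : chargeVar (0 : Rel (Dir S)) = 1 := rfl

lemma chargeVar_add (g h : Rel (Dir S)) : chargeVar (g + h) = chargeVar g * chargeVar h := by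
  rw [chargeVar, chargeVar, chargeVar, ← map_mul, AddMonoidAlgebra.single_mul_single, one_mul]

lemma chargeVar_fibreClass (v : Dir S) : chargeVar (fibreClass v) = -1 := by
  rw [eq_neg_iff_add_eq_zero]
  have h : (AddMonoidAlgebra.single (fibreClass v) 1 + 1 : AddMonoidAlgebra ℤ (Rel (Dir S))) ∈
      Ideal.span (Set.range fun v : Dir S =>
      (AddMonoidAlgebra.single (fibreClass v) 1 + 1 : AddMonoidAlgebra ℤ (Sing.Rel (Dir S)))) :=
    Ideal.subset_span ⟨v, rfl⟩
  have := Ideal.Quotient.eq_zero_iff_mem.2 h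
  rw [map_add, map_one] at this
  exact this

lemma isUnit_chargeVar (g : Rel (Dir S)) : IsUnit (chargeVar g) :=
  ⟨⟨chargeVar g, chargeVar (-g), by rw [← chargeVar_add, add_neg_cancel, chargeVar_zero],
    by rw [← chargeVar_add, neg_add_cancel, chargeVar_zero]⟩, rfl⟩

/-- An exponential map, as a homomorphism to the group of units. -/
def unitsHom {R G : Type*} [CommRing R] [AddCommGroup G] (f : G → R) (h0 : f 0 = 1)
    (hf : ∀ a b, f (a + b) = f a * f b) : G →+ Additive Rˣ where
  toFun g := Additive.ofMul ⟨f g, f (-g), by rw [← hf, add_neg_cancel, h0],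
    by rw [← hf, neg_add_cancel, h0]⟩
  map_zero' := congrArg Additive.ofMul (Units.ext h0)
  map_add' g h := congrArg Additive.ofMul (Units.ext (hf g h))

lemma expChain_zero : expChain (0 : Chain1 (Dir S)) = 1 := by
  rw [expChain, cls_zero, chargeVar_zero, map_one]

lemma expChain_add (a b : Chain1 (Dir S)) : expChain (a + b) = expChain a * expChain b := by
  rw [expChain, cls_add, chargeVar_add, map_mul]; rfl

lemma expChain_sub (a b : Chain1 (Dir S)) : expChain (a - b) = expChain a * expChain (-b) := by
  rw [sub_eq_add_neg, expChain_add]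

lemma expChain_mul_neg (a : Chain1 (Dir S)) : expChain a * expChain (-a) = 1 := by
  rw [← expChain_add, add_neg_cancel, expChain_zero]

lemma expChain_sum {ι : Type*} (s : Finset ι) (f : ι → Chain1 (Dir S)) :
    expChain (∑ i ∈ s, f i) = ∏ i ∈ s, expChain (f i) := by
  classical
  induction s using Finset.induction_on with
  | empty => rw [Finset.sum_empty, Finset.prod_empty, expChain_zero]
  | insert i s hi ih => rw [Finset.sum_insert hi, Finset.prod_insert hi, expChain_add, ih]

end Characters

section StreetChains

open Sing

variable {S C : Type*}
  [TopologicalSpace S] [ChartedSpace ℂ S] [IsManifold 𝓘(ℂ, ℂ) ω S]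
  [TopologicalSpace C] [ChartedSpace ℂ C]
  {π : S → C} {B : Set C} {St Jt : Type*}

namespace SolitonNetwork

variable (N : SolitonNetwork π B St Jt)

/-- The series of solitons of the type of a chain of streets, at its start. -/
noncomputable def upsL : List St → Ser S
  | [] => 0
  | s :: _ => N.ups s

/-- The series of solitons of the opposite type, at the start of a chain of streets. -/
noncomputable def delL : List St → Ser S
  | [] => 0
  | s :: _ => N.del s

/-- The street factor of a chain of streets. -/
noncomputable def qL (L : List St) : Ser S := 1 + N.upsL L * N.delL L

variable {N}

lemma ends_of_isChain {L : List St}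
    (hR : ∀ s s', N.Passes s s' → N.ups s' = N.upsEnd s ∧ N.delEnd s = N.del s') (hne : L ≠ []) (hch : L.IsChain N.Passes) {s' : St} (hs' : L.getLast? = some s') :
    N.upsEnd s' = expChain (N.trans L) * N.upsL L ∧
      N.delEnd s' = expChain (-N.trans L) * N.delL L ∧ ∀ s ∈ L, N.Q s = N.qL L := by
  induction L with
  | nil => exact absurd rfl hne
  | cons a L ih =>
    cases L with
    | nil =>
      obtain rfl : a = s' := by simpa using hs'
      rw [N.trans_singleton]
      refine ⟨rfl, rfl, fun s hs => ?_⟩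
      obtain rfl : s = a := by simpa using hs
      rfl
    | cons b L =>
      rw [List.isChain_cons_cons] at hch
      obtain ⟨h1, h2, h3⟩ := ih (by simp) hch.2 (by simpa [List.getLast?_cons_cons] using hs')
      obtain ⟨r1, r2⟩ := hR a b hch.1
      have hb : N.upsL (b :: L) = expChain (N.street a).trans * N.ups a := r1
      have hd : N.delL (b :: L) = expChain (-(N.street a).trans) * N.del a := r2.symm
      have hq : N.qL (b :: L) = N.qL (a :: b :: L) := by
        rw [qL, hb, hd, qL]
        change _ = 1 + N.ups a * N.del a
        linear_combination (N.ups a * N.del a) * expChain_mul_neg (N.street a).trans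
      refine ⟨?_, ?_, fun s hs => ?_⟩
      · rw [h1, hb, N.trans_cons a, expChain_add]
        change _ = _ * N.ups a
        ring
      · rw [h2, hd, N.trans_cons a, neg_add, expChain_add]
        change _ = _ * N.del a
        ring
      · rcases List.mem_cons.1 hs with rfl | hs
        · rfl
        · rw [h3 s hs, hq]

lemma tau_of_startsAt {L : List St} {v : Jt} {i j : Fin 3} (h : N.StartsAt L v i j) :
    N.tau v i j = N.upsL L ∧ N.nu v j i = N.delL L := by
  obtain ⟨s, hs, hv⟩ := h
  obtain ⟨L', rfl⟩ := List.head?_eq_some_iff.1 hs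
  simp [tau, nu, hv, upsL, delL]

end SolitonNetwork

namespace SpectralNetwork

variable {N : SpectralNetwork π B St Jt}

lemma exists_junction (v : Jt) {i j k : Fin 3} (hij : i ≠ j) (hjk : j ≠ k) (hki : k ≠ i) :
    ∃ c, N.tau v i j = N.nu v i j + c * (N.tau v i k * N.nu v k j) ∨
      N.tau v i j = N.nu v i j + c * (N.nu v i k * N.tau v k j) := by
  have h : ∀ i j k : Fin 3, i ≠ j → j ≠ k → k ≠ i →
      (i = 0 ∧ j = 1 ∧ k = 2) ∨ (i = 1 ∧ j = 2 ∧ k = 0) ∨ (i = 2 ∧ j = 0 ∧ k = 1) ∨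
      (i = 1 ∧ j = 0 ∧ k = 2) ∨ (i = 2 ∧ j = 1 ∧ k = 0) ∨ (i = 0 ∧ j = 2 ∧ k = 1) := by
    intro i j k
    simp only [Fin.ext_iff, ne_eq]
    have := i.2
    have := j.2
    have := k.2
    simp
    omega
  rcases h i j k hij hjk hki with ⟨rfl, rfl, rfl⟩ | ⟨rfl, rfl, rfl⟩ | ⟨rfl, rfl, rfl⟩ |
    ⟨rfl, rfl, rfl⟩ | ⟨rfl, rfl, rfl⟩ | ⟨rfl, rfl, rfl⟩
  · exact ⟨_, .inl (N.junction₁₂ v)⟩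
  · exact ⟨_, .inl (N.junction₂₃ v)⟩
  · exact ⟨_, .inl (N.junction₃₁ v)⟩
  · exact ⟨_, .inr (N.junction₂₁ v)⟩
  · exact ⟨_, .inr (N.junction₃₂ v)⟩
  · exact ⟨_, .inr (N.junction₁₃ v)⟩

lemma tau_eq_nu {v : Jt} {i j k : Fin 3} (hij : i ≠ j) (hjk : j ≠ k) (hki : k ≠ i)
    (h : (N.tau v k i = 0 ∧ N.nu v k i = 0 ∧ N.tau v k j = 0 ∧ N.nu v k j = 0) ∨
      (N.tau v i k = 0 ∧ N.nu v i k = 0 ∧ N.tau v j k = 0 ∧ N.nu v j k = 0)) :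
    N.tau v i j = N.nu v i j := by
  obtain ⟨c, hc | hc⟩ := exists_junction (N := N) v hij hjk hki <;>
    rcases h with ⟨h1, h2, h3, h4⟩ | ⟨h1, h2, h3, h4⟩
  · exact eq_of_eq_add_mul_right_zero (R := Ser S) hc h4
  · exact eq_of_eq_add_mul_left_zero (R := Ser S) hc h1
  · exact eq_of_eq_add_mul_right_zero (R := Ser S) hc h3
  · exact eq_of_eq_add_mul_left_zero (R := Ser S) hc h2

lemma passes_series {s s' : St} (h : N.Passes s s') :
    N.ups s' = N.upsEnd s ∧ N.delEnd s = N.del s' := by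
  obtain ⟨v, i, j, k, hij, hjk, hki, h1, h2, h3⟩ := h
  have e1 := tau_eq_nu hij hjk hki h3
  have e2 := tau_eq_nu hij.symm hki.symm hjk.symm (v := v) (N := N) (by tauto)
  simp only [SolitonNetwork.tau, SolitonNetwork.nu, h1, h2] at e1 e2
  exact ⟨e1, e2⟩

lemma tau_of_endsAt {L : List St} (hL : L ≠ [] ∧ L.IsChain N.Passes) {v : Jt} {i j : Fin 3}
    (h : N.EndsAt L v i j) :
    N.nu v j i = expChain (N.trans L) * N.upsL L ∧
      N.tau v i j = expChain (-N.trans L) * N.delL L := by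
  obtain ⟨s, hs, hv⟩ := h
  obtain ⟨h1, h2, -⟩ := SolitonNetwork.ends_of_isChain (N := N.N) (fun s s' h => passes_series h)
    hL.1 hL.2 hs
  rw [← h1, ← h2]
  simp [SolitonNetwork.tau, SolitonNetwork.nu, hv]

lemma Q_eq_qL {L : List St} (hch : L.IsChain N.Passes) {s : St} (hs : s ∈ L) : N.Q s = N.qL L := by
  have hne : L ≠ [] := List.ne_nil_of_mem hs
  exact (SolitonNetwork.ends_of_isChain (N := N.N) (fun s s' h => passes_series h) hne hch
    (List.getLast?_eq_some_getLast hne)).2.2 s hs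

end SpectralNetwork

end StreetChains

section HorseAlgebra

variable {R : Type*} [CommRing R]

/-- The six-way junction equations for outgoing series `t` and incoming series `n`. -/
structure JunctionEquations (η η' : R) (t n : Fin 3 → Fin 3 → R) : Prop where
  inv : η * η' = 1
  e01 : t 0 1 = n 0 1 + η * (t 0 2 * n 2 1)
  e12 : t 1 2 = n 1 2 + η * (t 1 0 * n 0 2)
  e20 : t 2 0 = n 2 0 + η * (t 2 1 * n 1 0)
  e10 : t 1 0 = n 1 0 + η' * (n 1 2 * t 2 0)
  e21 : t 2 1 = n 2 1 + η' * (n 2 0 * t 0 1)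
  e02 : t 0 2 = n 0 2 + η' * (n 0 1 * t 1 2)

/-- The relations between the soliton series `U`, `D` of the streets of a horse; `x`, `y` are the
parallel transports along the streets and their inverses, `ε` and `κ` the half rotations at the
lowest and at the highest joint. -/
structure HorseEquations (U D x y : HorseStreet → R) (ε κ : R) : Prop where
  inv : ∀ e, x e * y e = 1
  ups_a2 : U .a2 = x .a1 * U .a1 * (1 + U .b2 * D .b2)
  ups_b2 : U .b2 = x .b1 * U .b1
  ups_c : U .c = ε * (x .a1 * U .a1 * (x .b1 * U .b1))
  q_a1 : 1 + U .a1 * D .a1 = (1 + U .c * D .c) * (1 + U .a2 * D .a2)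
  q_b1 : 1 + U .b1 * D .b1 = (1 + U .c * D .c) * (1 + U .b2 * D .b2)
  ups_a3 : U .a3 = x .a2 * U .a2 * (1 + U .bbar2 * D .bbar2)
  del_a2 : y .a2 * D .a2 = D .a3 * (1 + U .bbar2 * D .bbar2)
  ups_bbar2 : U .bbar2 = x .bbar3 * U .bbar3
  del_bbar3 : y .bbar3 * D .bbar3 = D .bbar2
  ups_abar2 : U .abar2 = x .abar3 * U .abar3 * (1 + U .b3 * D .b3)
  del_abar3 : y .abar3 * D .abar3 = D .abar2 * (1 + U .b3 * D .b3)
  ups_b3 : U .b3 = x .b2 * U .b2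
  del_b2 : y .b2 * D .b2 = D .b3
  del_c : y .c * D .c = κ * (D .bbar1 * D .abar1)
  del_abar2 : y .abar2 * D .abar2 = D .abar1 * (1 + U .bbar2 * D .bbar2)
  del_bbar2 : y .bbar2 * D .bbar2 = D .bbar1
  q_abar1 : 1 + U .abar1 * D .abar1 = (1 + U .c * D .c) * (1 + U .abar2 * D .abar2)
  q_bbar1 : 1 + U .bbar1 * D .bbar1 = (1 + U .c * D .c) * (1 + U .bbar2 * D .bbar2)

lemma transport_mul {x y u d : R} (h : x * y = 1) : (x * u) * (y * d) = u * d := by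
  linear_combination (u * d) * h

lemma HorseEquations.of_junctions {U D x y : HorseStreet → R} {η η' : Fin 4 → R}
    {t n : Fin 4 → Fin 3 → Fin 3 → R} (hinv : ∀ e, x e * y e = 1)
    (hJ : ∀ q, JunctionEquations (η q) (η' q) (t q) (n q))
    (a1_end : n 0 0 1 = x .a1 * U .a1 ∧ t 0 1 0 = y .a1 * D .a1)
    (b1_end : n 0 1 2 = x .b1 * U .b1 ∧ t 0 2 1 = y .b1 * D .b1)
    (a2_start : t 0 0 1 = U .a2 ∧ n 0 1 0 = D .a2)
    (b2_start : t 0 1 2 = U .b2 ∧ n 0 2 1 = D .b2)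
    (c_start : t 0 0 2 = U .c ∧ n 0 2 0 = D .c)
    (background₀ : n 0 0 2 = 0)
    (a2_end : n 1 0 1 = x .a2 * U .a2 ∧ t 1 1 0 = y .a2 * D .a2)
    (bbar3_end : n 1 1 2 = x .bbar3 * U .bbar3 ∧ t 1 2 1 = y .bbar3 * D .bbar3)
    (a3_start : t 1 0 1 = U .a3 ∧ n 1 1 0 = D .a3)
    (bbar2_start : t 1 1 2 = U .bbar2 ∧ n 1 2 1 = D .bbar2)
    (background₁ : n 1 0 2 = 0 ∧ n 1 2 0 = 0)
    (abar3_end : n 2 0 1 = x .abar3 * U .abar3 ∧ t 2 1 0 = y .abar3 * D .abar3)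
    (b2_end : n 2 1 2 = x .b2 * U .b2 ∧ t 2 2 1 = y .b2 * D .b2)
    (abar2_start : t 2 0 1 = U .abar2 ∧ n 2 1 0 = D .abar2)
    (b3_start : t 2 1 2 = U .b3 ∧ n 2 2 1 = D .b3)
    (background₂ : n 2 0 2 = 0 ∧ n 2 2 0 = 0)
    (abar2_end : n 3 0 1 = x .abar2 * U .abar2 ∧ t 3 1 0 = y .abar2 * D .abar2)
    (bbar2_end : n 3 1 2 = x .bbar2 * U .bbar2 ∧ t 3 2 1 = y .bbar2 * D .bbar2)
    (c_end : n 3 0 2 = x .c * U .c ∧ t 3 2 0 = y .c * D .c)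
    (abar1_start : t 3 0 1 = U .abar1 ∧ n 3 1 0 = D .abar1)
    (bbar1_start : t 3 1 2 = U .bbar1 ∧ n 3 2 1 = D .bbar1)
    (background₃ : n 3 2 0 = 0) :
    HorseEquations U D x y (η' 0) (η 3) := by
  have E0 := hJ 0
  have E3 := hJ 3
  have M : ∀ q, n q 0 2 = 0 → n q 2 0 = 0 → t q 1 2 = n q 1 2 ∧ t q 2 1 = n q 2 1 ∧
      t q 0 1 = n q 0 1 * (1 + t q 1 2 * n q 2 1) ∧
      t q 1 0 = n q 1 0 * (1 + t q 1 2 * n q 2 1) := by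
    intro q h1 h2
    have h12 := (hJ q).e12
    have h20 := (hJ q).e20
    have h21 := (hJ q).e21
    have h02 := (hJ q).e02
    rw [h1, mul_zero, mul_zero, add_zero] at h12
    rw [h1, zero_add] at h02
    rw [h2, zero_mul, mul_zero, add_zero] at h21
    rw [h2, zero_add] at h20
    exact ⟨h12, h21, junction_middle (hJ q).inv (hJ q).e01 h12 h20 (hJ q).e10 h21 h02⟩
  obtain ⟨M1, M1', M1'', M1'''⟩ := M 1 background₁.1 background₁.2
  obtain ⟨M2, M2', M2'', M2'''⟩ := M 2 background₂.1 background₂.2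
  have h20 := E3.e20
  have h21 := E3.e21
  rw [background₃, zero_add] at h20
  rw [background₃, zero_mul, mul_zero, add_zero] at h21
  have L3 := junction_upper E3.inv E3.e01 E3.e12 h20 E3.e10 h21 E3.e02
  have h12 := E0.e12
  have h02 := E0.e02
  rw [background₀, mul_zero, mul_zero, add_zero] at h12
  rw [background₀, zero_add] at h02
  have L0 := junction_lower E0.inv E0.e01 h12 E0.e20 E0.e10 E0.e21 h02
  rw [a1_end.1, a1_end.2, b1_end.1, b1_end.2, a2_start.1, a2_start.2, b2_start.1, b2_start.2,
    c_start.1, c_start.2, transport_mul (hinv _), transport_mul (hinv _)] at L0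
  rw [b2_start.1, b1_end.1] at h12
  rw [c_start.1, a1_end.1, b2_start.1, h12] at h02
  rw [a2_end.1, a3_start.1, bbar2_start.1, bbar2_start.2] at M1''
  rw [a2_end.2, a3_start.2, bbar2_start.1, bbar2_start.2] at M1'''
  rw [bbar2_start.1, bbar3_end.1] at M1
  rw [bbar2_start.2, bbar3_end.2] at M1'
  rw [abar3_end.1, abar2_start.1, b3_start.1, b3_start.2] at M2''
  rw [abar3_end.2, abar2_start.2, b3_start.1, b3_start.2] at M2'''
  rw [b3_start.1, b2_end.1] at M2
  rw [b3_start.2, b2_end.2] at M2'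
  rw [bbar2_end.2, bbar1_start.2] at h21
  rw [c_end.2, bbar2_end.2, abar1_start.2, h21] at h20
  rw [abar2_end.1, abar2_end.2, bbar2_end.1, bbar2_end.2, abar1_start.1, abar1_start.2,
    bbar1_start.1, bbar1_start.2, c_end.1, c_end.2, transport_mul (hinv _),
    transport_mul (hinv _), transport_mul (hinv _)] at L3
  exact {
    inv := hinv
    ups_a2 := L0.1
    ups_b2 := h12
    ups_c := h02
    q_a1 := L0.2.1
    q_b1 := L0.2.2
    ups_a3 := M1''
    del_a2 := M1'''
    ups_bbar2 := M1
    del_bbar3 := M1'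
    ups_abar2 := M2''
    del_abar3 := M2'''
    ups_b3 := M2
    del_b2 := M2'
    del_c := h20
    del_abar2 := L3.1
    del_bbar2 := h21
    q_abar1 := L3.2.1
    q_bbar1 := L3.2.2 }

end HorseAlgebra

section HerdAlgebra

open Finset

variable {R : Type*} [CommRing R] {m : ℕ}

/-- The relations between the soliton series of the streets of a herd; the simpletons have the
series `T`. -/
structure HerdEquations (U D x y : Fin m → HorseStreet → R) (ε κ : Fin m → R) (T : R) :
    Prop where
  horse : ∀ l, HorseEquations (U l) (D l) (x l) (y l) (ε l) (κ l)
  glue : ∀ v w : Fin m × HorseStreet, Glued v w →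
    U v.1 v.2 = U w.1 w.2 ∧ D v.1 v.2 = D w.1 w.2 ∧ x v.1 v.2 = x w.1 w.2 ∧
      y v.1 v.2 = y w.1 w.2
  lower : ∀ l : Fin m, l.val = 0 →
    U l .a1 = T ∧ U l .b1 = T ∧ U l .abar3 = 0 ∧ U l .bbar3 = 0
  upper : ∀ l : Fin m, l.val + 1 = m →
    y l .abar1 * D l .abar1 = T ∧ y l .bbar1 * D l .bbar1 = T ∧ D l .a3 = 0 ∧ D l .b3 = 0

/-- The exponent of the street factor of `c` in the factor of a street of the `l`-th horse. -/
def herdMult {m : ℕ} (l : Fin m) : HorseStreet → ℕ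
  | .a1 | .b1 => m - l
  | .a2 | .a3 | .b2 | .b3 => m - (l + 1)
  | .abar1 | .bbar1 => l + 1
  | .abar2 | .abar3 | .bbar2 | .bbar3 => l
  | .c => 1

namespace HorseEquations

variable {U D x y : HorseStreet → R} {ε κ : R} (h : HorseEquations U D x y ε κ)
include h

lemma q_eq (e : HorseStreet) : (x e * U e) * (y e * D e) = U e * D e := transport_mul (h.inv e)

lemma del_eq (e : HorseStreet) : D e = x e * (y e * D e) := by
  linear_combination (-D e) * h.inv e

lemma q_a3 : 1 + U .a3 * D .a3 = 1 + U .a2 * D .a2 := by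
  rw [← h.q_eq .a2, h.ups_a3, h.del_a2]; ring

lemma q_b3 : 1 + U .b3 * D .b3 = 1 + U .b2 * D .b2 := by
  rw [← h.q_eq .b2, h.ups_b3, h.del_b2]

lemma q_abar3 : 1 + U .abar3 * D .abar3 = 1 + U .abar2 * D .abar2 := by
  rw [← h.q_eq .abar3, h.ups_abar2, h.del_abar3]; ring

lemma q_bbar3 : 1 + U .bbar3 * D .bbar3 = 1 + U .bbar2 * D .bbar2 := by
  rw [← h.q_eq .bbar3, h.ups_bbar2, h.del_bbar3]

end HorseEquations

lemma Fin.erase_eq_filter_union (l : Fin m) (f : Fin m → R) :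
    ∏ r ∈ univ.erase l, f r = (∏ r with r < l, f r) * ∏ r with l < r, f r := by
  rw [← prod_union]
  · congr 1
    ext r
    simp [lt_or_lt_iff_ne]
  · rw [disjoint_filter]
    intro r _ h
    exact h.le.not_gt

namespace HerdEquations

variable {U D x y : Fin m → HorseStreet → R} {ε κ : Fin m → R} {T : R}
  (h : HerdEquations U D x y ε κ T)
include h

lemma q_lower (l : Fin m) :
    1 + U l .a2 * D l .a2 = ∏ r with l < r, (1 + U r .c * D r .c) ∧
      1 + U l .b2 * D l .b2 = ∏ r with l < r, (1 + U r .c * D r .c) := by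
  induction l using Fin.induction_down with
  | h0 l hl =>
    obtain ⟨-, -, h1, h2⟩ := h.upper l hl
    rw [prod_filter_gt_last _ hl, ← (h.horse l).q_a3, ← (h.horse l).q_b3, h1, h2]
    simp
  | hs l l' hl ih =>
    obtain ⟨a1, a2, -, -⟩ := h.glue (l, .a3) (l', .a1) ⟨hl, by simp⟩
    obtain ⟨b1, b2, -, -⟩ := h.glue (l, .b3) (l', .b1) ⟨hl, by simp⟩
    dsimp only at a1 a2 b1 b2
    rw [prod_filter_gt_succ _ hl, ← (h.horse l).q_a3, ← (h.horse l).q_b3, a1, a2, b1, b2,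
      (h.horse l').q_a1, (h.horse l').q_b1, ih.1, ih.2]
    exact ⟨mul_comm _ _, mul_comm _ _⟩

lemma q_upper (l : Fin m) :
    1 + U l .abar2 * D l .abar2 = ∏ r with r < l, (1 + U r .c * D r .c) ∧
      1 + U l .bbar2 * D l .bbar2 = ∏ r with r < l, (1 + U r .c * D r .c) := by
  induction l using Fin.induction_up with
  | h0 l hl =>
    obtain ⟨-, -, h1, h2⟩ := h.lower l hl
    rw [prod_filter_lt_first _ hl, ← (h.horse l).q_abar3, ← (h.horse l).q_bbar3, h1, h2]
    simp
  | hs l l' hl ih =>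
    obtain ⟨a1, a2, -, -⟩ := h.glue (l, .abar1) (l', .abar3) ⟨hl, by simp⟩
    obtain ⟨b1, b2, -, -⟩ := h.glue (l, .bbar1) (l', .bbar3) ⟨hl, by simp⟩
    dsimp only at a1 a2 b1 b2
    rw [prod_filter_lt_succ _ hl, ← (h.horse l').q_abar3, ← (h.horse l').q_bbar3, ← a1, ← a2,
      ← b1, ← b2, (h.horse l).q_abar1, (h.horse l).q_bbar1, ih.1, ih.2]
    exact ⟨mul_comm _ _, mul_comm _ _⟩

lemma q_b2_mul_q_bbar2 (l : Fin m) :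
    (1 + U l .b2 * D l .b2) * (1 + U l .bbar2 * D l .bbar2) =
      ∏ r ∈ univ.erase l, (1 + U r .c * D r .c) := by
  rw [(h.q_lower l).2, (h.q_upper l).2, Fin.erase_eq_filter_union, mul_comm]

lemma ups_lower (l : Fin m) :
    U l .a1 = T * ∏ r with r < l, (x r .a1 * x r .a2 *
      ∏ s ∈ univ.erase r, (1 + U s .c * D s .c)) ∧
    U l .b1 = T * ∏ r with r < l, (x r .b1 * x r .b2) := by
  induction l using Fin.induction_up with
  | h0 l hl =>
    obtain ⟨h1, h2, -, -⟩ := h.lower l hl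
    rw [prod_filter_lt_first _ hl, prod_filter_lt_first _ hl, h1, h2]
    simp
  | hs l l' hl ih =>
    have a := (h.glue (l, .a3) (l', .a1) ⟨hl, by simp⟩).1
    have b := (h.glue (l, .b3) (l', .b1) ⟨hl, by simp⟩).1
    dsimp only at a b
    rw [prod_filter_lt_succ _ hl, prod_filter_lt_succ _ hl, ← a, ← b, (h.horse l).ups_a3,
      (h.horse l).ups_b3, (h.horse l).ups_a2, ← h.q_b2_mul_q_bbar2 l]
    constructor
    · rw [ih.1]; ring
    · rw [(h.horse l).ups_b2, ih.2]; ring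

lemma del_upper (l : Fin m) :
    y l .abar1 * D l .abar1 = T * ∏ r with l < r, (x r .abar1 * x r .abar2 *
      ∏ s ∈ univ.erase r, (1 + U s .c * D s .c)) ∧
    y l .bbar1 * D l .bbar1 = T * ∏ r with l < r, (x r .bbar1 * x r .bbar2) := by
  induction l using Fin.induction_down with
  | h0 l hl =>
    obtain ⟨h1, h2, -, -⟩ := h.upper l hl
    rw [prod_filter_gt_last _ hl, prod_filter_gt_last _ hl, h1, h2]
    simp
  | hs l l' hl ih =>
    obtain ⟨-, a1, -, a2⟩ := h.glue (l, .abar1) (l', .abar3) ⟨hl, by simp⟩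
    obtain ⟨-, b1, -, b2⟩ := h.glue (l, .bbar1) (l', .bbar3) ⟨hl, by simp⟩
    dsimp only at a1 a2 b1 b2
    have H := h.horse l'
    rw [prod_filter_gt_succ _ hl, prod_filter_gt_succ _ hl, a1, a2, b1, b2, H.del_abar3,
      H.del_bbar3, H.del_eq .abar2, H.del_eq .bbar2, H.del_abar2, H.del_bbar2, H.q_b3,
      H.del_eq .abar1, H.del_eq .bbar1, ← h.q_b2_mul_q_bbar2 l']
    constructor
    · rw [ih.1]; ring
    · rw [ih.2]; ring

lemma q_c (l : Fin m) :
    1 + U l .c * D l .c = 1 + (T ^ 4 * ((∏ r with r < l, (x r .a1 * x r .a2 * x r .b1 * x r .b2)) *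
      (x l .a1 * x l .b1 * ε l * x l .c * κ l * x l .abar1 * x l .bbar1) *
      ∏ r with l < r, (x r .abar1 * x r .abar2 * x r .bbar1 * x r .bbar2))) *
      ∏ r ∈ univ.erase l, ∏ s ∈ univ.erase r, (1 + U s .c * D s .c) := by
  have H := h.horse l
  have e1 : ∏ r with r < l, (x r .a1 * x r .a2 * x r .b1 * x r .b2) =
      (∏ r with r < l, (x r .a1 * x r .a2)) * ∏ r with r < l, (x r .b1 * x r .b2) := by
    rw [← prod_mul_distrib]
    exact prod_congr rfl fun r _ => by ring
  have e2 : ∏ r with l < r, (x r .abar1 * x r .abar2 * x r .bbar1 * x r .bbar2) =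
      (∏ r with l < r, (x r .abar1 * x r .abar2)) * ∏ r with l < r, (x r .bbar1 * x r .bbar2) := by
    rw [← prod_mul_distrib]
    exact prod_congr rfl fun r _ => by ring
  rw [Fin.erase_eq_filter_union, e1, e2, ← H.q_eq .c, H.ups_c, H.del_c, H.del_eq .abar1,
    H.del_eq .bbar1, (h.del_upper l).1, (h.del_upper l).2, (h.ups_lower l).1, (h.ups_lower l).2,
    prod_mul_distrib (f := fun r => x r .a1 * x r .a2),
    prod_mul_distrib (f := fun r => x r .abar1 * x r .abar2)]
  ring

lemma q_eq_pow {P : R} (hP : ∀ l, 1 + U l .c * D l .c = P) (l : Fin m) (e : HorseStreet) :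
    1 + U l e * D l e = P ^ herdMult l e := by
  have H := h.horse l
  have h1 := h.q_lower l
  have h2 := h.q_upper l
  simp only [hP, prod_const] at h1 h2
  have c1 : #{r : Fin m | l < r} = m - (l + 1) := by
    rw [filter_lt_eq_Ioi, Fin.card_Ioi]; omega
  have c2 : #{r : Fin m | r < l} = l := by
    rw [filter_gt_eq_Iio, Fin.card_Iio]
  have c3 : m - (l : ℕ) = m - (l + 1) + 1 := by have := l.2; omega
  rw [c1] at h1
  rw [c2] at h2
  cases e <;> simp only [herdMult]
  · rw [H.q_a1, hP, h1.1, c3, pow_succ']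
  · exact h1.1
  · rw [H.q_a3, h1.1]
  · rw [H.q_b1, hP, h1.2, c3, pow_succ']
  · exact h1.2
  · rw [H.q_b3, h1.2]
  · rw [H.q_abar1, hP, h2.1, pow_succ']
  · exact h2.1
  · rw [H.q_abar3, h2.1]
  · rw [H.q_bbar1, hP, h2.2, pow_succ']
  · exact h2.2
  · rw [H.q_bbar3, h2.2]
  · rw [hP, pow_one]

end HerdEquations

end HerdAlgebra

section HerdSeries

open Sing

variable {S C : Type*}
  [TopologicalSpace S] [ChartedSpace ℂ S] [IsManifold 𝓘(ℂ, ℂ) ω S]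
  [TopologicalSpace C] [ChartedSpace ℂ C]
  {π : S → C} {B : Set C} {St Jt : Type*}

namespace SolitonNetwork

variable {N : SolitonNetwork π B St Jt}

lemma base_orient (i j : Fin 3) (u : Dir S) : (orient i j u).base = u.base := by
  unfold orient
  split_ifs <;> rfl

lemma start_notMem {v : Jt} {i j : Fin 3} {s : St} (h : N.slot v i j = some (s, false)) :
    (N.street s).path 0 ∉ B := by
  rw [FramedStreet.path, (N.attach_start v i j s h).1, base_orient]
  exact N.frame_notMem v i

lemma end_notMem {v : Jt} {i j : Fin 3} {s : St} (h : N.slot v i j = some (s, true)) :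
    (N.street s).path 1 ∉ B := by
  rw [FramedStreet.path, (N.attach_end v i j s h).1, base_orient]
  exact N.frame_notMem v j

lemma head_or_start_notMem {L : List St} (hL : L.IsChain N.Passes) {s : St} (hs : s ∈ L) :
    L.head? = some s ∨ (N.street s).path 0 ∉ B := by
  induction L with
  | nil => simp at hs
  | cons a L ih =>
    rcases List.mem_cons.1 hs with rfl | hs
    · exact .inl rfl
    · right
      cases L with
      | nil => simp at hs
      | cons b L =>
        rw [List.isChain_cons_cons] at hL
        rcases ih hL.2 hs with h | h
        · obtain rfl : b = s := by simpa using h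
          obtain ⟨v, i, j, k, -, -, -, -, h2, -⟩ := hL.1
          exact start_notMem h2
        · exact h

lemma last_or_end_notMem {L : List St} (hL : L.IsChain N.Passes) {s : St} (hs : s ∈ L) :
    L.getLast? = some s ∨ (N.street s).path 1 ∉ B := by
  induction L with
  | nil => simp at hs
  | cons a L ih =>
    cases L with
    | nil =>
      obtain rfl : s = a := by simpa using hs
      exact .inl rfl
    | cons b L =>
      rw [List.isChain_cons_cons] at hL
      rcases List.mem_cons.1 hs with rfl | hs
      · obtain ⟨v, i, j, k, -, -, -, h1, -, -⟩ := hL.1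
        exact .inr (end_notMem h1)
      · rcases ih hL.2 hs with h | h
        · exact .inl (by simpa [List.getLast?_cons_cons] using h)
        · exact .inr h

lemma StartsAt.start_notMem {L : List St} {v : Jt} {i j : Fin 3} (h : N.StartsAt L v i j)
    (hL : L.IsChain N.Passes) {s : St} (hs : s ∈ L) : (N.street s).path 0 ∉ B := by
  obtain ⟨s', hs', hv⟩ := h
  rcases head_or_start_notMem hL hs with h | h
  · obtain rfl : s' = s := Option.some.inj (hs'.symm.trans h)
    exact SolitonNetwork.start_notMem hv
  · exact h

lemma EndsAt.end_notMem {L : List St} {v : Jt} {i j : Fin 3} (h : N.EndsAt L v i j)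
    (hL : L.IsChain N.Passes) {s : St} (hs : s ∈ L) : (N.street s).path 1 ∉ B := by
  obtain ⟨s', hs', hv⟩ := h
  rcases last_or_end_notMem hL hs with h | h
  · obtain rfl : s' = s := Option.some.inj (hs'.symm.trans h)
    exact SolitonNetwork.end_notMem hv
  · exact h

end SolitonNetwork

namespace Herd

variable {N : SpectralNetwork π B St Jt} {m : ℕ} (H : Herd N m)

lemma chain (l : Fin m) (e : HorseStreet) : H.path l e ≠ [] ∧ (H.path l e).IsChain N.Passes :=
  (H.isHorse l).chain e

lemma exists_pred {l : Fin m} (h : l.val ≠ 0) : ∃ k : Fin m, k.val + 1 = l.val :=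
  ⟨⟨l.val - 1, by omega⟩, by simp; omega⟩

lemma exists_succ {l : Fin m} (h : l.val + 1 ≠ m) : ∃ k : Fin m, l.val + 1 = k.val :=
  ⟨⟨l.val + 1, by omega⟩, rfl⟩

/-- Two-way streets start at joints, unless they carry the simpletons of the lower sources. -/
lemma start_notMem_or {s : St} (hs : N.TwoWay s) : (N.street s).path 0 ∉ B ∨
    ∃ l : Fin m, l.val = 0 ∧ ((H.path l .a1).head? = some s ∨ (H.path l .b1).head? = some s) := by
  obtain ⟨l, e, he⟩ := H.twoWay_mem s hs
  have I := H.isHorse l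
  have key : ∀ {l e v i j}, N.StartsAt (H.path l e) v i j → s ∈ H.path l e →
      (N.street s).path 0 ∉ B := fun {l e v i j} h hs => h.start_notMem (H.chain l e).2 hs
  by_cases hl : l.val = 0
  · have low := H.lower_source l hl
    cases e
    case a1 =>
      exact (SolitonNetwork.head_or_start_notMem (H.chain l _).2 he).elim
        (fun h => .inr ⟨l, hl, .inl h⟩) .inl
    case b1 =>
      exact (SolitonNetwork.head_or_start_notMem (H.chain l _).2 he).elim
        (fun h => .inr ⟨l, hl, .inr h⟩) .inl
    case abar3 => exact absurd (low.2.2.1 s he) hs.1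
    case bbar3 => exact absurd (low.2.2.2 s he) hs.1
    case a2 => exact .inl (key I.a2_start he)
    case a3 => exact .inl (key I.a3_start he)
    case b2 => exact .inl (key I.b2_start he)
    case b3 => exact .inl (key I.b3_start he)
    case abar1 => exact .inl (key I.abar1_start he)
    case abar2 => exact .inl (key I.abar2_start he)
    case bbar1 => exact .inl (key I.bbar1_start he)
    case bbar2 => exact .inl (key I.bbar2_start he)
    case c => exact .inl (key I.c_start he)
  · obtain ⟨k, hk⟩ := exists_pred hl
    have I' := H.isHorse k
    left
    cases e
    case a1 => exact key I'.a3_start (H.a1_eq hk ▸ he)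
    case b1 => exact key I'.b3_start (H.b1_eq hk ▸ he)
    case abar3 => exact key I'.abar1_start (H.abar1_eq hk ▸ he)
    case bbar3 => exact key I'.bbar1_start (H.bbar1_eq hk ▸ he)
    case a2 => exact key I.a2_start he
    case a3 => exact key I.a3_start he
    case b2 => exact key I.b2_start he
    case b3 => exact key I.b3_start he
    case abar1 => exact key I.abar1_start he
    case abar2 => exact key I.abar2_start he
    case bbar1 => exact key I.bbar1_start he
    case bbar2 => exact key I.bbar2_start he
    case c => exact key I.c_start he

/-- Two-way streets end at joints, unless they carry the simpletons of the upper sources. -/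
lemma end_notMem_or {s : St} (hs : N.TwoWay s) : (N.street s).path 1 ∉ B ∨
    ∃ l : Fin m, l.val + 1 = m ∧
      ((H.path l .abar1).getLast? = some s ∨ (H.path l .bbar1).getLast? = some s) := by
  obtain ⟨l, e, he⟩ := H.twoWay_mem s hs
  have I := H.isHorse l
  have key : ∀ {l e v i j}, N.EndsAt (H.path l e) v i j → s ∈ H.path l e →
      (N.street s).path 1 ∉ B := fun {l e v i j} h hs => h.end_notMem (H.chain l e).2 hs
  by_cases hl : l.val + 1 = m
  · have up := H.upper_source l hl
    cases e
    case abar1 =>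
      exact (SolitonNetwork.last_or_end_notMem (H.chain l _).2 he).elim
        (fun h => .inr ⟨l, hl, .inl h⟩) .inl
    case bbar1 =>
      exact (SolitonNetwork.last_or_end_notMem (H.chain l _).2 he).elim
        (fun h => .inr ⟨l, hl, .inr h⟩) .inl
    case a3 => exact absurd (up.2.2.1 s he) hs.2
    case b3 => exact absurd (up.2.2.2 s he) hs.2
    case a1 => exact .inl (key I.a1_end he)
    case a2 => exact .inl (key I.a2_end he)
    case b1 => exact .inl (key I.b1_end he)
    case b2 => exact .inl (key I.b2_end he)
    case abar2 => exact .inl (key I.abar2_end he)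
    case abar3 => exact .inl (key I.abar3_end he)
    case bbar2 => exact .inl (key I.bbar2_end he)
    case bbar3 => exact .inl (key I.bbar3_end he)
    case c => exact .inl (key I.c_end he)
  · obtain ⟨k, hk⟩ := exists_succ hl
    have I' := H.isHorse k
    left
    cases e
    case abar1 => exact key I'.abar3_end (H.abar1_eq hk ▸ he)
    case bbar1 => exact key I'.bbar3_end (H.bbar1_eq hk ▸ he)
    case a3 => exact key I'.a1_end ((H.a1_eq hk).symm ▸ he)
    case b3 => exact key I'.b1_end ((H.b1_eq hk).symm ▸ he)
    case a1 => exact key I.a1_end he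
    case a2 => exact key I.a2_end he
    case b1 => exact key I.b1_end he
    case b2 => exact key I.b2_end he
    case abar2 => exact key I.abar2_end he
    case abar3 => exact key I.abar3_end he
    case bbar2 => exact key I.bbar2_end he
    case bbar3 => exact key I.bbar3_end he
    case c => exact key I.c_end he

lemma path_zero_of_twoWay {s : St} (hs : N.TwoWay s) {q : Fin 4}
    (h : (N.street s).path 0 = H.branchPoint q) :
    ∃ l : Fin m, l.val = 0 ∧ ((q = 0 ∧ (H.path l .a1).head? = some s) ∨
      (q = 1 ∧ (H.path l .b1).head? = some s)) := by
  rcases H.start_notMem_or hs with h' | ⟨l, hl, h'⟩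
  · exact absurd (h ▸ H.branchPoint_mem q) h'
  · obtain ⟨⟨sa, ha, hpa⟩, ⟨sb, hb, hpb⟩, -⟩ := H.lower_source l hl
    refine ⟨l, hl, h'.imp (fun h' => ⟨?_, h'⟩) fun h' => ⟨?_, h'⟩⟩
    · obtain rfl : s = sa := Option.some.inj (h'.symm.trans ha)
      exact H.branchPoint_inj (h.symm.trans hpa)
    · obtain rfl : s = sb := Option.some.inj (h'.symm.trans hb)
      exact H.branchPoint_inj (h.symm.trans hpb)

lemma path_one_of_twoWay {s : St} (hs : N.TwoWay s) {q : Fin 4}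
    (h : (N.street s).path 1 = H.branchPoint q) :
    ∃ l : Fin m, l.val + 1 = m ∧ ((q = 2 ∧ (H.path l .abar1).getLast? = some s) ∨
      (q = 3 ∧ (H.path l .bbar1).getLast? = some s)) := by
  rcases H.end_notMem_or hs with h' | ⟨l, hl, h'⟩
  · exact absurd (h ▸ H.branchPoint_mem q) h'
  · obtain ⟨⟨sa, ha, hpa⟩, ⟨sb, hb, hpb⟩, -⟩ := H.upper_source l hl
    refine ⟨l, hl, h'.imp (fun h' => ⟨?_, h'⟩) fun h' => ⟨?_, h'⟩⟩
    · obtain rfl : s = sa := Option.some.inj (h'.symm.trans ha)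
      exact H.branchPoint_inj (h.symm.trans hpa)
    · obtain rfl : s = sb := Option.some.inj (h'.symm.trans hb)
      exact H.branchPoint_inj (h.symm.trans hpb)

/-- The lower sources emit simpletons. -/
lemma ups_source {l : Fin m} (hl : l.val = 0) :
    N.upsL (H.path l .a1) = PowerSeries.X ∧ N.upsL (H.path l .b1) = PowerSeries.X := by
  obtain ⟨⟨sa, ha, hpa⟩, ⟨sb, hb, hpb⟩, -⟩ := H.lower_source l hl
  have key : ∀ {e s q v i j}, (H.path l e).head? = some s →
      (N.street s).path 0 = H.branchPoint q → N.EndsAt (H.path l e) v i j → (q = 0 ∨ q = 1) →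
      (q = 0 → s = sa) → (q = 1 → s = sb) → N.ups s = PowerSeries.X := by
    intro e s q v i j hs hp he hq h0 h1
    have hB : (N.street s).path 0 ∈ B := hp ▸ H.branchPoint_mem q
    refine N.simpleton_start s hB ?_ fun s' hne htw => ⟨fun h => ?_, fun h => ?_⟩
    · intro h
      exact he.end_notMem (H.chain l e).2 (List.mem_of_mem_head? hs) (h ▸ hB)
    · obtain ⟨k, hk, ⟨hq, h2⟩ | ⟨hq, h2⟩⟩ := H.path_zero_of_twoWay htw (h.trans hp) <;>
        obtain rfl : k = l := Fin.ext (hk.trans hl.symm)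
      · exact hne ((Option.some.inj (h2.symm.trans ha)).trans (h0 hq).symm)
      · exact hne ((Option.some.inj (h2.symm.trans hb)).trans (h1 hq).symm)
    · obtain ⟨k, hk, ⟨hq', h2⟩ | ⟨hq', h2⟩⟩ := H.path_one_of_twoWay htw (h.trans hp) <;>
        subst hq' <;> exact absurd hq (by decide)
  constructor
  · have := key ha hpa (H.isHorse l).a1_end (.inl rfl) (fun _ => rfl) (fun h => absurd h (by decide))
    rw [← this]
    obtain ⟨L', h⟩ := List.head?_eq_some_iff.1 ha
    rw [h]; rfl
  · have := key hb hpb (H.isHorse l).b1_end (.inr rfl) (fun h => absurd h (by decide)) (fun _ => rfl)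
    rw [← this]
    obtain ⟨L', h⟩ := List.head?_eq_some_iff.1 hb
    rw [h]; rfl

/-- The upper sources emit simpletons. -/
lemma del_source {l : Fin m} (hl : l.val + 1 = m) :
    expChain (-N.trans (H.path l .abar1)) * N.delL (H.path l .abar1) = PowerSeries.X ∧
      expChain (-N.trans (H.path l .bbar1)) * N.delL (H.path l .bbar1) = PowerSeries.X := by
  obtain ⟨⟨sa, ha, hpa⟩, ⟨sb, hb, hpb⟩, -⟩ := H.upper_source l hl
  have key : ∀ {e s q v i j}, (H.path l e).getLast? = some s →
      (N.street s).path 1 = H.branchPoint q → N.StartsAt (H.path l e) v i j → (q = 2 ∨ q = 3) →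
      (q = 2 → s = sa) → (q = 3 → s = sb) → N.delEnd s = PowerSeries.X := by
    intro e s q v i j hs hp he hq h0 h1
    have hB : (N.street s).path 1 ∈ B := hp ▸ H.branchPoint_mem q
    refine N.simpleton_end s hB ?_ fun s' hne htw => ⟨fun h => ?_, fun h => ?_⟩
    · intro h
      exact he.start_notMem (H.chain l e).2 (List.mem_of_mem_getLast? hs) (h ▸ hB)
    · obtain ⟨k, hk, ⟨hq', h2⟩ | ⟨hq', h2⟩⟩ := H.path_zero_of_twoWay htw (h.trans hp) <;>
        subst hq' <;> exact absurd hq (by decide)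
    · obtain ⟨k, hk, ⟨hq, h2⟩ | ⟨hq, h2⟩⟩ := H.path_one_of_twoWay htw (h.trans hp) <;>
        obtain rfl : k = l := Fin.ext (by omega)
      · exact hne ((Option.some.inj (h2.symm.trans ha)).trans (h0 hq).symm)
      · exact hne ((Option.some.inj (h2.symm.trans hb)).trans (h1 hq).symm)
  have ends : ∀ {e s}, (H.path l e).getLast? = some s →
      N.delEnd s = expChain (-N.trans (H.path l e)) * N.delL (H.path l e) := fun {e s} hs =>
    (SolitonNetwork.ends_of_isChain (N := N.N) (fun _ _ h => SpectralNetwork.passes_series h)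
      (H.chain l e).1 (H.chain l e).2 hs).2.1
  constructor
  · rw [← ends ha]
    exact key ha hpa (H.isHorse l).abar1_start (.inl rfl) (fun _ => rfl)
      (fun h => absurd h (by decide))
  · rw [← ends hb]
    exact key hb hpb (H.isHorse l).bbar1_start (.inr rfl) (fun h => absurd h (by decide))
      (fun _ => rfl)

lemma horseEquations (l : Fin m) : HorseEquations (R := Ser S)
    (fun e => N.upsL (H.path l e)) (fun e => N.delL (H.path l e))
    (fun e => expChain (N.trans (H.path l e))) (fun e => expChain (-N.trans (H.path l e)))
    (expChain (-N.half (H.joint l 0))) (expChain (N.half (H.joint l 3))) := by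
  have I := H.isHorse l
  have st : ∀ {e v i j}, N.StartsAt (H.path l e) v i j →
      N.tau v i j = N.upsL (H.path l e) ∧ N.nu v j i = N.delL (H.path l e) := fun h =>
    SolitonNetwork.tau_of_startsAt h
  have en : ∀ {e v i j}, N.EndsAt (H.path l e) v i j →
      N.nu v j i = expChain (N.trans (H.path l e)) * N.upsL (H.path l e) ∧
      N.tau v i j = expChain (-N.trans (H.path l e)) * N.delL (H.path l e) := fun {e v i j} h =>
    SpectralNetwork.tau_of_endsAt (H.chain l e) h
  exact HorseEquations.of_junctions (R := Ser S)
    (η := fun q => expChain (N.half (H.joint l q))) (η' := fun q => expChain (-N.half (H.joint l q)))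
    (t := fun q => N.tau (H.joint l q)) (n := fun q => N.nu (H.joint l q))
    (fun e => expChain_mul_neg _)
    (fun q => ⟨expChain_mul_neg _, N.junction₁₂ _, N.junction₂₃ _, N.junction₃₁ _, N.junction₂₁ _,
      N.junction₃₂ _, N.junction₁₃ _⟩)
    (en I.a1_end) (en I.b1_end) (st I.a2_start) (st I.b2_start) (st I.c_start) I.background₀
    (en I.a2_end) (en I.bbar3_end) (st I.a3_start) (st I.bbar2_start) I.background₁
    (en I.abar3_end) (en I.b2_end) (st I.abar2_start) (st I.b3_start) I.background₂
    (en I.abar2_end) (en I.bbar2_end) (en I.c_end) (st I.abar1_start) (st I.bbar1_start)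
    I.background₃

lemma herdEquations : HerdEquations (R := Ser S)
    (fun l e => N.upsL (H.path l e)) (fun l e => N.delL (H.path l e))
    (fun l e => expChain (N.trans (H.path l e))) (fun l e => expChain (-N.trans (H.path l e)))
    (fun l => expChain (-N.half (H.joint l 0))) (fun l => expChain (N.half (H.joint l 3)))
    PowerSeries.X where
  horse := H.horseEquations
  glue v w h := by
    have := H.glue v w h
    simp only [this, and_self]
  lower l hl := by
    obtain ⟨h1, h2⟩ := H.ups_source hl
    obtain ⟨-, -, h3, h4⟩ := H.lower_source l hl
    have key : ∀ L : List St, (∀ s ∈ L, N.ups s = 0) → N.upsL L = 0 := by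
      rintro (_ | ⟨a, L⟩) h
      · rfl
      · exact h a (by simp)
    exact ⟨h1, h2, key _ h3, key _ h4⟩
  upper l hl := by
    obtain ⟨h1, h2⟩ := H.del_source hl
    obtain ⟨-, -, h3, h4⟩ := H.upper_source l hl
    have key : ∀ L : List St, (∀ s ∈ L, N.del s = 0) → N.delL L = 0 := by
      rintro (_ | ⟨a, L⟩) h
      · rfl
      · exact h a (by simp)
    exact ⟨h1, h2, key _ h3, key _ h4⟩

end Herd

end HerdSeries

section StreetFactors

open Sing

variable {S C : Type*}
  [TopologicalSpace S] [ChartedSpace ℂ S] [IsManifold 𝓘(ℂ, ℂ) ω S]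
  [TopologicalSpace C] [ChartedSpace ℂ C]
  {π : S → C} {B : Set C} {St Jt : Type*}

lemma X_dvd_C_mul_X_pow {R : Type*} [CommRing R] (a : R) {d : ℕ} (hd : d ≠ 0) :
    (PowerSeries.X : PowerSeries R) ∣ PowerSeries.C a * PowerSeries.X ^ d :=
  (dvd_pow_self _ hd).mul_left _

/-- Substitution of a series `z` into the fixed point series and its product decomposition. -/
lemma exists_specialization {R : Type*} [CommRing R] {z : PowerSeries R} (hz : PowerSeries.X ∣ z)
    {N : ℕ} {P : PowerSeries ℤ} (hP : P = 1 + PowerSeries.X * P ^ N) :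
    ∃ F : PowerSeries R, F = 1 + z * F ^ N ∧
      ∀ m α, HasExponents m PowerSeries.X P α → HasExponents m z F α := by
  have h : PowerSeries.HasSubst z := .of_constantCoeff_zero' (PowerSeries.X_dvd_iff.1 hz)
  let φ : PowerSeries ℤ →+* PowerSeries R := (PowerSeries.substAlgHom (R := ℤ) h).toRingHom
  have hφ : φ PowerSeries.X = z := by simp [φ, PowerSeries.coe_substAlgHom, PowerSeries.subst_X h]
  refine ⟨φ P, ?_, fun m α hα => ?_⟩
  · conv_lhs => rw [hP]
    simp [hφ]
  · have := hα.map φ (by rwa [hφ])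
    rwa [hφ] at this

lemma expChain_prod_form {R : Type*} [CommRing R] (T a b c d e f g p q : R) :
    T ^ 4 * (p * (a * b * c * d * e * f * g) * q) = p * a * b * c * d * e * f * g * q * T ^ 4 := by
  ring

namespace Herd

variable {N : SpectralNetwork π B St Jt} {m : ℕ} (H : Herd N m)

lemma X_dvd_z (l : Fin m) : PowerSeries.X ∣ H.z l := by
  rw [z, expChain]
  exact X_dvd_C_mul_X_pow (R := ChargeRing S) _ four_ne_zero

lemma z_eq_prod (l : Fin m) : H.z l =
    PowerSeries.X ^ 4 * ((∏ r with r < l, (expChain (N.trans (H.path r .a1)) *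
        expChain (N.trans (H.path r .a2)) * expChain (N.trans (H.path r .b1)) *
        expChain (N.trans (H.path r .b2)))) *
      (expChain (N.trans (H.path l .a1)) * expChain (N.trans (H.path l .b1)) *
        expChain (-N.half (H.joint l 0)) * expChain (N.trans (H.path l .c)) *
        expChain (N.half (H.joint l 3)) * expChain (N.trans (H.path l .abar1)) *
        expChain (N.trans (H.path l .bbar1))) *
      ∏ r with l < r, (expChain (N.trans (H.path r .abar1)) *
        expChain (N.trans (H.path r .abar2)) * expChain (N.trans (H.path r .bbar1)) *
        expChain (N.trans (H.path r .bbar2)))) := by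
  rw [z, chargeChain]
  simp only [expChain_add, expChain_sub, expChain_sum]
  exact (expChain_prod_form (R := Ser S) _ _ _ _ _ _ _ _ _ _).symm

variable [IsManifold 𝓘(ℂ, ℂ) ω C] {K : ℕ}

lemma map_chargeChain_eq_of_exp {R : Type*} [CommRing R] (hπ : IsSimpleBranchedCover π B K)
    (f : Rel (Dir S) → R) (h0 : f 0 = 1) (hf : ∀ a b, f (a + b) = f a * f b)
    (hfib : ∀ v, f (fibreClass v) = -1) (l l' : Fin m) :
    f (cls (H.chargeChain l)) = f (cls (H.chargeChain l')) := by
  have h := H.map_chargeChain_eq hπ (unitsHom f h0 hf) (h := Additive.ofMul (-1 : Rˣ))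
    (fun v => congrArg Additive.ofMul (Units.ext (hfib v))) l l'
  exact congrArg (fun u => (u.toMul : R)) h

lemma z_eq (hπ : IsSimpleBranchedCover π B K) (l l' : Fin m) : H.z l = H.z l' := by
  have h' : chargeVar (cls (H.chargeChain l)) = chargeVar (cls (H.chargeChain l')) :=
    H.map_chargeChain_eq_of_exp (R := ChargeRing S) hπ chargeVar chargeVar_zero chargeVar_add
      chargeVar_fibreClass l l'
  rw [z, z, expChain, expChain, h']

/-- The street factors of a herd are powers of one generating series. -/
lemma qL_eq_pow (hπ : IsSimpleBranchedCover π B K) (l₀ : Fin m) {F : Ser S}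
    (hF : F = 1 + H.z l₀ * F ^ ((m - 1) ^ 2)) (l : Fin m) (e : HorseStreet) :
    N.qL (H.path l e) = F ^ herdMult l e := by
  have hc : ∀ k, 1 + N.upsL (H.path k .c) * N.delL (H.path k .c) = F := by
    refine eq_of_herd_system (R := ChargeRing S) (H.X_dvd_z l₀)
      (q := fun k => 1 + N.upsL (H.path k .c) * N.delL (H.path k .c)) (fun l => ?_) hF
    have h := H.herdEquations.q_c l
    rw [← z_eq_prod, H.z_eq hπ l l₀] at h
    exact h
  exact HerdEquations.q_eq_pow (R := Ser S) H.herdEquations (P := F) hc l e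

end Herd

end StreetFactors

section PushForward

namespace Sing

variable {X Y : Type*} [TopologicalSpace X] [TopologicalSpace Y]

lemma bdry_bdrySimplex (s : C(stdSimplex ℝ (Fin 3), X)) : bdry (bdrySimplex s) = 0 := by
  have h0 : ∀ i j, edge i j 0 = edge i i 0 := fun i j => Subtype.ext (by simp [edge])
  have h1 : ∀ i j, edge i j 1 = edge j j 0 := fun i j => Subtype.ext (by simp [edge])
  rw [bdrySimplex, map_sub, map_add, bdry_ofPath, bdry_ofPath, bdry_ofPath]
  simp only [ContinuousMap.comp_apply]
  rw [h1 0 1, h0 0 1, h1 1 2, h0 1 2, h1 0 2, h0 0 2]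
  abel

lemma bdry_eq_zero_of_mem {c : Chain1 X} (hc : c ∈ boundaries X) : bdry c = 0 := by
  have : boundaries X ≤ (bdry (X := X)).ker := by
    rw [boundaries, AddSubgroup.closure_le]
    rintro _ ⟨s, rfl⟩
    exact bdry_bdrySimplex s
  exact this hc

lemma push_ofPath (f : C(X, Y)) (p : C(unitInterval, X)) :
    push f (ofPath p) = ofPath (f.comp p) := by
  simp [push, ofPath]

lemma push_mem_boundaries (f : C(X, Y)) {c : Chain1 X} (hc : c ∈ boundaries X) :
    push f c ∈ boundaries Y := by
  have : boundaries X ≤ (boundaries Y).comap (push f) := by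
    rw [boundaries, AddSubgroup.closure_le]
    rintro _ ⟨s, rfl⟩
    have h : push f (bdrySimplex s) = bdrySimplex (f.comp s) := by
      rw [bdrySimplex, map_sub, map_add, push_ofPath, push_ofPath, push_ofPath]
      rfl
    rw [SetLike.mem_coe, AddSubgroup.mem_comap, h]
    exact AddSubgroup.subset_closure ⟨_, rfl⟩
  exact this hc

lemma bdry_push (f : C(X, Y)) (c : Chain1 X) :
    bdry (push f c) = Finsupp.mapDomain f (bdry c) := by
  have h : (bdry (X := Y)).comp (push f) = (Finsupp.mapDomain.addMonoidHom f).comp bdry := by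
    refine Finsupp.addHom_ext fun p n => ?_
    have e : ∀ a : X →₀ ℤ, Finsupp.mapDomain f (-a) = -Finsupp.mapDomain f a := fun a =>
      map_neg (Finsupp.mapDomain.addMonoidHom f) a
    simp [push, bdry, Finsupp.mapDomain_single, sub_eq_add_neg, Finsupp.mapDomain_add, e]
  exact DFunLike.congr_fun h c

/-- Push-forward of chains modulo boundaries. -/
noncomputable def pushRel (f : C(X, Y)) : Rel X →+ Rel Y :=
  QuotientAddGroup.map _ _ (push f) fun _ h => push_mem_boundaries f h

lemma HasClass.of_cls_eq {c c' : Chain1 X} {γ : H1 X} (h : HasClass c' γ) {k : ℤ}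
    (hk : cls c = k • cls c') : HasClass c (k • γ) := by
  obtain ⟨hc', rfl⟩ := h
  have hm : c - k • c' ∈ boundaries X := by
    rw [← QuotientAddGroup.eq_zero_iff]
    change cls (c - k • c') = 0
    rw [cls_sub, hk, ← clsHom_apply, ← clsHom_apply, map_zsmul, sub_self]
  have hc : bdry c = 0 := by
    have := bdry_eq_zero_of_mem hm
    rwa [map_sub, map_zsmul, AddMonoidHom.mem_ker.1 hc', smul_zero, sub_zero] at this
  refine ⟨hc, ?_⟩
  rw [← QuotientAddGroup.mk_zsmul, eq_comm, QuotientAddGroup.eq, AddSubgroup.mem_addSubgroupOf]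
  simpa [neg_add_eq_sub] using hm

end Sing

end PushForward

section HerdCycle

open Sing

variable {S C : Type*}
  [TopologicalSpace S] [ChartedSpace ℂ S] [IsManifold 𝓘(ℂ, ℂ) ω S]
  [TopologicalSpace C] [ChartedSpace ℂ C]
  {π : S → C} {B : Set C} {St Jt : Type*}

lemma push_rotPath (θ : ℝ) (v : Dir S) :
    cls (push (Dir.baseMap S) (ofPath (Dir.rotPath θ v))) = 0 := by
  rw [push_ofPath]
  exact cls_const v.base

lemma Dir.rot_pi (s : ℤˣ) (v : Dir S) : Dir.rot (((s : ℤ) : ℝ) * Real.pi) v = v.neg := by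
  refine Subtype.ext ?_
  have h : Complex.exp (((((s : ℤ) : ℝ) * Real.pi : ℝ) : ℂ) * Complex.I) = -1 := by
    rcases Int.units_eq_one_or s with rfl | rfl
    · simp [Complex.exp_pi_mul_I]
    · simp [Complex.exp_neg, Complex.exp_pi_mul_I]
  rw [Dir.rot_val, h]
  exact (tneg_eq_tsmul _).symm

/-- The pair of ends, at a joint, of a soliton of type `i j`. -/
noncomputable def Network.endPair (N : Network π B St Jt) (v : Jt) (i j : Fin 3) : Dir S →₀ ℤ :=
  Finsupp.single (N.frame v j).neg 1 - Finsupp.single (N.frame v i) 1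

lemma Network.JointRun.bdry_trans {N : SolitonNetwork π B St Jt} {L : List St} {v w : Jt}
    {i j : Fin 3} (h : N.JointRun L v w i j) :
    bdry (N.trans L) = N.endPair w i j - N.endPair v i j :=
  Network.Run.bdry_trans h

namespace SolitonNetwork

variable {N : SolitonNetwork π B St Jt}

lemma bdry_half (v : Jt) : bdry (N.half v) = N.endPair v 1 1 := by
  rw [half, bdry_ofPath, Network.endPair]
  have h0 : Dir.rotPath (((N.sense : ℤ) : ℝ) * Real.pi) (N.frame v 1) 0 = N.frame v 1 := by
    refine Subtype.ext ?_
    change (Dir.rot _ _).1 = _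
    rw [Dir.rot_val]
    simp [tsmul]
  have h1 : Dir.rotPath (((N.sense : ℤ) : ℝ) * Real.pi) (N.frame v 1) 1 = (N.frame v 1).neg := by
    rw [← Dir.rot_pi N.sense]
    change Dir.rot (((N.sense : ℤ) : ℝ) * Real.pi * ((1 : unitInterval) : ℝ)) _ = _
    rw [Set.Icc.coe_one, mul_one]
  rw [h0, h1]

lemma bdry_trans_of_source {L : List St} (hL : L ≠ [] ∧ L.IsChain N.Passes) {s : St}
    (hs : L.head? = some s) (h : (N.street s).src 0 = (N.street s).tgt 0) {w : Jt} {i j : Fin 3}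
    (hij : i < j) (he : N.EndsAt L w j i) : bdry (N.trans L) = N.endPair w i j := by
  obtain ⟨s₁, he, he'⟩ := he
  have e2 := N.attach_end w j i s₁ he'
  have hr := Network.run_of_forall (N := N.toNetwork) (fun s s' h => Passes.ends h) hL.1 hL.2 hs he
  rw [hr.bdry_trans, h, sub_self, sub_zero, e2.1, e2.2]
  simp only [orient, hij, hij.not_gt, if_true, if_false, Network.endPair]

lemma bdry_trans_of_sink {L : List St} (hL : L ≠ [] ∧ L.IsChain N.Passes) {s : St}
    (hs : L.getLast? = some s) (h : (N.street s).src 1 = (N.street s).tgt 1) {v : Jt} {i j : Fin 3}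
    (hij : i < j) (hst : N.StartsAt L v i j) : bdry (N.trans L) = -N.endPair v i j := by
  obtain ⟨s₁, he, he'⟩ := hst
  have e2 := N.attach_start v i j s₁ he'
  have hr := Network.run_of_forall (N := N.toNetwork) (fun s s' h => Passes.ends h) hL.1 hL.2 he hs
  rw [hr.bdry_trans, h, sub_self, zero_sub, e2.1, e2.2]
  simp only [orient, hij, hij.not_gt, if_true, if_false, Network.endPair]

end SolitonNetwork

namespace Herd

variable {N : SpectralNetwork π B St Jt} {m : ℕ} (H : Herd N m)

lemma bdry_lower (l : Fin m) :
    (∑ r with r < l, (bdry (N.trans (H.path r .a1)) + bdry (N.trans (H.path r .a2))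
      + bdry (N.trans (H.path r .b1)) + bdry (N.trans (H.path r .b2))))
      + bdry (N.trans (H.path l .a1)) + bdry (N.trans (H.path l .b1)) =
    N.endPair (H.joint l 0) 0 1 + N.endPair (H.joint l 0) 1 2 := by
  induction l using Fin.induction_up with
  | h0 l hl =>
    obtain ⟨⟨sa, ha, hpa⟩, ⟨sb, hb, hpb⟩, -⟩ := H.lower_source l hl
    rw [sum_filter_lt_first _ hl, zero_add,
      SolitonNetwork.bdry_trans_of_source (H.chain l _) ha
        (N.branch_start _ (hpa ▸ H.branchPoint_mem _)) (by decide) (H.isHorse l).a1_end,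
      SolitonNetwork.bdry_trans_of_source (H.chain l _) hb
        (N.branch_start _ (hpb ▸ H.branchPoint_mem _)) (by decide) (H.isHorse l).b1_end]
  | hs l l' hl ih =>
    rw [sum_filter_lt_succ _ hl, H.a1_eq hl, H.b1_eq hl, (H.run_a3 hl).bdry_trans,
      (H.run_b3 hl).bdry_trans, (H.run_a2 l).bdry_trans, (H.run_b2 l).bdry_trans]
    rw [add_assoc, ← eq_sub_iff_add_eq] at ih
    rw [ih]
    abel

lemma bdry_upper (l : Fin m) :
    bdry (N.trans (H.path l .abar1)) + bdry (N.trans (H.path l .bbar1)) +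
    (∑ r with l < r, (bdry (N.trans (H.path r .abar1)) + bdry (N.trans (H.path r .abar2))
      + bdry (N.trans (H.path r .bbar1)) + bdry (N.trans (H.path r .bbar2)))) =
    -N.endPair (H.joint l 3) 0 1 - N.endPair (H.joint l 3) 1 2 := by
  induction l using Fin.induction_down with
  | h0 l hl =>
    obtain ⟨⟨sa, ha, hpa⟩, ⟨sb, hb, hpb⟩, -⟩ := H.upper_source l hl
    rw [sum_filter_gt_last _ hl, add_zero,
      SolitonNetwork.bdry_trans_of_sink (H.chain l _) ha
        (N.branch_end _ (hpa ▸ H.branchPoint_mem _)) (by decide) (H.isHorse l).abar1_start,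
      SolitonNetwork.bdry_trans_of_sink (H.chain l _) hb
        (N.branch_end _ (hpb ▸ H.branchPoint_mem _)) (by decide) (H.isHorse l).bbar1_start]
    abel
  | hs l l' hl ih =>
    rw [sum_filter_gt_succ _ hl, (H.run_abar1 hl).bdry_trans,
      (H.run_bbar1 hl).bdry_trans, (H.run_abar2 l').bdry_trans, (H.run_bbar2 l').bdry_trans]
    rw [add_comm, ← eq_sub_iff_add_eq] at ih
    rw [ih]
    abel

lemma bdry_chargeChain (l : Fin m) : bdry (H.chargeChain l) = 0 := by
  have h1 := H.bdry_lower l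
  have h2 := H.bdry_upper l
  rw [add_assoc, ← eq_sub_iff_add_eq] at h1
  rw [add_comm, ← eq_sub_iff_add_eq] at h2
  rw [H.chargeChain_eq_add, h1, h2, SolitonNetwork.bdry_half, SolitonNetwork.bdry_half,
    (H.run_c l).bdry_trans]
  simp only [Network.endPair]
  abel

lemma bdry_gammaChain (l : Fin m) : bdry (H.gammaChain l) = 0 := by
  rw [gammaChain, bdry_push, bdry_chargeChain, Finsupp.mapDomain_zero]

variable [IsManifold 𝓘(ℂ, ℂ) ω C] {K : ℕ}

lemma cls_gammaChain_eq (hπ : IsSimpleBranchedCover π B K) (l l' : Fin m) :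
    cls (H.gammaChain l) = cls (H.gammaChain l') :=
  H.map_chargeChain_eq hπ (pushRel (Dir.baseMap S)) (fun v => push_rotPath _ v) l l'

end Herd

end HerdCycle

section StreetMultiplicities

open Sing

variable {S C : Type*}
  [TopologicalSpace S] [ChartedSpace ℂ S] [IsManifold 𝓘(ℂ, ℂ) ω S]
  [TopologicalSpace C] [ChartedSpace ℂ C]
  {π : S → C} {B : Set C} {St Jt : Type*}

/-- The horse streets that represent all streets of a herd with non-trivial factor once. -/
def HorseStreet.representatives : List HorseStreet :=
  [.a1, .a2, .b1, .b2, .abar1, .abar2, .bbar1, .bbar2, .c]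

open HorseStreet in
lemma sum_herdMult {A : Type*} [AddCommGroup A] {m : ℕ} (f : Fin m → HorseStreet → A) :
    ∑ l, (representatives.map fun e => herdMult l e • f l e).sum =
      ∑ l, ((∑ r with r < l, (f r .a1 + f r .a2 + f r .b1 + f r .b2)) + f l .a1 + f l .b1 +
        f l .c + f l .abar1 + f l .bbar1 +
        ∑ r with l < r, (f r .abar1 + f r .abar2 + f r .bbar1 + f r .bbar2)) := by
  have h1 : ∀ g : Fin m → A, ∑ l, ∑ r with r < l, g r = ∑ l, (m - (l.val + 1)) • g l := by
    intro g
    rw [Finset.sum_comm' (t' := Finset.univ) (s' := fun r => Finset.univ.filter (r < ·)) (by simp)]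
    refine Finset.sum_congr rfl fun l _ => ?_
    rw [Finset.sum_const, Finset.filter_lt_eq_Ioi, Fin.card_Ioi]
    congr 1
    omega
  have h2 : ∀ g : Fin m → A, ∑ l, ∑ r with l < r, g r = ∑ l, l.val • g l := by
    intro g
    rw [Finset.sum_comm' (t' := Finset.univ) (s' := fun r => Finset.univ.filter (· < r)) (by simp)]
    refine Finset.sum_congr rfl fun l _ => ?_
    rw [Finset.sum_const, Finset.filter_gt_eq_Iio, Fin.card_Iio]
  simp only [Finset.sum_add_distrib (f := fun l : Fin m => (_ : A)), h1, h2]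
  simp only [← Finset.sum_add_distrib]
  refine Finset.sum_congr rfl fun l _ => ?_
  have h3 : m - l.val = m - (l.val + 1) + 1 := by have := l.2; omega
  simp only [representatives, herdMult, List.map_cons, List.map_nil, List.sum_cons, List.sum_nil,
    h3, add_smul, one_smul]
  abel

namespace Herd

variable {N : SpectralNetwork π B St Jt} {m : ℕ} (H : Herd N m)

open Classical in
/-- The exponent of the generating series in the factor of a street. -/
noncomputable def mult (s : St) : ℕ :=
  if h : ∃ v : Fin m × HorseStreet, s ∈ H.path v.1 v.2 then herdMult h.choose.1 h.choose.2 else 0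

lemma herdMult_of_glued {v w : Fin m × HorseStreet} (h : Glued v w) :
    herdMult v.1 v.2 = herdMult w.1 w.2 := by
  obtain ⟨l, e⟩ := v
  obtain ⟨l', e'⟩ := w
  obtain ⟨h1, h2⟩ := h
  dsimp only at h1 h2
  rcases h2 with ⟨rfl, rfl⟩ | ⟨rfl, rfl⟩ | ⟨rfl, rfl⟩ | ⟨rfl, rfl⟩ <;> simp only [herdMult] <;>
    omega

lemma mult_eq {l : Fin m} {e : HorseStreet} {s : St} (hs : s ∈ H.path l e) :
    H.mult s = herdMult l e := by
  have h : ∃ v : Fin m × HorseStreet, s ∈ H.path v.1 v.2 := ⟨(l, e), hs⟩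
  rw [mult, dif_pos h]
  rcases H.path_disjoint h.choose (l, e) s h.choose_spec hs with h' | h' | h'
  · rw [h']
  · exact herdMult_of_glued h'
  · exact (herdMult_of_glued h').symm

lemma exists_representative {s : St} (hs : H.mult s ≠ 0) :
    ∃ l, ∃ e ∈ HorseStreet.representatives, s ∈ H.path l e := by
  have h : ∃ v : Fin m × HorseStreet, s ∈ H.path v.1 v.2 := by
    by_contra h
    exact hs (dif_neg h)
  obtain ⟨⟨l, e⟩, he⟩ := h
  have hm := H.mult_eq he
  have hl := l.2
  have succ : ∀ {e}, m - (l.val + 1) = herdMult l e → H.mult s = herdMult l e →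
      ∃ k : Fin m, l.val + 1 = k.val := fun h1 h2 =>
    exists_succ fun h => hs (by rw [h2, ← h1, h]; omega)
  have pred : ∀ {e}, l.val = herdMult l e → H.mult s = herdMult l e →
      ∃ k : Fin m, k.val + 1 = l.val := fun h1 h2 =>
    exists_pred fun h => hs (by rw [h2, ← h1, h])
  by_cases hr : e ∈ HorseStreet.representatives
  · exact ⟨l, e, hr, he⟩
  · cases e <;> simp [HorseStreet.representatives] at hr
    · obtain ⟨k, hk⟩ := succ rfl hm
      exact ⟨k, .a1, by simp [HorseStreet.representatives], H.a1_eq hk ▸ he⟩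
    · obtain ⟨k, hk⟩ := succ rfl hm
      exact ⟨k, .b1, by simp [HorseStreet.representatives], H.b1_eq hk ▸ he⟩
    · obtain ⟨k, hk⟩ := pred rfl hm
      exact ⟨k, .abar1, by simp [HorseStreet.representatives], H.abar1_eq hk ▸ he⟩
    · obtain ⟨k, hk⟩ := pred rfl hm
      exact ⟨k, .bbar1, by simp [HorseStreet.representatives], H.bbar1_eq hk ▸ he⟩

lemma eq_of_mem_representative {l l' : Fin m} {e e' : HorseStreet}
    (he : e ∈ HorseStreet.representatives) (he' : e' ∈ HorseStreet.representatives) {s : St}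
    (hs : s ∈ H.path l e) (hs' : s ∈ H.path l' e') : l = l' ∧ e = e' := by
  have key : ∀ {v w : Fin m × HorseStreet}, v.2 ∈ HorseStreet.representatives →
      w.2 ∈ HorseStreet.representatives → ¬ Glued v w := by
    rintro ⟨l, e⟩ ⟨l', e'⟩ h1 h2 ⟨-, h⟩
    dsimp only at h1 h2 h
    rcases h with ⟨rfl, rfl⟩ | ⟨rfl, rfl⟩ | ⟨rfl, rfl⟩ | ⟨rfl, rfl⟩ <;>
      simp [HorseStreet.representatives] at h1 h2
  rcases H.path_disjoint (l, e) (l', e') s hs hs' with h | h | h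
  · exact Prod.mk.inj h
  · exact absurd h (key he he')
  · exact absurd h (key he' he)

/-- The factor of a street is a power of the generating series. -/
lemma Q_eq_pow {F : Ser S} (hF : ∀ l e, N.qL (H.path l e) = F ^ herdMult l e) (s : St) :
    N.Q s = F ^ H.mult s := by
  by_cases h : ∃ v : Fin m × HorseStreet, s ∈ H.path v.1 v.2
  · obtain ⟨⟨l, e⟩, he⟩ := h
    rw [SpectralNetwork.Q_eq_qL (H.chain l e).2 he, hF, H.mult_eq he]
  · have hm : H.mult s = 0 := dif_neg h
    have h2 : ¬ N.TwoWay s := fun ht => by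
      obtain ⟨l, e, he⟩ := H.twoWay_mem s ht
      exact h ⟨(l, e), he⟩
    rw [hm, pow_zero, SolitonNetwork.Q]
    by_cases hu : N.ups s = 0
    · rw [hu]; ring
    · have hd : N.del s = 0 := by
        by_contra hd
        exact h2 ⟨hu, hd⟩
      rw [hd]; ring

lemma finite_mult_ne_zero : {s | H.mult s ≠ 0}.Finite := by
  have : {s | H.mult s ≠ 0} ⊆ ⋃ l, ⋃ e ∈ HorseStreet.representatives, {s | s ∈ H.path l e} := by
    intro s hs
    obtain ⟨l, e, he, h⟩ := H.exists_representative hs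
    simp only [Set.mem_iUnion]
    exact ⟨l, e, he, h⟩
  refine Set.Finite.subset (Set.finite_iUnion fun l => ?_) this
  exact (List.finite_toSet HorseStreet.representatives).biUnion fun e _ => List.finite_toSet _

lemma push_trans (L : List St) :
    push (Dir.baseMap S) (N.trans L) = (L.map fun s => (N.street s).lift).sum := by
  rw [SolitonNetwork.trans, map_list_sum, List.map_map]
  rfl

lemma finsum_mult :
    ∑ᶠ s, H.mult s • (N.street s).lift = ∑ l, (HorseStreet.representatives.map fun e =>
      herdMult l e • push (Dir.baseMap S) (N.trans (H.path l e))).sum := by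
  classical
  have hnd : HorseStreet.representatives.Nodup := by
    simp [HorseStreet.representatives]
  let I : Finset (Fin m × HorseStreet) := Finset.univ ×ˢ HorseStreet.representatives.toFinset
  let W : Finset St := I.biUnion fun v => (H.path v.1 v.2).toFinset
  have hW : Function.support (fun s => H.mult s • (N.street s).lift) ⊆ W := by
    intro s hs
    have hm : H.mult s ≠ 0 := fun h => hs (by simp [h])
    obtain ⟨l, e, he, h⟩ := H.exists_representative hm
    simp only [W, I, Finset.coe_biUnion, Set.mem_iUnion]
    exact ⟨(l, e), by simpa using he, by simpa using h⟩
  rw [finsum_eq_sum_of_support_subset _ hW, Finset.sum_biUnion]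
  · rw [Finset.sum_product]
    refine Finset.sum_congr rfl fun l _ => ?_
    rw [List.sum_toFinset _ hnd]
    refine congrArg List.sum (List.map_congr_left fun e _ => ?_)
    rw [push_trans, ← List.sum_toFinset _ (H.path_nodup l e), Finset.smul_sum]
    refine Finset.sum_congr rfl fun s hs => ?_
    rw [H.mult_eq (List.mem_toFinset.1 hs)]
  · intro v hv w hw hvw
    rw [Function.onFun, Finset.disjoint_left]
    intro s hs hs'
    obtain ⟨h1, h2⟩ := H.eq_of_mem_representative (by simpa [I] using hv) (by simpa [I] using hw)
      (List.mem_toFinset.1 hs) (List.mem_toFinset.1 hs')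
    exact hvw (Prod.ext h1 h2)

lemma cls_gammaChain (l : Fin m) : cls (H.gammaChain l) =
    (∑ r with r < l, (cls (push (Dir.baseMap S) (N.trans (H.path r .a1)))
      + cls (push (Dir.baseMap S) (N.trans (H.path r .a2)))
      + cls (push (Dir.baseMap S) (N.trans (H.path r .b1)))
      + cls (push (Dir.baseMap S) (N.trans (H.path r .b2)))))
      + cls (push (Dir.baseMap S) (N.trans (H.path l .a1)))
      + cls (push (Dir.baseMap S) (N.trans (H.path l .b1)))
      + cls (push (Dir.baseMap S) (N.trans (H.path l .c)))
      + cls (push (Dir.baseMap S) (N.trans (H.path l .abar1)))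
      + cls (push (Dir.baseMap S) (N.trans (H.path l .bbar1)))
      + ∑ r with l < r, (cls (push (Dir.baseMap S) (N.trans (H.path r .abar1)))
      + cls (push (Dir.baseMap S) (N.trans (H.path r .abar2)))
      + cls (push (Dir.baseMap S) (N.trans (H.path r .bbar1)))
      + cls (push (Dir.baseMap S) (N.trans (H.path r .bbar2)))) := by
  have h := H.chargeChain_eq_add ((clsHom S).comp (push (Dir.baseMap S))) l
  simp only [AddMonoidHom.coe_comp, Function.comp_apply, clsHom_apply] at h
  have hh : ∀ v, cls (push (Dir.baseMap S) (N.half v)) = 0 := fun v => push_rotPath _ _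
  rw [hh, hh, sub_zero, add_zero] at h
  exact h

variable [IsManifold 𝓘(ℂ, ℂ) ω C] {K : ℕ}

lemma cls_finsum_mult (hπ : IsSimpleBranchedCover π B K) (l₀ : Fin m) :
    cls (∑ᶠ s, H.mult s • (N.street s).lift) = m • cls (H.gammaChain l₀) := by
  have h1 := sum_herdMult fun l e => cls (push (Dir.baseMap S) (N.trans (H.path l e)))
  simp only [← cls_gammaChain] at h1
  rw [Finset.sum_congr rfl fun l _ => H.cls_gammaChain_eq hπ l l₀, Finset.sum_const,
    Finset.card_univ, Fintype.card_fin] at h1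
  rw [finsum_mult, ← h1, ← clsHom_apply, map_sum]
  refine Finset.sum_congr rfl fun l _ => ?_
  rw [map_list_sum, List.map_map]
  refine congrArg List.sum (List.map_congr_left fun e _ => ?_)
  simp only [Function.comp_apply, map_nsmul, clsHom_apply]

lemma cls_streetSum (hπ : IsSimpleBranchedCover π B K) (l₀ : Fin m) (α : ℕ → ℤ) (n : ℕ) :
    cls (streetSum N (fun s n => H.mult s * α n) n) = ((m : ℤ) * α n) • cls (H.gammaChain l₀) := by
  have h : streetSum N (fun s n => H.mult s * α n) n =
      α n • ∑ᶠ s, H.mult s • (N.street s).lift := by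
    rw [streetSum, smul_finsum]
    refine finsum_congr fun s => ?_
    rw [mul_comm, mul_smul, natCast_zsmul]
  rw [h, ← clsHom_apply, map_zsmul, clsHom_apply, H.cls_finsum_mult hπ l₀, mul_comm, mul_smul,
    natCast_zsmul]

end Herd

end StreetMultiplicities

theorem proposition3p2 {S C : Type*}
    [TopologicalSpace S] [T2Space S] [ChartedSpace ℂ S] [IsManifold 𝓘(ℂ, ℂ) ω S]
    [TopologicalSpace C] [T2Space C] [ChartedSpace ℂ C] [IsManifold 𝓘(ℂ, ℂ) ω C]
    {π : S → C} {B : Set C} {K : ℕ} (hπ : IsSimpleBranchedCover π B K) (hK : 3 ≤ K)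
    {St Jt : Type*} (N : SpectralNetwork π B St Jt) {m : ℕ} (H : Herd N m) (l : Fin m) :
    -- the generating function `P` of the herd and its exponents `α` are well defined
    (∃! P : PowerSeries ℤ, P = 1 + PowerSeries.X * P ^ ((m - 1) ^ 2)) ∧
    ∀ P : PowerSeries ℤ, P = 1 + PowerSeries.X * P ^ ((m - 1) ^ 2) →
    (∃ α : ℕ → ℤ, HasExponents m PowerSeries.X P α) ∧
    ∀ α : ℕ → ℤ, HasExponents m PowerSeries.X P α →
    (∀ α' : ℕ → ℤ, HasExponents m PowerSeries.X P α' → ∀ n, 1 ≤ n → α' n = α n) ∧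
    ∃ γ : Sing.H1 S, Sing.HasClass (H.gammaChain l) γ ∧
    ∃ β : St → ℕ → ℤ,
      (∀ s, HasExponents m (H.z l) (N.Q s) (β s)) ∧
      -- the street exponents are determined by the street factors
      (Function.Injective (Int.castRingHom (ChargeRing S)) →
        ∀ s, ∀ b : ℕ → ℤ, HasExponents m (H.z l) (N.Q s) b → ∀ n, 1 ≤ n → b n = β s n) ∧
      -- the homology class of `L(n γ_c)`
      (∀ n, 1 ≤ n → {s | β s n ≠ 0}.Finite ∧
        Sing.HasClass (streetSum N β n) (((m : ℤ) * α n) • γ)) ∧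
      -- the BPS indices
      ((∀ k : ℤ, k • γ = 0 → k = 0) → ∀ Ω : Sing.H1 S → ℤ,
        (∀ n : ℕ, 1 ≤ n → Sing.HasClass (streetSum N β n) (Ω (n • γ) • (n • γ))) →
        ∀ n : ℕ, 1 ≤ n → (Ω (n • γ) : ℚ) = (m : ℚ) * (α n : ℚ) / (n : ℚ)) := by
  have hX : PowerSeries.X ∣ H.z l := H.X_dvd_z l
  refine ⟨existsUnique_fixedPoint _, fun P hP => ⟨exists_hasExponents m P ?_, fun α hα => ⟨?_, ?_⟩⟩⟩
  · rw [hP]; simp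
  · intro α' hα' n hn
    refine HasExponents.unique (R := ℤ) (a := 1) (d := 1) (m := m) (Q := P) ?_ isUnit_one le_rfl
      ?_ ?_ hn
    · exact fun a b h => by simpa using h
    · simpa using hα'
    · simpa using hα
  have hγ : Sing.bdry (H.gammaChain l) = 0 := H.bdry_gammaChain l
  obtain ⟨F, hF, hFα⟩ := exists_specialization (R := ChargeRing S) hX hP
  have hβ : ∀ s, HasExponents m (H.z l) (N.Q s) fun n => H.mult s * α n := fun s => by
    rw [H.Q_eq_pow (H.qL_eq_pow hπ l hF) s]
    exact HasExponents.pow (R := ChargeRing S) hX (hFα m α hα) (H.mult s)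
  have hc : ∀ n, Sing.HasClass (streetSum N (fun s n => H.mult s * α n) n)
      (((m : ℤ) * α n) • (QuotientAddGroup.mk ⟨_, hγ⟩ : Sing.H1 S)) := fun n =>
    Sing.HasClass.of_cls_eq ⟨hγ, rfl⟩ (H.cls_streetSum hπ l α n)
  refine ⟨QuotientAddGroup.mk ⟨_, hγ⟩, ⟨hγ, rfl⟩, fun s n => H.mult s * α n, hβ, ?_, ?_, ?_⟩
  · intro hinj s b hb n hn
    exact HasExponents.unique (R := ChargeRing S) hinj (isUnit_chargeVar _) (d := 4) (by norm_num)
      hb (hβ s) hn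
  · refine fun n _ => ⟨H.finite_mult_ne_zero.subset fun s hs h => hs ?_, hc n⟩
    simp [h]
  · intro hord Ω hΩ n hn
    obtain ⟨_, h1⟩ := hΩ n hn
    obtain ⟨_, h2⟩ := hc n
    have h3 := h1.symm.trans h2
    rw [← natCast_zsmul, ← mul_smul, ← sub_eq_zero, ← sub_smul] at h3
    have h4 := sub_eq_zero.1 (hord _ h3)
    rw [natCast_zsmul] at h4
    have hn' : (n : ℚ) ≠ 0 := by exact_mod_cast (by omega : n ≠ 0)
    rw [eq_div_iff hn']
    exact_mod_cast h4
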